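/- Let $\beta>0$, $M_\beta(z)=\frac{z-i\beta}{z+i\beta}$, $M_\beta^{-1}(z)=\frac{\beta}{i}\frac{z+1}{z-1}$, and $T(\theta)=M_\beta^{-1}(e^{i\theta})\in\mathbb R$ for $\theta\in(0,2\pi)$. For continuous $f:\mathbb R\to\mathbb C$ let $F$ be the function on the circle $\mathbb T=\mathbb R/2\pi\mathbb Z$ with $F(\theta)=f(T(\theta))$ for $\theta\in(0,2\pi)$ and $F(0)=\lim_{|x|\to\infty}f(x)$ (so $F(0)=0$ if $f$ vanishes at infinity). For $n\ge 1$ put $\theta_\ell=2\pi\ell/n$, $n_+=\lfloor n/2\rfloor$, $n_-=\lfloor (n-1)/2\rfloor$, and define the rational interpolant $$\mathcal R_nf(x)=\sum_{k=-n_-}^{n_+}\tilde F_k\,M_\beta(x)^k,\qquad \tilde F_k=\frac1n\sum_{\ell=0}^{n-1}e^{-ik\theta_\ell}F(\theta_\ell).$$ Write $\hat F_k=\frac1{2\pi}\int_0^{2\pi}e^{-ik\theta}F(\theta)\,d\theta$ and $\mathcal Fg(k)=\int_{\mathbb R}e^{-ikx}g(x)\,dx$ (in the $L^2$ sense). The space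 $H^s(\mathbb T)$ consists of the $F\in L^2(\mathbb T)$ for which $\|F\|_{H^s(\mathbb T)}^2=\sum_{k\in\mathbb Z}(1+|k|)^{2s}|\hat F_k|^2$ is finite, and $H^t(\mathbb R)$ consists of the $g\in L^2(\mathbb R)$ for which $\|g\|_{H^t(\mathbb R)}^2=\int_{\mathbb R}(1+|k|)^{2t}|\mathcal Fg(k)|^2\,dk$ is finite. The space $C_0^r(\mathbb R)$ consists of the $r$ times continuously differentiable $g$ with $g^{(j)}(x)\to0$ as $|x|\to\infty$ for $0\le j\le r$, and $\|g\|_{C_0^r(\mathbb R)}=\sum_{j=0}^r\sup_x|g^{(j)}(x)|$. Finally, $\mathcal D^j$ is the $j$-th weak derivative, and $\mathrm{p.v.}\!\int_{\mathbb R}g\,dx=\lim_{R\to\infty}\int_{-R}^Rg(x)\,dx$. Theorem. Let $s>1/2$. In the following, the constants do not depend on $n$ or $f$; besides $\beta$ they depend only on their subscripts, and no uniformity as $\epsilon\to0^+$ is claimed. For every continuous $f:\mathbb R\to\mathbb C$ with $F\in H^s(\mathbb T)$ and every $n\ge1$: - for every integer $r\ge0$ with $r<s-\frac12$: $\mathcal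 R_nf-f\in C_0^r(\mathbb R)$ and $$\|\mathcal R_nf-f\|_{C_0^r(\mathbb R)}\le C_{r,s}\,n^{1/2+r-s}\,\|F\|_{H^s(\mathbb T)};$$ - for all real $\epsilon>0$ and $t<s$ with $s>1+\epsilon$: $\mathcal R_nf-f\in H^t(\mathbb R)$ and $$\|\mathcal R_nf-f\|_{H^t(\mathbb R)}\le\left[C_{\epsilon,s}\,n^{1+\epsilon-s}+C_{s,t}\,n^{t-s}\right]\|F\|_{H^s(\mathbb T)};$$ - for every $\epsilon>0$ with $s>\frac32+\epsilon$: the principal-value integral exists and $$\left|\mathrm{p.v.}\!\int_{\mathbb R}(\mathcal R_nf(x)-f(x))\,dx\right|\le C_{\epsilon,s}\,n^{3/2+\epsilon-s}\,\|F\|_{H^s(\mathbb T)};$$ - for every integer $j$ with $0<j\le s$: the weak derivative $\mathcal D^j[\mathcal R_nf-f]$ exists, belongs to $L^1(\mathbb R)$, and $$\|\mathcal D^j[\mathcal R_nf-f]\|_{L^1(\mathbb R)}\le C_{j,s}\,n^{j-s}\,\|F\|_{H^s(\mathbb T)}.$$ -/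

import Mathlib

namespace RationalInterpolation

open MeasureTheory Filter Topology
open scoped FourierTransform ContDiff

noncomputable section

/-- The circle `ℝ / 2πℤ` is an instance of `AddCircle`. -/
instance instFactTwoPiPos : Fact (0 < 2 * Real.pi) := ⟨Real.two_pi_pos⟩

/-- The periodic interval `𝕋 = [0, 2π)` with its end points identified. -/
abbrev Torus : Type := AddCircle (2 * Real.pi)

/-! ### The change of variables -/

/-- The Möbius transformation `M_β(z) = (z - iβ) / (z + iβ)`. -/
def mobius (β : ℝ) (z : ℂ) : ℂ := (z - Complex.I * β) / (z + Complex.I * β)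

/-- The inverse Möbius transformation `M_β⁻¹(z) = (β / i) (z + 1) / (z - 1)`. -/
def mobiusInv (β : ℝ) (z : ℂ) : ℂ := (β / Complex.I) * ((z + 1) / (z - 1))

/-- `T(θ) = M_β⁻¹(e^{iθ})`. This number is real (see `ofReal_lineParam`), so it is recorded as a
real number. It is meaningful for `θ ≠ 0`. -/
def lineParam (β : ℝ) (θ : Torus) : ℝ := (mobiusInv β (AddCircle.toCircle θ : ℂ)).re

theorem toCircle_torus_coe (θ : ℝ) :
    ((AddCircle.toCircle (θ : Torus) : Circle) : ℂ) = Complex.exp (Complex.I * θ) := by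
  rw [AddCircle.toCircle_apply_mk, Circle.coe_exp, div_self Real.two_pi_pos.ne', one_mul, mul_comm]

theorem ofReal_lineParam (β : ℝ) (θ : Torus) :
    (lineParam β θ : ℂ) = mobiusInv β (AddCircle.toCircle θ : ℂ) := by
  refine Complex.conj_eq_iff_re.mp ?_
  set z : ℂ := (AddCircle.toCircle θ : ℂ) with hz
  have hz0 : z ≠ 0 := Circle.coe_ne_zero _
  have hc : (starRingEnd ℂ) z = z⁻¹ := by
    rw [hz, ← Circle.coe_inv_eq_conj, Circle.coe_inv]
  unfold mobiusInv
  simp only [map_mul, map_div₀, map_add, map_sub, map_one, Complex.conj_I, Complex.conj_ofReal, hc]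
  by_cases h1 : z = 1
  · simp [h1]
  · have h2 : z - 1 ≠ 0 := sub_ne_zero.mpr h1
    have h3 : z⁻¹ - 1 ≠ 0 := by
      intro h
      exact h1 (by simpa using congrArg Inv.inv (sub_eq_zero.mp h))
    have h4 : (1 : ℂ) - z ≠ 0 := fun h => h2 (by linear_combination -h)
    have e1 : z⁻¹ + 1 = (1 + z) / z := by field_simp
    have e2 : z⁻¹ - 1 = (1 - z) / z := by field_simp
    rw [e1, e2]
    field_simp
    ring

/-- The function on the circle that corresponds to `f : ℝ → ℂ`: `F(θ) = f(T(θ))` for `θ ≠ 0`, and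
`F(0)` is the limit of `f(x)` as `|x| → ∞`. -/
def toTorus (β : ℝ) (f : ℝ → ℂ) (θ : Torus) : ℂ :=
  open Classical in
  if θ = 0 then limUnder (cocompact ℝ) f else f (lineParam β θ)

/-! ### The periodic Sobolev spaces -/

/-- `F ∈ H^s(𝕋)`: `F ∈ L²(𝕋)` and `∑ (1 + |k|)^{2s} |F̂_k|² < ∞`, where
`F̂_k = (1 / 2π) ∫₀^{2π} e^{-ikθ} F(θ) dθ`. -/
def MemSobolevTorus (s : ℝ) (F : Torus → ℂ) : Prop :=
  MemLp F 2 (volume : Measure Torus) ∧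
    Summable fun k : ℤ => (1 + |(k : ℝ)|) ^ (2 * s) * ‖fourierCoeff F k‖ ^ 2

/-- `‖F‖_{H^s(𝕋)}`. -/
def normSobolevTorus (s : ℝ) (F : Torus → ℂ) : ℝ :=
  Real.sqrt (∑' k : ℤ, (1 + |(k : ℝ)|) ^ (2 * s) * ‖fourierCoeff F k‖ ^ 2)

/-! ### Trigonometric interpolation and its image on the line -/

/-- The node `θ_ℓ = 2πℓ / n`. -/
def node (n ℓ : ℕ) : Torus := ((2 * Real.pi * ℓ / n : ℝ) : Torus)

/-- The discrete Fourier coefficient `F̃_k = (1 / n) ∑_{ℓ < n} e^{-ikθ_ℓ} F(θ_ℓ)`. -/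
def discreteFourierCoeff (n : ℕ) (F : Torus → ℂ) (k : ℤ) : ℂ :=
  (1 / (n : ℂ)) * ∑ ℓ ∈ Finset.range n, fourier (-k) (node n ℓ) * F (node n ℓ)

/-- The rational interpolant `ℛ_n f(x) = ∑_{k = -n₋}^{n₊} F̃_k M_β(x)^k`, where `n₊ = ⌊n / 2⌋` and
`n₋ = ⌊(n - 1) / 2⌋`, that is, the trigonometric interpolant
`ℐ_n F(θ) = ∑_{k = -n₋}^{n₊} F̃_k e^{ikθ}` at `θ = T⁻¹(x)`. -/
def ratInterp (β : ℝ) (n : ℕ) (f : ℝ → ℂ) (x : ℝ) : ℂ :=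
  ∑ k ∈ Finset.Icc (-(((n - 1) / 2 : ℕ) : ℤ)) ((n / 2 : ℕ) : ℤ),
    discreteFourierCoeff n (toTorus β f) k * mobius β x ^ k

/-! ### Function spaces on the line -/

/-- `g ∈ C_0^r(ℝ)`. -/
def MemC0 (r : ℕ) (g : ℝ → ℂ) : Prop :=
  ContDiff ℝ r g ∧ ∀ j ≤ r, Tendsto (iteratedDeriv j g) (cocompact ℝ) (𝓝 0)

/-- `‖g‖_{C_0^r(ℝ)} = ∑_{j ≤ r} sup_x |g^{(j)}(x)|`. -/
def normC0 (r : ℕ) (g : ℝ → ℂ) : ℝ :=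
  ∑ j ∈ Finset.range (r + 1), ⨆ x : ℝ, ‖iteratedDeriv j g x‖

/-- The Fourier transform `ℱ g(k) = ∫ e^{-ikx} g(x) dx` of `g ∈ L²(ℝ)`, in the sense of
Plancherel (a function that is determined up to null sets). Mathlib's transform `𝓕` on `L²` has
the kernel `e^{-2πikx}`, which explains the rescaling. -/
def fourierL2 (g : ℝ → ℂ) (k : ℝ) : ℂ :=
  open Classical in
  if hg : MemLp g 2 (volume : Measure ℝ) then
    (𝓕 (hg.toLp g) : Lp ℂ 2 (volume : Measure ℝ)) (k / (2 * Real.pi))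
  else 0

/-- `g ∈ H^t(ℝ)`: `g ∈ L²(ℝ)` and `∫ (1 + |k|)^{2t} |ℱ g(k)|² dk < ∞`. -/
def MemSobolevLine (t : ℝ) (g : ℝ → ℂ) : Prop :=
  MemLp g 2 (volume : Measure ℝ) ∧
    Integrable fun k : ℝ => (1 + |k|) ^ (2 * t) * ‖fourierL2 g k‖ ^ 2

/-- `‖g‖_{H^t(ℝ)}`. -/
def normSobolevLine (t : ℝ) (g : ℝ → ℂ) : ℝ :=
  Real.sqrt (∫ k : ℝ, (1 + |k|) ^ (2 * t) * ‖fourierL2 g k‖ ^ 2)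

/-- The principal-value integral `lim_{R → ∞} ∫_{-R}^R g(x) dx` exists and equals `I`. -/
def HasPVIntegral (g : ℝ → ℂ) (I : ℂ) : Prop :=
  LocallyIntegrable g ∧ Tendsto (fun R : ℝ => ∫ x in (-R)..R, g x) atTop (𝓝 I)

/-- `w` is the `j`-th weak derivative `𝒟^j g` of `g` on `ℝ`. -/
def IsWeakDeriv (j : ℕ) (g w : ℝ → ℂ) : Prop :=
  LocallyIntegrable g ∧ LocallyIntegrable w ∧
    ∀ φ : ℝ → ℝ, ContDiff ℝ ∞ φ → HasCompactSupport φ →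
      ∫ x, ((iteratedDeriv j φ x : ℝ) : ℂ) * g x = (-1) ^ j * ∫ x, (φ x : ℂ) * w x

end

end RationalInterpolation

/-
Let `a` be the Fourier coefficients of `F`, so that `f = ∑ a_k M_β^k`. Frequencies that agree modulo
`n` coincide on the nodes, hence interpolation adds up the coefficients of each residue class, and
`ℛ_n f - f = ∑ c_k M_β^k` where `∑ c_k = 0` and, by Cauchy-Schwarz on the residue classes, the norms
of `(1 + |k|)^t c_k` in `ℓ²` and of `(1 + |k|)^r c_k` in `ℓ¹` are at most a constant times
`n^(t - s) ‖F‖` and `n^(1/2 + r - s) ‖F‖`.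

What remains are mapping properties of `c ↦ ∑ c_k M_β^k`. Write `M_β(x) = e^{iθ(x)}`. Since
`dθ/dx` is a trigonometric polynomial in `θ`, differentiation in `x` acts on `c` as a banded
operator of order one, which gives the bounds in `C_0^r`. As `dθ/dx` is moreover bounded and
integrable, one factor `dθ/dx` turns Parseval on the circle into `L¹` and `L²` bounds for the
derivatives on the line. The principal value of `∫ (M_β^k - 1)` is `O(|k|)`. For a real exponent
`t > 1`, the coefficients are split at height `R`, the low ones are estimated with `⌊t⌋ + 1`
derivatives and the high ones with a single one, and the bounds for the Fourier transform on
`|k| > R` are integrated over `R`.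
-/

namespace RationalInterpolation

open MeasureTheory Filter Topology
open scoped FourierTransform ContDiff ENNReal NNReal

noncomputable section

section Mobius

variable {β : ℝ}

theorem ofReal_add_I_mul_ne_zero (hβ : 0 < β) (x : ℝ) : (x : ℂ) + Complex.I * β ≠ 0 := fun h =>
  hβ.ne' (by simpa using congrArg Complex.im h)

theorem ofReal_sub_I_mul_ne_zero (hβ : 0 < β) (x : ℝ) : (x : ℂ) - Complex.I * β ≠ 0 := fun h =>
  hβ.ne' (by simpa using congrArg Complex.im h)

theorem mobius_ne_zero (hβ : 0 < β) (x : ℝ) : mobius β x ≠ 0 :=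
  div_ne_zero (ofReal_sub_I_mul_ne_zero hβ x) (ofReal_add_I_mul_ne_zero hβ x)

theorem mobius_neg (x : ℝ) : mobius β ((-x : ℝ) : ℂ) = (mobius β x)⁻¹ := by
  rw [mobius, mobius, inv_div, ← neg_div_neg_eq]
  push_cast
  congr 1 <;> ring

theorem mobius_eq_one_sub (hβ : 0 < β) (x : ℝ) :
    mobius β x = 1 - 2 * Complex.I * β * ((x : ℂ) + Complex.I * β)⁻¹ := by
  have := ofReal_add_I_mul_ne_zero hβ x
  rw [mobius]
  field_simp
  ring

theorem mobius_ne_one (hβ : 0 < β) (x : ℝ) : mobius β x ≠ 1 := by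
  simp [mobius_eq_one_sub hβ, hβ.ne', ofReal_add_I_mul_ne_zero hβ]

theorem mobiusInv_mobius (hβ : 0 < β) (x : ℝ) : mobiusInv β (mobius β x) = x := by
  have hb := ofReal_add_I_mul_ne_zero hβ x
  have hβ' : (β : ℂ) ≠ 0 := by exact_mod_cast hβ.ne'
  have hsum : mobius β x + 1 = 2 * x / (x + Complex.I * β) := by
    rw [mobius]; field_simp; ring
  have hdiff : mobius β x - 1 = -2 * Complex.I * β / (x + Complex.I * β) := by
    rw [mobius]; field_simp; ring
  rw [mobiusInv, hsum, hdiff, div_div_div_cancel_right₀ hb]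
  field_simp
  linear_combination (-x : ℂ) * Complex.I_sq

theorem tendsto_mobius (hβ : 0 < β) :
    Tendsto (fun x : ℝ => mobius β x) (cocompact ℝ) (𝓝 1) := by
  have hinv : Tendsto (fun x : ℝ => ((x : ℂ) + Complex.I * β)⁻¹) (cocompact ℝ) (𝓝 0) := by
    refine tendsto_inv₀_cobounded.comp (tendsto_norm_atTop_iff_cobounded.mp ?_)
    refine tendsto_atTop_mono (fun x => ?_) (tendsto_norm_cocompact_atTop (E := ℝ))
    simpa using Complex.abs_re_le_norm ((x : ℂ) + Complex.I * β)
  simp_rw [mobius_eq_one_sub hβ]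
  simpa using (hinv.const_mul (2 * Complex.I * (β : ℂ))).const_sub 1

/-- The number `T⁻¹(x) ∈ (0, 2π)`, given by the closed formula `π + 2 arctan (x / β)`. -/
def angle (β x : ℝ) : ℝ := Real.pi + 2 * Real.arctan (x / β)

/-- The derivative `2β / (x² + β²)` of `angle β`. -/
def angleDeriv (β x : ℝ) : ℝ := 2 * β / (x ^ 2 + β ^ 2)

theorem hasDerivAt_angle (hβ : 0 < β) (x : ℝ) : HasDerivAt (angle β) (angleDeriv β x) x := by
  refine ((((hasDerivAt_id x).div_const β).arctan.const_mul 2).const_add Real.pi).congr_deriv ?_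
  simp only [id, angleDeriv]
  field_simp
  ring

theorem continuous_angle (hβ : 0 < β) : Continuous (angle β) :=
  continuous_iff_continuousAt.mpr fun x => (hasDerivAt_angle hβ x).continuousAt

theorem injective_angle (hβ : 0 < β) : Function.Injective (angle β) := fun x y h => by
  have h' : Real.arctan (x / β) = Real.arctan (y / β) := by
    unfold angle at h
    linarith
  exact (div_left_inj' hβ.ne').mp (Real.arctan_injective h')

theorem range_angle (hβ : 0 < β) : Set.range (angle β) = Set.Ioo 0 (2 * Real.pi) := by
  ext θ
  constructor
  · rintro ⟨x, rfl⟩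
    have h1 := Real.neg_pi_div_two_lt_arctan (x / β)
    have h2 := Real.arctan_lt_pi_div_two (x / β)
    constructor <;> unfold angle <;> linarith
  · rintro ⟨h1, h2⟩
    refine ⟨Real.tan ((θ - Real.pi) / 2) * β, ?_⟩
    rw [angle, mul_div_cancel_right₀ _ hβ.ne', Real.arctan_tan] <;> linarith

theorem exp_angle (hβ : 0 < β) (x : ℝ) : Complex.exp (Complex.I * angle β x) = mobius β x := by
  have hb := ofReal_add_I_mul_ne_zero hβ x
  have ha := ofReal_sub_I_mul_ne_zero hβ x
  have hβ' : (β : ℂ) ≠ 0 := by exact_mod_cast hβ.ne'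
  have hsplit : (1 + ((x / β : ℝ) : ℂ) * Complex.I) / (1 - ((x / β : ℝ) : ℂ) * Complex.I) =
      -mobius β x := by
    have h1 : 1 + ((x / β : ℝ) : ℂ) * Complex.I = Complex.I / β * (x - Complex.I * β) := by
      push_cast; field_simp; linear_combination (β : ℂ) * Complex.I_sq
    have h2 : 1 - ((x / β : ℝ) : ℂ) * Complex.I = -(Complex.I / β * (x + Complex.I * β)) := by
      push_cast; field_simp; linear_combination (β : ℂ) * Complex.I_sq
    rw [h1, h2, div_neg, mobius, mul_div_mul_left _ _ (by simp [hβ.ne'])]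
  have harctan : Complex.I * (angle β x : ℂ) = Real.pi * Complex.I + Complex.log (-mobius β x) := by
    rw [angle, ← hsplit]
    push_cast [Complex.ofReal_arctan, Complex.arctan]
    linear_combination -Complex.log
      ((1 + (x / β : ℂ) * Complex.I) / (1 - (x / β : ℂ) * Complex.I)) * Complex.I_sq
  rw [harctan, Complex.exp_add, Complex.exp_pi_mul_I,
    Complex.exp_log (neg_ne_zero.mpr (mobius_ne_zero hβ x))]
  ring

theorem norm_mobius (hβ : 0 < β) (x : ℝ) : ‖mobius β x‖ = 1 := by
  rw [← exp_angle hβ, mul_comm, Complex.norm_exp_ofReal_mul_I]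

theorem norm_mobius_zpow (hβ : 0 < β) (x : ℝ) (k : ℤ) : ‖mobius β x ^ k‖ = 1 := by
  rw [norm_zpow, norm_mobius hβ, one_zpow]

theorem hasDerivAt_mobius_zpow (hβ : 0 < β) (k : ℤ) (x : ℝ) :
    HasDerivAt (fun x : ℝ => mobius β x ^ k)
      (angleDeriv β x * (Complex.I * k * mobius β x ^ k)) x := by
  have hexp : ∀ y : ℝ, mobius β y ^ k = Complex.exp (k * (Complex.I * angle β y)) := fun y => by
    rw [Complex.exp_int_mul, exp_angle hβ]
  simp_rw [hexp]
  refine (((hasDerivAt_angle hβ x).ofReal_comp.const_mul Complex.I).const_mul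
    (k : ℂ)).cexp.congr_deriv ?_
  ring

theorem continuous_mobius_zpow (hβ : 0 < β) (k : ℤ) : Continuous fun x : ℝ => mobius β x ^ k :=
  continuous_iff_continuousAt.mpr fun x => (hasDerivAt_mobius_zpow hβ k x).continuousAt

theorem angleDeriv_pos (hβ : 0 < β) (x : ℝ) : 0 < angleDeriv β x := by
  unfold angleDeriv; positivity

theorem angleDeriv_le (hβ : 0 < β) (x : ℝ) : angleDeriv β x ≤ 2 / β := by
  unfold angleDeriv
  rw [div_le_div_iff₀ (by positivity) hβ]
  nlinarith [sq_nonneg x]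

theorem continuous_angleDeriv (hβ : 0 < β) : Continuous (angleDeriv β) := by
  unfold angleDeriv
  exact continuous_const.div (by fun_prop) fun x => by positivity

theorem tendsto_angleDeriv : Tendsto (angleDeriv β) (cocompact ℝ) (𝓝 0) := by
  refine tendsto_const_nhds.div_atTop (tendsto_atTop_add_const_right _ _ ?_)
  simpa [Function.comp_def] using
    (tendsto_pow_atTop two_ne_zero).comp (tendsto_norm_cocompact_atTop (E := ℝ))

theorem ofReal_angleDeriv (hβ : 0 < β) (x : ℝ) :
    (angleDeriv β x : ℂ) = (2 - mobius β x - (mobius β x)⁻¹) / (2 * β) := by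
  have hb := ofReal_add_I_mul_ne_zero hβ x
  have ha := ofReal_sub_I_mul_ne_zero hβ x
  have hβ' : (β : ℂ) ≠ 0 := by exact_mod_cast hβ.ne'
  have hprod : (x : ℂ) ^ 2 + β ^ 2 = (x + Complex.I * β) * (x - Complex.I * β) := by
    linear_combination (β ^ 2 : ℂ) * Complex.I_sq
  rw [angleDeriv, mobius]
  push_cast
  rw [hprod]
  have hab : ((x : ℂ) + Complex.I * β) - (x - Complex.I * β) = 2 * Complex.I * β := by ring
  generalize (x : ℂ) + Complex.I * β = b at *
  generalize (x : ℂ) - Complex.I * β = a at *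
  field_simp
  linear_combination (b - a + 2 * Complex.I * β) * hab + (4 * β ^ 2 : ℂ) * Complex.I_sq

theorem fourier_angle (hβ : 0 < β) (k : ℤ) (x : ℝ) :
    fourier k (angle β x : Torus) = mobius β x ^ k := by
  rw [fourier_apply, AddCircle.toCircle_zsmul, Circle.coe_zpow, toCircle_torus_coe, exp_angle hβ]

theorem coe_angle_ne_zero (hβ : 0 < β) (x : ℝ) : (angle β x : Torus) ≠ 0 := fun h => by
  refine mobius_ne_one hβ x ?_
  rw [← exp_angle hβ, ← toCircle_torus_coe, h, AddCircle.toCircle_zero, Circle.coe_one]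

theorem exists_angle_eq (hβ : 0 < β) {θ : Torus} (hθ : θ ≠ 0) :
    ∃ x : ℝ, (angle β x : Torus) = θ := by
  obtain ⟨t, ht, rfl⟩ := AddCircle.eq_coe_Ico θ
  have ht0 : t ≠ 0 := by rintro rfl; exact hθ (AddCircle.coe_zero _)
  have hmem : t ∈ Set.range (angle β) := range_angle hβ ▸ ⟨lt_of_le_of_ne ht.1 ht0.symm, ht.2⟩
  exact hmem.imp fun x hx => by rw [hx]

theorem toTorus_angle (hβ : 0 < β) (f : ℝ → ℂ) (x : ℝ) :
    toTorus β f (angle β x : Torus) = f x := by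
  rw [toTorus, if_neg (coe_angle_ne_zero hβ x), lineParam, toCircle_torus_coe, exp_angle hβ,
    mobiusInv_mobius hβ, Complex.ofReal_re]

/-- The pullback of the Lebesgue measure of the circle to the line along `angle β`. -/
def angleMeasure (β : ℝ) : Measure ℝ :=
  volume.withDensity fun x => ENNReal.ofReal (angleDeriv β x)

theorem lintegral_angleMeasure (hβ : 0 < β) (g : ℝ → ℝ≥0∞) :
    ∫⁻ x, g x ∂angleMeasure β = ∫⁻ x, ENNReal.ofReal (angleDeriv β x) * g x :=
  lintegral_withDensity_eq_lintegral_mul_non_measurable _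
    (continuous_angleDeriv hβ).measurable.ennreal_ofReal (by simp) g

theorem measurePreserving_angle (hβ : 0 < β) :
    MeasurePreserving (fun x => (angle β x : Torus)) (angleMeasure β) volume := by
  have hmeas : Measurable (fun x => (angle β x : Torus)) :=
    AddCircle.measurable_mk'.comp (continuous_angle hβ).measurable
  refine ⟨hmeas, Measure.ext fun s hs => ?_⟩
  have hjac := lintegral_image_eq_lintegral_abs_deriv_mul MeasurableSet.univ
    (fun x _ => (hasDerivAt_angle hβ x).hasDerivWithinAt) (injective_angle hβ).injOn
    (fun t => s.indicator (1 : Torus → ℝ≥0∞) (t : Torus))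
  simp only [Set.image_univ, range_angle hβ, Measure.restrict_univ,
    abs_of_pos (angleDeriv_pos hβ _)] at hjac
  calc Measure.map (fun x => (angle β x : Torus)) (angleMeasure β) s
      = ∫⁻ x, s.indicator (1 : Torus → ℝ≥0∞) (angle β x : Torus) ∂angleMeasure β := by
        rw [← lintegral_map (measurable_one.indicator hs) hmeas, lintegral_indicator_one hs]
    _ = ∫⁻ t in Set.Ioc 0 (2 * Real.pi), s.indicator (1 : Torus → ℝ≥0∞) (t : Torus) := by
        rw [lintegral_angleMeasure hβ, ← hjac, restrict_Ioo_eq_restrict_Ioc]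
    _ = volume s := by
        rw [← lintegral_indicator_one hs, ← AddCircle.lintegral_preimage (2 * Real.pi) 0, zero_add]

theorem angleMeasure_univ (hβ : 0 < β) :
    angleMeasure β Set.univ = ENNReal.ofReal (2 * Real.pi) := by
  rw [← Set.preimage_univ, (measurePreserving_angle hβ).measure_preimage nullMeasurableSet_univ,
    AddCircle.measure_univ]

theorem volume_absolutelyContinuous_angleMeasure (hβ : 0 < β) : volume ≪ angleMeasure β :=
  withDensity_absolutelyContinuous'
    (continuous_angleDeriv hβ).measurable.ennreal_ofReal.aemeasurable
    (ae_of_all _ fun x => by simpa using angleDeriv_pos hβ x)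

end Mobius

section WeightedNorm

/-- The weight `1 + |k|` of the Sobolev norms on the circle. -/
def weight (k : ℤ) : ℝ := 1 + |(k : ℝ)|

theorem one_le_weight (k : ℤ) : 1 ≤ weight k := by simp [weight]

theorem weight_pos (k : ℤ) : 0 < weight k := one_pos.trans_le (one_le_weight k)

theorem weight_rpow_pos (k : ℤ) (s : ℝ) : 0 < weight k ^ s := Real.rpow_pos_of_pos (weight_pos k) s

theorem abs_le_weight (k : ℤ) : |(k : ℝ)| ≤ weight k := by simp [weight]

theorem weight_le_mul_weight_add (k m : ℤ) : weight k ≤ weight m * weight (k + m) := by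
  have htri : |(k : ℝ)| ≤ |(k : ℝ) + m| + |(m : ℝ)| := by
    simpa using abs_sub ((k : ℝ) + m) m
  unfold weight
  push_cast
  nlinarith [mul_nonneg (abs_nonneg (m : ℝ)) (abs_nonneg ((k : ℝ) + m))]

theorem weight_rpow_sq (k : ℤ) (s : ℝ) : (weight k ^ s) ^ 2 = weight k ^ (2 * s) := by
  rw [← Real.rpow_mul_natCast (weight_pos k).le, mul_comm s]
  norm_cast

theorem summable_weight_rpow {p : ℝ} (hp : 1 < p) : Summable fun k => weight k ^ (-p) := by
  refine (Real.summable_abs_int_rpow hp).of_norm_bounded_eventually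
    ((Set.finite_singleton (0 : ℤ)).subset fun k hk => ?_)
  by_contra hk0
  refine hk ?_
  rw [Set.mem_ofPred_eq, Real.norm_of_nonneg (weight_rpow_pos k _).le]
  exact Real.rpow_le_rpow_of_nonpos (abs_pos.mpr (Int.cast_ne_zero.mpr hk0)) (abs_le_weight k)
    (by linarith)

theorem eLpNorm_two_sq {α E : Type*} [MeasurableSpace α] [NormedAddCommGroup E] (g : α → E)
    (μ : Measure α) : eLpNorm g 2 μ ^ 2 = ∫⁻ x, ‖g x‖ₑ ^ 2 ∂μ := by
  simpa using eLpNorm_nnreal_pow_eq_lintegral (f := g) (μ := μ) (p := 2) two_ne_zero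

/-- The norm of `k ↦ (1 + |k|)^s c_k` in `ℓ^q`, with value `∞` outside the weighted space. For
`q = 2` it is the norm of `H^s(𝕋)` read on Fourier coefficients. -/
def weightedNorm (q : ℝ≥0∞) (s : ℝ) (c : ℤ → ℂ) : ℝ≥0∞ :=
  eLpNorm (fun k => (weight k ^ s) • c k) q Measure.count

variable {q : ℝ≥0∞} {s t : ℝ} {c d : ℤ → ℂ}

theorem norm_weight_rpow_smul (k : ℤ) (s : ℝ) (z : ℂ) :
    ‖(weight k ^ s) • z‖ = weight k ^ s * ‖z‖ := by
  rw [norm_smul, Real.norm_of_nonneg (weight_rpow_pos k s).le]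

theorem enorm_weight_rpow_smul (k : ℤ) (s : ℝ) (z : ℂ) :
    ‖(weight k ^ s) • z‖ₑ = ENNReal.ofReal (weight k ^ s) * ‖z‖ₑ := by
  rw [enorm_smul, Real.enorm_of_nonneg (weight_rpow_pos k s).le]

theorem weightedNorm_one : weightedNorm 1 s c = ∑' k, ‖(weight k ^ s) • c k‖ₑ := by
  rw [weightedNorm, eLpNorm_one_eq_lintegral_enorm, lintegral_count]

theorem weightedNorm_one_zero : weightedNorm 1 0 c = ∑' k, ‖c k‖ₑ := by
  simp [weightedNorm_one]

theorem weightedNorm_two_sq : weightedNorm 2 s c ^ 2 = ∑' k, ‖(weight k ^ s) • c k‖ₑ ^ 2 := by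
  rw [weightedNorm, eLpNorm_two_sq, lintegral_count]

theorem weightedNorm_le_mul_of_le {C : ℝ}
    (h : ∀ k, weight k ^ s * ‖c k‖ ≤ C * (weight k ^ t * ‖d k‖)) :
    weightedNorm q s c ≤ ENNReal.ofReal C * weightedNorm q t d :=
  eLpNorm_le_mul_eLpNorm_of_ae_le_mul
    (ae_of_all _ fun k => by simpa only [norm_weight_rpow_smul] using h k) q

theorem weightedNorm_mono (h : ∀ k, weight k ^ s * ‖c k‖ ≤ weight k ^ t * ‖d k‖) :
    weightedNorm q s c ≤ weightedNorm q t d := by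
  simpa using weightedNorm_le_mul_of_le (q := q) (C := 1) (by simpa using h)

theorem weightedNorm_mono_exponent (hst : s ≤ t) : weightedNorm q s c ≤ weightedNorm q t c :=
  weightedNorm_mono fun k => mul_le_mul_of_nonneg_right
    (Real.rpow_le_rpow_of_exponent_le (one_le_weight k) hst) (norm_nonneg _)

theorem weightedNorm_indicator_le (S : Set ℤ) :
    weightedNorm q s (S.indicator c) ≤ weightedNorm q s c :=
  weightedNorm_mono fun k => mul_le_mul_of_nonneg_left
    (norm_indicator_le_norm_self c k) (weight_rpow_pos k s).le

theorem weightedNorm_add_le (hq : 1 ≤ q) :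
    weightedNorm q s (c + d) ≤ weightedNorm q s c + weightedNorm q s d := by
  have hsum : (fun k => (weight k ^ s) • (c + d) k) =
      (fun k => (weight k ^ s) • c k) + fun k => (weight k ^ s) • d k := by
    ext1 k
    simp only [Pi.add_apply, smul_add]
  rw [weightedNorm, hsum]
  exact eLpNorm_add_le StronglyMeasurable.of_discrete.aestronglyMeasurable
    StronglyMeasurable.of_discrete.aestronglyMeasurable hq

theorem weightedNorm_neg : weightedNorm q s (-c) = weightedNorm q s c := by
  simp only [weightedNorm, Pi.neg_apply, smul_neg]
  exact eLpNorm_neg (fun k => (weight k ^ s) • c k) q Measure.count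

theorem weightedNorm_const_smul (z : ℂ) : weightedNorm q s (z • c) = ‖z‖ₑ * weightedNorm q s c := by
  rw [weightedNorm, weightedNorm, ← eLpNorm_const_smul]
  congr 1
  ext1 k
  exact smul_comm _ z (c k)

theorem weightedNorm_comp_add_le (hs : 0 ≤ s) (m : ℤ) :
    weightedNorm q s (fun k => c (k + m)) ≤ ENNReal.ofReal (weight m ^ s) * weightedNorm q s c := by
  have hshift := eLpNorm_comp_measurePreserving (p := q) (g := fun k => (weight k ^ s) • c k)
    StronglyMeasurable.of_discrete.aestronglyMeasurable
    (measurePreserving_add_right (Measure.count : Measure ℤ) m)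
  rw [weightedNorm, weightedNorm, ← hshift]
  refine eLpNorm_le_mul_eLpNorm_of_ae_le_mul (ae_of_all _ fun k => ?_) q
  rw [Function.comp_apply, norm_weight_rpow_smul, norm_weight_rpow_smul, ← mul_assoc,
    ← Real.mul_rpow (weight_pos _).le (weight_pos _).le]
  exact mul_le_mul_of_nonneg_right
    (Real.rpow_le_rpow (weight_pos k).le (weight_le_mul_weight_add k m) hs) (norm_nonneg _)

theorem weightedNorm_one_indicator_le (S : Set ℤ) (r : ℝ) :
    weightedNorm 1 r (S.indicator c) ≤
      eLpNorm (S.indicator fun k => weight k ^ (r - s)) 2 Measure.count *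
        weightedNorm 2 s (S.indicator c) := by
  refine (eLpNorm_mono_enorm fun k => le_of_eq ?_).trans (eLpNorm_smul_le_mul_eLpNorm
    (StronglyMeasurable.of_discrete.aestronglyMeasurable)
    (StronglyMeasurable.of_discrete.aestronglyMeasurable))
  by_cases hk : k ∈ S
  · simp only [Pi.smul_apply', Set.indicator_of_mem hk, smul_smul, ← Real.rpow_add (weight_pos k),
      sub_add_cancel]
  · simp [hk]

theorem weightedNorm_two_le_one (s : ℝ) (c : ℤ → ℂ) :
    weightedNorm 2 s c ≤ weightedNorm 1 s c := by
  refine (ENNReal.pow_le_pow_left_iff two_ne_zero).mp ?_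
  rw [weightedNorm_two_sq, weightedNorm_one, sq, ← ENNReal.tsum_mul_left]
  refine ENNReal.tsum_le_tsum fun k => ?_
  rw [sq]
  gcongr
  exact ENNReal.le_tsum k

theorem summable_weight_rpow_mul_norm (hc : weightedNorm 1 s c ≠ ⊤) :
    Summable fun k => weight k ^ s * ‖c k‖ := by
  rw [weightedNorm_one] at hc
  simpa only [norm_weight_rpow_smul] using (tsum_enorm_ne_top_iff_summable_norm).mp hc

theorem summable_norm_of_weightedNorm (hs : 0 ≤ s) (hc : weightedNorm 1 s c ≠ ⊤) :
    Summable fun k => ‖c k‖ := by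
  simpa using summable_weight_rpow_mul_norm
    (ne_top_of_le_ne_top hc (weightedNorm_mono_exponent hs))

theorem weightedNorm_le_indicator_add (hq : 1 ≤ q) (S : Set ℤ) :
    weightedNorm q s c ≤ weightedNorm q s (S.indicator c) + weightedNorm q s (Sᶜ.indicator c) := by
  simpa only [Set.indicator_self_add_compl] using
    weightedNorm_add_le (s := s) (c := S.indicator c) (d := Sᶜ.indicator c) hq

theorem eLpNorm_weight_rpow_ne_top (hs : 1 / 2 < s) :
    eLpNorm (fun k => weight k ^ (-s)) 2 Measure.count ≠ ⊤ := by
  refine (ENNReal.pow_ne_top_iff.mp ?_).resolve_right two_ne_zero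
  rw [eLpNorm_two_sq, lintegral_count]
  simp only [← enorm_pow, weight_rpow_sq]
  rw [tsum_enorm_ne_top_iff_summable_norm, mul_neg]
  exact (summable_weight_rpow (by linarith)).norm

theorem exists_weightedNorm_one_le {r : ℝ} (hrs : r < s - 1 / 2) :
    ∃ C : ℝ≥0, ∀ c : ℤ → ℂ, weightedNorm 1 r c ≤ C * weightedNorm 2 s c := by
  have htop := eLpNorm_weight_rpow_ne_top (s := s - r) (by linarith)
  refine ⟨(eLpNorm (fun k => weight k ^ (-(s - r))) 2 Measure.count).toNNReal, fun c => ?_⟩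
  rw [ENNReal.coe_toNNReal htop]
  simpa using weightedNorm_one_indicator_le (c := c) (s := s) Set.univ r

end WeightedNorm

section Aliasing

/-- The frequencies `-n₋, …, n₊` of the trigonometric interpolant. -/
def freqs (n : ℕ) : Finset ℤ := Finset.Icc (-(((n - 1) / 2 : ℕ) : ℤ)) ((n / 2 : ℕ) : ℤ)

/-- The frequencies `l ≡ k mod n`, which coincide with `k` on the nodes `2πℓ / n`. -/
def residueClass (n : ℕ) (k : ℤ) : Set ℤ := {l | (n : ℤ) ∣ l - k}

variable {n : ℕ} {k : ℤ} {s t : ℝ}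

theorem card_freqs (hn : 1 ≤ n) : (freqs n).card = n := by
  rw [freqs, Int.card_Icc]
  omega

theorem two_mul_abs_le_of_mem_freqs (hk : k ∈ freqs n) : 2 * |k| ≤ n := by
  rw [freqs, Finset.mem_Icc] at hk
  rcases abs_cases k with h | h <;> omega

theorem le_two_mul_abs_of_notMem_freqs (hk : k ∉ freqs n) : n ≤ 2 * |k| := by
  rw [freqs, Finset.mem_Icc] at hk
  rcases abs_cases k with h | h <;> omega

theorem weight_le_of_mem_freqs (hn : 1 ≤ n) (hk : k ∈ freqs n) : weight k ≤ 2 * n := by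
  have h : 2 * |(k : ℝ)| ≤ n := by exact_mod_cast two_mul_abs_le_of_mem_freqs hk
  have hn' : (1 : ℝ) ≤ n := by exact_mod_cast hn
  unfold weight
  linarith

theorem div_two_le_weight_of_notMem_freqs (hk : k ∉ freqs n) : (n : ℝ) / 2 ≤ weight k := by
  have h : (n : ℝ) ≤ 2 * |(k : ℝ)| := by exact_mod_cast le_two_mul_abs_of_notMem_freqs hk
  unfold weight
  linarith

theorem existsUnique_mem_freqs_mem_residueClass (hn : 1 ≤ n) (l : ℤ) :
    ∃! k, k ∈ freqs n ∧ l ∈ residueClass n k := by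
  set m : ℤ := (((n - 1) / 2 : ℕ) : ℤ) with hm
  have h1 := Int.emod_nonneg (l + m) (b := (n : ℤ)) (by omega)
  have h2 := Int.emod_lt_of_pos (l + m) (b := (n : ℤ)) (by omega)
  have h3 := Int.mul_ediv_add_emod (l + m) n
  refine ⟨(l + m) % n - m, ⟨?_, (l + m) / n, by linarith⟩, ?_⟩
  · rw [freqs, Finset.mem_Icc]
    omega
  · rintro k ⟨hk, q, hq⟩
    rw [freqs, Finset.mem_Icc] at hk
    have hmod : (l + m) % n = k + m := by
      rw [show l + m = (k + m) + n * q by linarith, Int.add_mul_emod_self_left]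
      exact Int.emod_eq_of_lt (by omega) (by omega)
    omega

theorem sum_freqs_indicator_residueClass {E : Type*} [AddCommMonoid E] (hn : 1 ≤ n) (f : ℤ → E)
    (l : ℤ) : ∑ k ∈ freqs n, (residueClass n k).indicator f l = f l := by
  obtain ⟨k₀, ⟨hk₀, hl⟩, huniq⟩ := existsUnique_mem_freqs_mem_residueClass hn l
  rw [Finset.sum_eq_single_of_mem k₀ hk₀ fun k hk hne =>
    Set.indicator_of_notMem (fun hlk => hne (huniq k ⟨hk, hlk⟩)) f, Set.indicator_of_mem hl]

theorem sum_freqs_tsum_indicator_residueClass {E : Type*} [AddCommMonoid E] [TopologicalSpace E]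
    [T2Space E] [ContinuousAdd E] (hn : 1 ≤ n) {f : ℤ → E}
    (hf : ∀ k, Summable ((residueClass n k).indicator f)) :
    ∑ k ∈ freqs n, ∑' l, (residueClass n k).indicator f l = ∑' l, f l := by
  rw [← Summable.tsum_finsetSum fun k _ => hf k]
  exact tsum_congr (sum_freqs_indicator_residueClass hn f)

theorem residueClass_eq_insert (hn : 1 ≤ n) (hk : k ∈ freqs n) :
    residueClass n k = insert k (residueClass n k ∩ (freqs n : Set ℤ)ᶜ) := by
  have hkk : k ∈ residueClass n k := ⟨0, by ring⟩
  ext l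
  constructor
  · intro hl
    by_cases hlF : l ∈ freqs n
    · have hll : l ∈ residueClass n l := ⟨0, by ring⟩
      exact Or.inl ((existsUnique_mem_freqs_mem_residueClass hn l).unique ⟨hlF, hll⟩ ⟨hk, hl⟩)
    · exact Or.inr ⟨hl, hlF⟩
  · rintro (rfl | hl)
    exacts [hkk, hl.1]

theorem weight_quotient_mul_le (hk : k ∈ freqs n) {m : ℤ} (hm : k + n * m ∉ freqs n) :
    n / 4 * weight m ≤ weight (k + n * m) := by
  have hm0 : m ≠ 0 := by rintro rfl; simp [hk] at hm
  have hm1 : (1 : ℝ) ≤ |(m : ℝ)| := by exact_mod_cast Int.one_le_abs hm0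
  have hk2 : 2 * |(k : ℝ)| ≤ n := by exact_mod_cast two_mul_abs_le_of_mem_freqs hk
  have htri : n * |(m : ℝ)| ≤ |(k : ℝ) + n * m| + |(k : ℝ)| := by
    have h := abs_sub ((k : ℝ) + n * m) k
    rwa [add_sub_cancel_left, abs_mul, Nat.abs_cast] at h
  have hn0 : (0 : ℝ) ≤ n := n.cast_nonneg
  unfold weight
  push_cast
  nlinarith

theorem weight_quotient_rpow_neg_le (hn : 1 ≤ n) (hs : 0 ≤ s) (hk : k ∈ freqs n) {m : ℤ}
    (hm : k + n * m ∉ freqs n) :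
    weight (k + n * m) ^ (-s) ≤ ((n : ℝ) / 4) ^ (-s) * weight m ^ (-s) := by
  have hn0 : (0 : ℝ) < n := by exact_mod_cast hn
  rw [← Real.mul_rpow (by positivity) (weight_pos m).le]
  exact Real.rpow_le_rpow_of_nonpos (mul_pos (by positivity) (weight_pos m))
    (weight_quotient_mul_le hk hm) (neg_nonpos.mpr hs)

theorem enorm_natCast_rpow (hn : 1 ≤ n) (p : ℝ) : ‖(n : ℝ) ^ p‖ₑ = (n : ℝ≥0∞) ^ p := by
  have hn0 : (0 : ℝ) < n := by exact_mod_cast hn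
  rw [Real.enorm_of_nonneg (by positivity), ← ENNReal.ofReal_rpow_of_pos hn0,
    ENNReal.ofReal_natCast]

theorem natCast_rpow_add (hn : 1 ≤ n) (p q : ℝ) :
    (n : ℝ≥0∞) ^ (p + q) = (n : ℝ≥0∞) ^ p * (n : ℝ≥0∞) ^ q :=
  ENNReal.rpow_add p q (by simpa using (by omega : n ≠ 0)) (ENNReal.natCast_ne_top n)

theorem exists_eLpNorm_weight_residueClass_le (hs : 1 / 2 < s) :
    ∃ C : ℝ≥0, ∀ n : ℕ, 1 ≤ n → ∀ k ∈ freqs n,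
      eLpNorm ((residueClass n k ∩ (freqs n : Set ℤ)ᶜ).indicator fun l => weight l ^ (-s)) 2
        Measure.count ≤ C * (n : ℝ≥0∞) ^ (-s) := by
  have htop := eLpNorm_weight_rpow_ne_top hs
  refine ⟨‖(4 : ℝ) ^ s‖₊ * (eLpNorm (fun l => weight l ^ (-s)) 2 Measure.count).toNNReal,
    fun n hn k hk => ?_⟩
  have hn0 : (0 : ℝ) < n := by exact_mod_cast hn
  set S := residueClass n k ∩ (freqs n : Set ℤ)ᶜ
  let quot : S → ℤ := fun l => (l - k) / n
  have hquot : ∀ l : S, k + n * quot l = l := fun l => by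
    rw [Int.mul_ediv_cancel' l.2.1]; ring
  have hinj : Function.Injective quot := fun l l' h => Subtype.ext (by rw [← hquot, h, hquot])
  have hterm : ∀ l : S, ‖weight l ^ (-s)‖ₑ ≤ ‖((n : ℝ) / 4) ^ (-s) * weight (quot l) ^ (-s)‖ₑ := by
    intro l
    have hle := weight_quotient_rpow_neg_le (s := s) hn (by linarith) hk (m := quot l)
      (by rw [hquot]; exact l.2.2)
    rw [hquot] at hle
    exact enorm_le_iff_norm_le.mpr (abs_le_abs_of_nonneg (weight_rpow_pos _ _).le hle)
  rw [← ENNReal.pow_le_pow_left_iff two_ne_zero, eLpNorm_two_sq, lintegral_count]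
  calc ∑' l, ‖S.indicator (fun l => weight l ^ (-s)) l‖ₑ ^ 2
      = ∑' l : S, ‖weight l ^ (-s)‖ₑ ^ 2 := by
        rw [tsum_subtype S fun l => ‖weight l ^ (-s)‖ₑ ^ 2]
        refine tsum_congr fun l => ?_
        by_cases hl : l ∈ S <;> simp [hl]
    _ ≤ ∑' l : S, ‖((n : ℝ) / 4) ^ (-s) * weight (quot l) ^ (-s)‖ₑ ^ 2 :=
        ENNReal.tsum_le_tsum fun l => pow_le_pow_left₀ zero_le (hterm l) 2
    _ ≤ ∑' m : ℤ, ‖((n : ℝ) / 4) ^ (-s) * weight m ^ (-s)‖ₑ ^ 2 :=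
        ENNReal.tsum_comp_le_tsum_of_injective hinj
          fun m : ℤ => ‖((n : ℝ) / 4) ^ (-s) * weight m ^ (-s)‖ₑ ^ 2
    _ = (‖((n : ℝ) / 4) ^ (-s)‖ₑ * eLpNorm (fun l => weight l ^ (-s)) 2 Measure.count) ^ 2 := by
        simp only [enorm_mul, mul_pow, ENNReal.tsum_mul_left, eLpNorm_two_sq, lintegral_count]
    _ = _ := by
        have hdiv : ((n : ℝ) / 4) ^ (-s) = 4 ^ s * (n : ℝ) ^ (-s) := by
          rw [Real.div_rpow hn0.le (by norm_num), Real.rpow_neg (by norm_num : (0 : ℝ) ≤ 4),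
            div_inv_eq_mul, mul_comm]
        rw [hdiv, enorm_mul, enorm_natCast_rpow hn, enorm_eq_nnnorm, ENNReal.coe_mul,
          ENNReal.coe_toNNReal htop]
        ring

theorem exists_eLpNorm_weight_compl_freqs_le (hs : 1 / 2 < s) :
    ∃ C : ℝ≥0, ∀ n : ℕ, 1 ≤ n →
      eLpNorm ((freqs n : Set ℤ)ᶜ.indicator fun l => weight l ^ (-s)) 2 Measure.count ≤
        C * (n : ℝ≥0∞) ^ (1 / 2 - s) := by
  obtain ⟨C, hC⟩ := exists_eLpNorm_weight_residueClass_le hs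
  refine ⟨C, fun n hn => ?_⟩
  have hsplit : ∀ k l, (residueClass n k).indicator
      (fun l => ‖(freqs n : Set ℤ)ᶜ.indicator (fun l => weight l ^ (-s)) l‖ₑ ^ 2) l =
      ‖(residueClass n k ∩ (freqs n : Set ℤ)ᶜ).indicator (fun l => weight l ^ (-s)) l‖ₑ ^ 2 := by
    intro k l
    rw [← Set.indicator_indicator]
    by_cases hl : l ∈ residueClass n k <;> simp [hl]
  rw [← ENNReal.pow_le_pow_left_iff two_ne_zero, eLpNorm_two_sq, lintegral_count,
    ← sum_freqs_tsum_indicator_residueClass hn fun _ => ENNReal.summable]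
  calc ∑ k ∈ freqs n, ∑' l, (residueClass n k).indicator
        (fun l => ‖(freqs n : Set ℤ)ᶜ.indicator (fun l => weight l ^ (-s)) l‖ₑ ^ 2) l
      ≤ ∑ _k ∈ freqs n, (C * (n : ℝ≥0∞) ^ (-s)) ^ 2 := Finset.sum_le_sum fun k hk => by
        simpa only [hsplit, eLpNorm_two_sq, lintegral_count]
          using pow_le_pow_left₀ zero_le (hC n hn k hk) 2
    _ = (n : ℝ≥0∞) ^ (1 : ℝ) * (C * (n : ℝ≥0∞) ^ (-s)) ^ 2 := by
        rw [Finset.sum_const, card_freqs hn, nsmul_eq_mul, ENNReal.rpow_one]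
    _ = _ := by
        have hhalf :
            (n : ℝ≥0∞) ^ (1 : ℝ) = (n : ℝ≥0∞) ^ (1 / 2 : ℝ) * (n : ℝ≥0∞) ^ (1 / 2 : ℝ) := by
          rw [← natCast_rpow_add hn, add_halves]
        rw [sub_eq_add_neg, natCast_rpow_add hn, hhalf]
        ring

/-- The Fourier coefficients of `ℐ_n F - F` when `a` are those of `F`: interpolation adds up the
coefficients of each residue class. -/
def errCoeff (n : ℕ) (a : ℤ → ℂ) (k : ℤ) : ℂ :=
  (if k ∈ freqs n then ∑' l, (residueClass n k).indicator a l else 0) - a k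

variable {a : ℤ → ℂ}

theorem indicator_compl_freqs_errCoeff :
    (freqs n : Set ℤ)ᶜ.indicator (errCoeff n a) = -(freqs n : Set ℤ)ᶜ.indicator a := by
  ext k
  by_cases hk : k ∈ freqs n <;> simp [errCoeff, hk]

theorem errCoeff_of_mem_freqs (hn : 1 ≤ n) (ha : Summable a) (hk : k ∈ freqs n) :
    errCoeff n a k = ∑' l, (residueClass n k ∩ (freqs n : Set ℤ)ᶜ).indicator a l := by
  have hdisj : Disjoint {k} (residueClass n k ∩ (freqs n : Set ℤ)ᶜ) :=
    Set.disjoint_singleton_left.mpr fun h => h.2 hk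
  rw [errCoeff, if_pos hk]
  conv_lhs => rw [residueClass_eq_insert hn hk, Set.insert_eq,
    Set.indicator_union_of_disjoint hdisj]
  rw [(ha.indicator _).tsum_add (ha.indicator _), ← tsum_subtype {k} a, tsum_singleton,
    add_sub_cancel_left]

theorem tsum_errCoeff (hn : 1 ≤ n) (ha : Summable a) : ∑' k, errCoeff n a k = 0 := by
  have hfin : HasSum (fun k => if k ∈ freqs n then ∑' l, (residueClass n k).indicator a l else 0)
      (∑' l, a l) := by
    rw [← sum_freqs_tsum_indicator_residueClass hn fun _ => ha.indicator _,
      ← Finset.sum_congr rfl fun k hk => if_pos hk]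
    exact hasSum_sum_of_ne_finset_zero fun k hk => if_neg hk
  simpa [errCoeff] using (hfin.sub ha.hasSum).tsum_eq

theorem sum_freqs_weightedNorm_two_sq (hn : 1 ≤ n) :
    ∑ k ∈ freqs n, weightedNorm 2 s ((residueClass n k).indicator a) ^ 2 =
      weightedNorm 2 s a ^ 2 := by
  simp only [weightedNorm_two_sq]
  rw [← sum_freqs_tsum_indicator_residueClass hn fun _ => ENNReal.summable]
  refine Finset.sum_congr rfl fun k _ => tsum_congr fun l => ?_
  by_cases hl : l ∈ residueClass n k <;> simp [hl]

theorem exists_enorm_errCoeff_le (hs : 1 / 2 < s) :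
    ∃ C : ℝ≥0, ∀ n : ℕ, 1 ≤ n → ∀ a : ℤ → ℂ, Summable a → ∀ k ∈ freqs n,
      ‖errCoeff n a k‖ₑ ≤
        C * (n : ℝ≥0∞) ^ (-s) * weightedNorm 2 s ((residueClass n k).indicator a) := by
  obtain ⟨C, hC⟩ := exists_eLpNorm_weight_residueClass_le hs
  refine ⟨C, fun n hn a ha k hk => ?_⟩
  calc ‖errCoeff n a k‖ₑ
      ≤ weightedNorm 1 0 ((residueClass n k ∩ (freqs n : Set ℤ)ᶜ).indicator a) := by
        rw [errCoeff_of_mem_freqs hn ha hk, weightedNorm_one_zero]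
        exact enorm_tsum_le_tsum_enorm
    _ ≤ _ := weightedNorm_one_indicator_le (s := s) _ 0
    _ ≤ _ := by
        have hmono : weightedNorm 2 s ((residueClass n k ∩ (freqs n : Set ℤ)ᶜ).indicator a) ≤
            weightedNorm 2 s ((residueClass n k).indicator a) := by
          rw [Set.inter_comm, ← Set.indicator_indicator]
          exact weightedNorm_indicator_le _
        rw [zero_sub]
        exact mul_le_mul' (hC n hn k hk) hmono

theorem exists_weightedNorm_two_indicator_freqs_errCoeff_le (hs : 1 / 2 < s) (ht : 0 ≤ t) :
    ∃ C : ℝ≥0, ∀ n : ℕ, 1 ≤ n → ∀ a : ℤ → ℂ, Summable a →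
      weightedNorm 2 t ((freqs n : Set ℤ).indicator (errCoeff n a)) ≤
        C * (n : ℝ≥0∞) ^ (t - s) * weightedNorm 2 s a := by
  obtain ⟨C, hC⟩ := exists_enorm_errCoeff_le hs
  refine ⟨‖(2 : ℝ) ^ t‖₊ * C, fun n hn a ha => ?_⟩
  have hterm : ∀ k ∈ freqs n, ‖(weight k ^ t) • errCoeff n a k‖ₑ ≤
      ‖(2 : ℝ) ^ t‖₊ * C * (n : ℝ≥0∞) ^ (t - s) *
        weightedNorm 2 s ((residueClass n k).indicator a) := by
    intro k hk
    have hweight : ‖weight k ^ t‖ₑ ≤ ‖(2 : ℝ) ^ t‖₊ * (n : ℝ≥0∞) ^ t := by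
      rw [← enorm_natCast_rpow hn, ← enorm_eq_nnnorm, ← enorm_mul,
        ← Real.mul_rpow zero_le_two n.cast_nonneg]
      refine enorm_le_iff_norm_le.mpr (abs_le_abs_of_nonneg (weight_rpow_pos k t).le ?_)
      exact Real.rpow_le_rpow (weight_pos k).le (weight_le_of_mem_freqs hn hk) ht
    rw [enorm_smul, sub_eq_add_neg, natCast_rpow_add hn]
    refine (mul_le_mul' hweight (hC n hn a ha k hk)).trans_eq ?_
    ring
  rw [← ENNReal.pow_le_pow_left_iff two_ne_zero, weightedNorm_two_sq, mul_pow,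
    ← sum_freqs_weightedNorm_two_sq hn, Finset.mul_sum,
    tsum_eq_sum (s := freqs n) fun k hk => by simp [hk]]
  refine Finset.sum_le_sum fun k hk => ?_
  rw [Set.indicator_of_mem (Finset.mem_coe.mpr hk), ← mul_pow, ENNReal.coe_mul]
  exact pow_le_pow_left₀ zero_le (hterm k hk) 2

theorem weightedNorm_two_indicator_compl_freqs_errCoeff_le (hn : 1 ≤ n) (hts : t ≤ s) :
    weightedNorm 2 t ((freqs n : Set ℤ)ᶜ.indicator (errCoeff n a)) ≤
      ‖(2 : ℝ) ^ (s - t)‖₊ * (n : ℝ≥0∞) ^ (t - s) * weightedNorm 2 s a := by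
  have hn0 : (0 : ℝ) < n := by exact_mod_cast hn
  rw [indicator_compl_freqs_errCoeff, weightedNorm_neg, ← enorm_natCast_rpow hn, ← enorm_eq_nnnorm,
    ← enorm_mul, Real.enorm_of_nonneg (by positivity)]
  refine weightedNorm_le_mul_of_le fun k => ?_
  by_cases hk : k ∈ freqs n
  · simp only [Set.indicator_of_notMem (Set.notMem_compl_iff.mpr hk), norm_zero, mul_zero]
    have := weight_rpow_pos k s
    positivity
  · have hweight : weight k ^ (t - s) ≤ 2 ^ (s - t) * (n : ℝ) ^ (t - s) := by
      have h := Real.rpow_le_rpow_of_nonpos (z := t - s) (by positivity)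
        (div_two_le_weight_of_notMem_freqs hk) (by linarith)
      rwa [Real.div_rpow hn0.le zero_le_two, div_eq_mul_inv, ← Real.rpow_neg zero_le_two, neg_sub,
        mul_comm] at h
    rw [Set.indicator_of_mem (by simpa using hk), ← mul_assoc]
    refine mul_le_mul_of_nonneg_right ?_ (norm_nonneg _)
    rw [← sub_add_cancel t s, Real.rpow_add (weight_pos k), sub_add_cancel]
    exact mul_le_mul_of_nonneg_right hweight (weight_rpow_pos k s).le

theorem exists_weightedNorm_two_errCoeff_le (hs : 1 / 2 < s) (ht : 0 ≤ t) (hts : t ≤ s) :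
    ∃ C : ℝ≥0, ∀ n : ℕ, 1 ≤ n → ∀ a : ℤ → ℂ, Summable a →
      weightedNorm 2 t (errCoeff n a) ≤ C * (n : ℝ≥0∞) ^ (t - s) * weightedNorm 2 s a := by
  obtain ⟨C, hC⟩ := exists_weightedNorm_two_indicator_freqs_errCoeff_le hs ht
  refine ⟨C + ‖(2 : ℝ) ^ (s - t)‖₊, fun n hn a ha => ?_⟩
  refine (weightedNorm_le_indicator_add one_le_two (freqs n : Set ℤ)).trans ?_
  rw [ENNReal.coe_add, add_mul, add_mul]
  exact add_le_add (hC n hn a ha) (weightedNorm_two_indicator_compl_freqs_errCoeff_le hn hts)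

theorem weightedNorm_one_indicator_freqs_le (hn : 1 ≤ n) (c : ℤ → ℂ) (r : ℝ) :
    weightedNorm 1 r ((freqs n : Set ℤ).indicator c) ≤
      (n : ℝ≥0∞) ^ (1 / 2 : ℝ) * weightedNorm 2 r ((freqs n : Set ℤ).indicator c) := by
  refine (weightedNorm_one_indicator_le (s := r) _ r).trans_eq ?_
  simp only [sub_self, Real.rpow_zero]
  rw [eLpNorm_indicator_const (freqs n).measurableSet two_ne_zero ENNReal.ofNat_ne_top,
    Measure.count_apply_finset, card_freqs hn]
  simp

theorem exists_weightedNorm_one_errCoeff_le {r : ℝ} (hr : 0 ≤ r) (hrs : r < s - 1 / 2) :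
    ∃ C : ℝ≥0, ∀ n : ℕ, 1 ≤ n → ∀ a : ℤ → ℂ, Summable a →
      weightedNorm 1 r (errCoeff n a) ≤
        C * (n : ℝ≥0∞) ^ (1 / 2 + r - s) * weightedNorm 2 s a := by
  obtain ⟨C₁, hC₁⟩ := exists_weightedNorm_two_indicator_freqs_errCoeff_le (s := s) (t := r)
    (by linarith) hr
  obtain ⟨C₂, hC₂⟩ := exists_eLpNorm_weight_compl_freqs_le (s := s - r) (by linarith)
  refine ⟨C₁ + C₂, fun n hn a ha => ?_⟩
  refine (weightedNorm_le_indicator_add le_rfl (freqs n : Set ℤ)).trans ?_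
  rw [ENNReal.coe_add, add_mul, add_mul]
  refine add_le_add ?_ ?_
  · rw [add_sub_assoc, natCast_rpow_add hn, mul_left_comm, mul_assoc]
    exact (weightedNorm_one_indicator_freqs_le hn _ r).trans (mul_le_mul_right (hC₁ n hn a ha) _)
  · rw [indicator_compl_freqs_errCoeff, weightedNorm_neg, add_sub_assoc, ← sub_neg_eq_add,
      ← neg_sub s r, neg_neg]
    refine (weightedNorm_one_indicator_le (s := s) _ r).trans ?_
    rw [← neg_sub s r]
    exact mul_le_mul' (hC₂ n hn) (weightedNorm_indicator_le _)

end Aliasing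

section MobiusSeries

/-- The coefficients of the derivative of `θ ↦ ∑ c_k e^{ikθ}`. -/
def derivCoeff (c : ℤ → ℂ) (k : ℤ) : ℂ := Complex.I * k * c k

/-- The coefficients of `(dθ/dx) ∑ c_k M_β^k` as a series in powers of `M_β`: the factor is
`dθ/dx = (2 - M_β - M_β⁻¹) / (2β)`, so multiplication by it only mixes neighbouring
coefficients. -/
def angleDerivCoeff (β : ℝ) (c : ℤ → ℂ) : ℤ → ℂ :=
  (1 / (2 * β) : ℂ) • ((2 : ℂ) • c + -((fun k => c (k + -1)) + fun k => c (k + 1)))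

/-- The coefficients of the derivative of `x ↦ ∑ c_k M_β(x)^k`. -/
def lineDerivCoeff (β : ℝ) (c : ℤ → ℂ) : ℤ → ℂ := angleDerivCoeff β (derivCoeff c)

/-- The function `x ↦ ∑ c_k M_β(x)^k`. -/
def mobiusSeries (β : ℝ) (c : ℤ → ℂ) (x : ℝ) : ℂ := ∑' k : ℤ, c k * mobius β x ^ k

variable {β : ℝ} {q : ℝ≥0∞} {p : ℝ} {c : ℤ → ℂ}

theorem weightedNorm_derivCoeff_le : weightedNorm q p (derivCoeff c) ≤ weightedNorm q (p + 1) c :=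
  weightedNorm_mono fun k => by
    rw [derivCoeff, norm_mul, norm_mul, Complex.norm_I, one_mul, Complex.norm_intCast,
      Real.rpow_add_one (weight_pos k).ne', mul_assoc]
    exact mul_le_mul_of_nonneg_left
      (mul_le_mul_of_nonneg_right (abs_le_weight k) (norm_nonneg _)) (weight_rpow_pos k p).le

theorem weightedNorm_angleDerivCoeff_le (hq : 1 ≤ q) (hp : 0 ≤ p) :
    weightedNorm q p (angleDerivCoeff β c) ≤
      ‖(1 / (2 * β) : ℂ)‖ₑ * (2 + 2 * ENNReal.ofReal (2 ^ p)) * weightedNorm q p c := by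
  have hshift : ∀ m : ℤ, |(m : ℝ)| = 1 → weightedNorm q p (fun k => c (k + m)) ≤
      ENNReal.ofReal (2 ^ p) * weightedNorm q p c := fun m hm => by
    have hweight : weight m = 2 := by rw [weight, hm, one_add_one_eq_two]
    simpa only [hweight] using weightedNorm_comp_add_le (q := q) (c := c) hp m
  rw [angleDerivCoeff, weightedNorm_const_smul, mul_assoc]
  refine mul_le_mul_right ((weightedNorm_add_le hq).trans ?_) _
  have htwo : ‖(2 : ℂ)‖ₑ = 2 := by simp [← ofReal_norm]
  rw [weightedNorm_neg, weightedNorm_const_smul, htwo, add_mul, mul_assoc,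
    two_mul (_ * weightedNorm q p c)]
  refine add_le_add_right ((weightedNorm_add_le hq).trans ?_) _
  exact add_le_add (hshift (-1) (by simp)) (hshift 1 (by simp))

theorem exists_weightedNorm_iterate_lineDerivCoeff_le (β : ℝ) (hq : 1 ≤ q) (hp : 0 ≤ p) (j : ℕ) :
    ∃ K : ℝ≥0, ∀ c : ℤ → ℂ,
      weightedNorm q p ((lineDerivCoeff β)^[j] c) ≤ K * weightedNorm q (p + j) c := by
  induction j generalizing p with
  | zero => exact ⟨1, fun c => by simp⟩
  | succ j ih =>
    obtain ⟨K, hK⟩ := ih (p := p + 1) (by linarith)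
    refine ⟨‖(1 / (2 * β) : ℂ)‖₊ * (2 + 2 * (2 ^ p : ℝ).toNNReal) * K, fun c => ?_⟩
    rw [Function.iterate_succ_apply', Nat.cast_succ, add_comm (j : ℝ) 1, ← add_assoc,
      ENNReal.coe_mul, mul_assoc]
    refine (weightedNorm_angleDerivCoeff_le hq hp).trans (mul_le_mul' (le_of_eq ?_)
      (weightedNorm_derivCoeff_le.trans (hK c)))
    push_cast
    rfl

theorem weightedNorm_iterate_lineDerivCoeff_ne_top {j : ℕ} {t : ℝ} (hp : 0 ≤ p) (hpj : p + j ≤ t)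
    (hc : weightedNorm 1 t c ≠ ⊤) : weightedNorm 1 p ((lineDerivCoeff β)^[j] c) ≠ ⊤ := by
  obtain ⟨K, hK⟩ := exists_weightedNorm_iterate_lineDerivCoeff_le β le_rfl hp j
  exact ne_top_of_le_ne_top
    (ENNReal.mul_ne_top ENNReal.coe_ne_top
      (ne_top_of_le_ne_top hc (weightedNorm_mono_exponent hpj))) (hK c)

theorem norm_mul_mobius_zpow (hβ : 0 < β) (k : ℤ) (x : ℝ) : ‖c k * mobius β x ^ k‖ = ‖c k‖ := by
  rw [norm_mul, norm_mobius_zpow hβ, mul_one]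

theorem hasSum_mobiusSeries (hβ : 0 < β) (hc : Summable fun k => ‖c k‖) (x : ℝ) :
    HasSum (fun k => c k * mobius β x ^ k) (mobiusSeries β c x) :=
  (Summable.of_norm (by simpa only [norm_mul_mobius_zpow hβ] using hc)).hasSum

theorem enorm_mobiusSeries_le (hβ : 0 < β) (c : ℤ → ℂ) (x : ℝ) :
    ‖mobiusSeries β c x‖ₑ ≤ weightedNorm 1 0 c := by
  rw [weightedNorm_one_zero]
  refine enorm_tsum_le_tsum_enorm.trans_eq (tsum_congr fun k => ?_)
  rw [enorm_eq_iff_norm_eq, norm_mul_mobius_zpow hβ]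

theorem continuous_mobiusSeries (hβ : 0 < β) (hc : Summable fun k => ‖c k‖) :
    Continuous (mobiusSeries β c) :=
  continuous_tsum (fun k => continuous_const.mul (continuous_mobius_zpow hβ k)) hc
    fun k x => (norm_mul_mobius_zpow hβ k x).le

theorem tendsto_mobiusSeries (hβ : 0 < β) (hc : Summable fun k => ‖c k‖) :
    Tendsto (mobiusSeries β c) (cocompact ℝ) (𝓝 (∑' k, c k)) := by
  refine tendsto_tsum_of_dominated_convergence hc (fun k => ?_)
    (Eventually.of_forall fun x k => (norm_mul_mobius_zpow hβ k x).le)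
  simpa using ((tendsto_mobius hβ).zpow₀ k (Or.inl one_ne_zero)).const_mul (c k)

theorem mobiusSeries_angleDerivCoeff (hβ : 0 < β) (hc : Summable fun k => ‖c k‖) (x : ℝ) :
    mobiusSeries β (angleDerivCoeff β c) x = angleDeriv β x * mobiusSeries β c x := by
  have hM := mobius_ne_zero hβ x
  have hshift : ∀ m : ℤ,
      HasSum (fun k => c (k + m) * mobius β x ^ (k + m)) (mobiusSeries β c x) := fun m =>
    ((Equiv.addRight m).hasSum_iff (f := fun k => c k * mobius β x ^ k)).mpr
      (hasSum_mobiusSeries hβ hc x)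
  have hsum := ((((hasSum_mobiusSeries hβ hc x).mul_left 2).sub
    ((hshift (-1)).mul_left (mobius β x))).sub ((hshift 1).mul_left (mobius β x)⁻¹)).mul_left
      (1 / (2 * β) : ℂ)
  have hterm : ∀ k, angleDerivCoeff β c k * mobius β x ^ k = 1 / (2 * β : ℂ) *
      (2 * (c k * mobius β x ^ k) - mobius β x * (c (k + -1) * mobius β x ^ (k + -1)) -
        (mobius β x)⁻¹ * (c (k + 1) * mobius β x ^ (k + 1))) := fun k => by
    rw [zpow_add₀ hM k (-1), zpow_add₀ hM k 1, zpow_neg_one, zpow_one]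
    simp only [angleDerivCoeff, Pi.smul_apply, Pi.add_apply, Pi.neg_apply, smul_eq_mul]
    field_simp
    ring
  rw [ofReal_angleDeriv hβ]
  refine ((tsum_congr hterm).trans hsum.tsum_eq).trans ?_
  ring

theorem summable_norm_derivCoeff (hc : weightedNorm 1 1 c ≠ ⊤) :
    Summable fun k => ‖derivCoeff c k‖ :=
  summable_norm_of_weightedNorm le_rfl
    (ne_top_of_le_ne_top hc (by simpa using weightedNorm_derivCoeff_le (q := 1) (p := 0)))

theorem mobiusSeries_lineDerivCoeff (hβ : 0 < β) (hc : weightedNorm 1 1 c ≠ ⊤) (x : ℝ) :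
    mobiusSeries β (lineDerivCoeff β c) x = angleDeriv β x * mobiusSeries β (derivCoeff c) x :=
  mobiusSeries_angleDerivCoeff hβ (summable_norm_derivCoeff hc) x

theorem hasDerivAt_mobiusSeries (hβ : 0 < β) (hc : weightedNorm 1 1 c ≠ ⊤) (x : ℝ) :
    HasDerivAt (mobiusSeries β c) (mobiusSeries β (lineDerivCoeff β c) x) x := by
  have hterm : ∀ k y, c k * (angleDeriv β y * (Complex.I * k * mobius β y ^ k)) =
      angleDeriv β y * (derivCoeff c k * mobius β y ^ k) := fun k y => by rw [derivCoeff]; ring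
  have hderiv := hasDerivAt_tsum (𝕜 := ℝ) (F := ℂ) ((summable_norm_derivCoeff hc).mul_left (2 / β))
    (fun k y => (hasDerivAt_mobius_zpow hβ k y).const_mul (c k)) (fun k y => ?_)
    (hasSum_mobiusSeries hβ (summable_norm_of_weightedNorm zero_le_one hc) x).summable x
  · refine hderiv.congr_deriv ?_
    rw [mobiusSeries_lineDerivCoeff hβ hc, mobiusSeries, ← tsum_mul_left]
    exact tsum_congr fun k => hterm k x
  · rw [hterm, norm_mul, norm_mul_mobius_zpow hβ, Complex.norm_real,
      Real.norm_of_nonneg (angleDeriv_pos hβ y).le]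
    exact mul_le_mul_of_nonneg_right (angleDeriv_le hβ y) (norm_nonneg _)

theorem hasDerivAt_mobiusSeries_iterate (hβ : 0 < β) {j : ℕ}
    (hc : weightedNorm 1 (j + 1) c ≠ ⊤) (x : ℝ) :
    HasDerivAt (mobiusSeries β ((lineDerivCoeff β)^[j] c))
      (mobiusSeries β ((lineDerivCoeff β)^[j + 1] c) x) x := by
  rw [Function.iterate_succ_apply']
  exact hasDerivAt_mobiusSeries hβ
    (weightedNorm_iterate_lineDerivCoeff_ne_top zero_le_one (add_comm _ _).le hc) x

theorem iteratedDeriv_mobiusSeries (hβ : 0 < β) {j : ℕ} (hc : weightedNorm 1 j c ≠ ⊤) :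
    iteratedDeriv j (mobiusSeries β c) = mobiusSeries β ((lineDerivCoeff β)^[j] c) := by
  induction j with
  | zero => simp
  | succ j ih =>
    rw [Nat.cast_succ] at hc
    rw [iteratedDeriv_succ, ih (ne_top_of_le_ne_top hc (weightedNorm_mono_exponent (by linarith)))]
    ext x
    exact (hasDerivAt_mobiusSeries_iterate hβ hc x).deriv

theorem contDiff_mobiusSeries (hβ : 0 < β) {r : ℕ} (hc : weightedNorm 1 r c ≠ ⊤) :
    ContDiff ℝ r (mobiusSeries β c) := by
  have hmono : ∀ {t : ℝ}, t ≤ r → weightedNorm 1 t c ≠ ⊤ := fun ht =>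
    ne_top_of_le_ne_top hc (weightedNorm_mono_exponent ht)
  refine contDiff_nat_iff_iteratedDeriv.mpr ⟨fun m hm => ?_, fun m hm => ?_⟩
  · rw [iteratedDeriv_mobiusSeries hβ (hmono (by exact_mod_cast hm))]
    exact continuous_mobiusSeries hβ (summable_norm_of_weightedNorm le_rfl
      (weightedNorm_iterate_lineDerivCoeff_ne_top le_rfl (by simpa using hm) hc))
  · rw [iteratedDeriv_mobiusSeries hβ (hmono (by exact_mod_cast hm.le))]
    exact fun x =>
      (hasDerivAt_mobiusSeries_iterate hβ (hmono (by exact_mod_cast hm)) x).differentiableAt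

theorem tendsto_iteratedDeriv_succ_mobiusSeries (hβ : 0 < β) {j : ℕ}
    (hc : weightedNorm 1 (j + 1 : ℕ) c ≠ ⊤) :
    Tendsto (iteratedDeriv (j + 1) (mobiusSeries β c)) (cocompact ℝ) (𝓝 0) := by
  have hiter : weightedNorm 1 1 ((lineDerivCoeff β)^[j] c) ≠ ⊤ :=
    weightedNorm_iterate_lineDerivCoeff_ne_top zero_le_one (by push_cast; linarith) hc
  have hlim := ((Complex.continuous_ofReal.tendsto 0).comp (tendsto_angleDeriv (β := β))).mul
    (tendsto_mobiusSeries hβ (summable_norm_derivCoeff hiter))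
  rw [Complex.ofReal_zero, zero_mul] at hlim
  rw [iteratedDeriv_mobiusSeries hβ hc, Function.iterate_succ_apply']
  exact hlim.congr fun x => (mobiusSeries_lineDerivCoeff hβ hiter x).symm

theorem memC0_mobiusSeries (hβ : 0 < β) {r : ℕ} (hc : weightedNorm 1 r c ≠ ⊤)
    (hsum : ∑' k, c k = 0) : MemC0 r (mobiusSeries β c) := by
  refine ⟨contDiff_mobiusSeries hβ hc, fun j hj => ?_⟩
  cases j with
  | zero =>
    rw [iteratedDeriv_zero, ← hsum]
    exact tendsto_mobiusSeries hβ (summable_norm_of_weightedNorm r.cast_nonneg hc)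
  | succ j =>
    exact tendsto_iteratedDeriv_succ_mobiusSeries hβ
      (ne_top_of_le_ne_top hc (weightedNorm_mono_exponent (by exact_mod_cast hj)))

theorem exists_normC0_mobiusSeries_le (hβ : 0 < β) (r : ℕ) :
    ∃ C : ℝ≥0, ∀ c : ℤ → ℂ,
      ENNReal.ofReal (normC0 r (mobiusSeries β c)) ≤ C * weightedNorm 1 r c := by
  choose K hK using
    exists_weightedNorm_iterate_lineDerivCoeff_le β (le_refl (1 : ℝ≥0∞)) (le_refl (0 : ℝ))
  refine ⟨1 + ∑ j ∈ Finset.range (r + 1), K j, fun c => ?_⟩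
  by_cases hc : weightedNorm 1 r c = ⊤
  · simp [hc, ENNReal.mul_top]
  have hmono : ∀ j ∈ Finset.range (r + 1), weightedNorm 1 j c ≤ weightedNorm 1 r c := fun j hj =>
    weightedNorm_mono_exponent (by exact_mod_cast Finset.mem_range_succ_iff.mp hj)
  have hsup : ∀ j ∈ Finset.range (r + 1),
      ENNReal.ofReal (⨆ x, ‖iteratedDeriv j (mobiusSeries β c) x‖) ≤
        K j * weightedNorm 1 r c := fun j hj => by
    have hle : weightedNorm 1 0 ((lineDerivCoeff β)^[j] c) ≤ K j * weightedNorm 1 r c := by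
      refine (hK j c).trans (mul_le_mul_right ?_ _)
      simpa using hmono j hj
    have htop : weightedNorm 1 0 ((lineDerivCoeff β)^[j] c) ≠ ⊤ :=
      ne_top_of_le_ne_top (ENNReal.mul_ne_top ENNReal.coe_ne_top hc) hle
    refine le_trans (ENNReal.ofReal_le_of_le_toReal (ciSup_le fun x => ?_)) hle
    rw [iteratedDeriv_mobiusSeries hβ (ne_top_of_le_ne_top hc (hmono j hj)), ← toReal_enorm]
    exact ENNReal.toReal_mono htop (enorm_mobiusSeries_le hβ _ x)
  rw [normC0, ENNReal.ofReal_sum_of_nonneg fun j _ => Real.iSup_nonneg fun x => norm_nonneg _]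
  refine (Finset.sum_le_sum hsup).trans ?_
  rw [← Finset.sum_mul, ENNReal.coe_add, ENNReal.ofNNReal_finsetSum]
  exact mul_le_mul_left le_add_self _

end MobiusSeries

section DiscreteFourier

variable {n : ℕ}

theorem fourier_node (n ℓ : ℕ) (m : ℤ) :
    fourier m (node n ℓ) = (Complex.exp (2 * Real.pi * Complex.I / n) ^ m) ^ ℓ := by
  rw [node, fourier_coe_apply, ← Complex.exp_int_mul, ← Complex.exp_nat_mul]
  congr 1
  have hpi : (Real.pi : ℂ) ≠ 0 := by exact_mod_cast Real.pi_ne_zero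
  push_cast
  field_simp

theorem sum_fourier_node (hn : 1 ≤ n) (m : ℤ) :
    ∑ ℓ ∈ Finset.range n, fourier m (node n ℓ) = if (n : ℤ) ∣ m then (n : ℂ) else 0 := by
  have hζ := Complex.isPrimitiveRoot_exp n (by omega)
  simp only [fourier_node]
  split_ifs with hdvd
  · simp [(hζ.zpow_eq_one_iff_dvd m).mpr hdvd]
  · rw [geom_sum_eq (mt (hζ.zpow_eq_one_iff_dvd m).mp hdvd), ← zpow_natCast, zpow_comm,
      zpow_natCast, hζ.pow_eq_one]
    simp

theorem discreteFourierCoeff_eq_tsum (hn : 1 ≤ n) {F : Torus → ℂ} {a : ℤ → ℂ}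
    (hF : ∀ θ, HasSum (fun k => a k * fourier k θ) (F θ)) (k : ℤ) :
    discreteFourierCoeff n F k = ∑' l, (residueClass n k).indicator a l := by
  have hn0 : (n : ℂ) ≠ 0 := by exact_mod_cast (by omega : n ≠ 0)
  have hsum : HasSum (fun l => (1 / (n : ℂ)) * ∑ ℓ ∈ Finset.range n,
      fourier (-k) (node n ℓ) * (a l * fourier l (node n ℓ))) (discreteFourierCoeff n F k) :=
    (hasSum_sum fun ℓ _ => (hF (node n ℓ)).mul_left _).mul_left _
  rw [← hsum.tsum_eq]
  refine tsum_congr fun l => ?_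
  have hterm : ∀ ℓ, fourier (-k) (node n ℓ) * (a l * fourier l (node n ℓ)) =
      a l * fourier (l - k) (node n ℓ) := fun ℓ => by
    rw [sub_eq_add_neg, fourier_add]
    ring
  simp only [hterm, ← Finset.mul_sum, sum_fourier_node hn, Set.indicator_apply, residueClass,
    Set.mem_ofPred_eq]
  split_ifs
  · field_simp
  · simp

end DiscreteFourier

section FourierSeries

variable {a : ℤ → ℂ}

/-- The function `θ ↦ ∑ a_k e^{ikθ}` on the circle, for absolutely summable `a`. -/
def fourierSum (a : ℤ → ℂ) : C(Torus, ℂ) := ∑' k, a k • fourier k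

theorem hasSum_fourierSum (ha : Summable fun k => ‖a k‖) :
    HasSum (fun k => a k • fourier k) (fourierSum a) :=
  Summable.hasSum (Summable.of_norm (by simpa only [norm_smul, fourier_norm, mul_one] using ha))

theorem hasSum_fourierSum_apply (ha : Summable fun k => ‖a k‖) (θ : Torus) :
    HasSum (fun k => a k * fourier k θ) (fourierSum a θ) := by
  simpa using (ContinuousMap.evalCLM ℂ θ).hasSum (hasSum_fourierSum ha)

/-- `fourierSum a` as an element of `L²` of the circle with its normalised measure. -/
def fourierSumLp (a : ℤ → ℂ) : Lp ℂ 2 (AddCircle.haarAddCircle (T := 2 * Real.pi)) :=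
  ContinuousMap.toLp 2 _ ℂ (fourierSum a)

theorem repr_fourierSumLp (ha : Summable fun k => ‖a k‖) (k : ℤ) :
    fourierBasis.repr (fourierSumLp a) k = a k := by
  have hsum : HasSum (fun l => a l • fourierLp 2 l) (fourierSumLp a) := by
    simpa only [map_smul] using! (ContinuousMap.toLp (E := ℂ) 2
      (AddCircle.haarAddCircle (T := 2 * Real.pi)) ℂ).hasSum (hasSum_fourierSum ha)
  have hinner := (innerSL ℂ (fourierLp (T := 2 * Real.pi) 2 k)).hasSum hsum
  have horth : ∀ l, innerSL ℂ (fourierLp (T := 2 * Real.pi) 2 k) (a l • fourierLp 2 l) =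
      if l = k then a k else 0 := fun l => by
    rw [map_smul, innerSL_apply_apply, orthonormal_iff_ite.mp orthonormal_fourier k l]
    by_cases hlk : l = k
    · simp [hlk]
    · simp [hlk, Ne.symm hlk]
  rw [HilbertBasis.repr_apply_apply, coe_fourierBasis, ← innerSL_apply_apply, ← hinner.tsum_eq]
  exact (tsum_congr horth).trans (tsum_ite_eq k _)

theorem eLpNorm_fourierSum (ha : Summable fun k => ‖a k‖) :
    eLpNorm (fourierSum a) 2 AddCircle.haarAddCircle = weightedNorm 2 0 a := by
  have hnorm : HasSum (fun k => ‖a k‖ ^ 2) (‖fourierSumLp a‖ ^ 2) := by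
    have h := lp.hasSum_norm (p := 2) (by simp) (fourierBasis.repr (fourierSumLp a))
    simpa only [LinearIsometryEquiv.norm_map, repr_fourierSumLp ha, ENNReal.toReal_ofNat,
      Real.rpow_ofNat] using h
  have hLp : eLpNorm (fourierSum a) 2 AddCircle.haarAddCircle = ‖fourierSumLp a‖ₑ := by
    rw [Lp.enorm_def]
    exact eLpNorm_congr_ae (ContinuousMap.coeFn_toLp _ _).symm
  rw [hLp]
  apply (ENNReal.pow_right_strictMono two_ne_zero).injective
  simp only [weightedNorm_two_sq, Real.rpow_zero, one_smul, ← ofReal_norm,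
    ← ENNReal.ofReal_pow (norm_nonneg _)]
  rw [← hnorm.tsum_eq, ENNReal.ofReal_tsum_of_nonneg (fun k => sq_nonneg _) hnorm.summable]

theorem ae_eq_fourierSum {F : Torus → ℂ} (hF : MemLp F 2 (volume : Measure Torus))
    (ha : Summable fun k => ‖fourierCoeff F k‖) :
    F =ᵐ[volume] fourierSum (fourierCoeff F) := by
  have hmem : MemLp F 2 (AddCircle.haarAddCircle (T := 2 * Real.pi)) :=
    memLp_haarAddCircle_iff.mpr hF
  have hLp : hmem.toLp = fourierSumLp (fourierCoeff F) := by
    refine fourierBasis.repr.injective (lp.ext (funext fun k => ?_))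
    rw [repr_fourierSumLp ha, fourierBasis_repr, fourierCoeff_congr_ae hmem.coeFn_toLp]
  have hae : F =ᵐ[AddCircle.haarAddCircle] fourierSum (fourierCoeff F) :=
    hmem.coeFn_toLp.symm.trans (hLp ▸ ContinuousMap.coeFn_toLp _ _)
  rw [AddCircle.volume_eq_smul_haarAddCircle]
  exact Measure.ae_smul_measure hae _

end FourierSeries

section Identification

variable {β s : ℝ} {f : ℝ → ℂ} {F : Torus → ℂ} {a : ℤ → ℂ}

theorem weightedNorm_fourierCoeff (hF : MemSobolevTorus s F) :
    weightedNorm 2 s (fourierCoeff F) = ENNReal.ofReal (normSobolevTorus s F) := by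
  apply (ENNReal.pow_right_strictMono two_ne_zero).injective
  simp only [weightedNorm_two_sq, normSobolevTorus]
  rw [← ENNReal.ofReal_pow (Real.sqrt_nonneg _), Real.sq_sqrt (tsum_nonneg fun k => by positivity),
    ENNReal.ofReal_tsum_of_nonneg (fun k => by positivity) hF.2]
  refine tsum_congr fun k => ?_
  rw [← ofReal_norm, norm_weight_rpow_smul, ← ENNReal.ofReal_pow
    (mul_nonneg (weight_rpow_pos k s).le (norm_nonneg _)), mul_pow, weight_rpow_sq, weight]

theorem summable_norm_fourierCoeff (hs : 1 / 2 < s) (hF : MemSobolevTorus s F) :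
    Summable fun k => ‖fourierCoeff F k‖ := by
  obtain ⟨C, hC⟩ := exists_weightedNorm_one_le (r := 0) (s := s) (by linarith)
  refine summable_norm_of_weightedNorm le_rfl (ne_top_of_le_ne_top ?_ (hC _))
  rw [weightedNorm_fourierCoeff hF]
  exact ENNReal.mul_ne_top ENNReal.coe_ne_top ENNReal.ofReal_ne_top

theorem mobiusSeries_eq_fourierSum (hβ : 0 < β) (ha : Summable fun k => ‖a k‖) (x : ℝ) :
    mobiusSeries β a x = fourierSum a (angle β x : Torus) := by
  rw [← (hasSum_fourierSum_apply ha _).tsum_eq]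
  simp only [fourier_angle hβ, mobiusSeries]

theorem eLpNorm_mobiusSeries_angleMeasure (hβ : 0 < β) (ha : Summable fun k => ‖a k‖) :
    eLpNorm (mobiusSeries β a) 2 (angleMeasure β) =
      ENNReal.ofReal (2 * Real.pi) ^ (1 / 2 : ℝ) * weightedNorm 2 0 a := by
  have hcomp := eLpNorm_comp_measurePreserving (p := 2) (g := fourierSum a)
    (fourierSum a).continuous.aestronglyMeasurable (measurePreserving_angle hβ)
  rw [AddCircle.volume_eq_smul_haarAddCircle,
    eLpNorm_smul_measure_of_ne_top ENNReal.ofNat_ne_top, eLpNorm_fourierSum ha] at hcomp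
  simpa only [Function.comp_def, ← mobiusSeries_eq_fourierSum hβ ha, ENNReal.toReal_div,
    ENNReal.toReal_one, ENNReal.toReal_ofNat, smul_eq_mul] using hcomp

theorem eq_mobiusSeries (hβ : 0 < β) (hf : Continuous f) (hF : MemLp (toTorus β f) 2)
    (ha : Summable fun k => ‖fourierCoeff (toTorus β f) k‖) :
    f = mobiusSeries β (fourierCoeff (toTorus β f)) := by
  refine (hf.ae_eq_iff_eq volume (continuous_mobiusSeries hβ ha)).mp
    ((volume_absolutelyContinuous_angleMeasure hβ).ae_le ?_)
  filter_upwards [(measurePreserving_angle hβ).quasiMeasurePreserving.ae (ae_eq_fourierSum hF ha)]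
    with x hx
  rwa [toTorus_angle hβ, ← mobiusSeries_eq_fourierSum hβ ha] at hx

theorem hasSum_toTorus (hβ : 0 < β) (ha : Summable fun k => ‖a k‖) (hf : f = mobiusSeries β a)
    (θ : Torus) : HasSum (fun k => a k * fourier k θ) (toTorus β f θ) := by
  by_cases hθ : θ = 0
  · have hlim : limUnder (cocompact ℝ) f = ∑' k, a k :=
      (hf ▸ tendsto_mobiusSeries hβ ha).limUnder_eq
    rw [toTorus, if_pos hθ, hlim, hθ]
    simpa using ha.of_norm.hasSum
  · obtain ⟨x, rfl⟩ := exists_angle_eq hβ hθ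
    simp only [toTorus_angle hβ, fourier_angle hβ, hf]
    exact hasSum_mobiusSeries hβ ha x

theorem ratInterp_sub_eq (hβ : 0 < β) (ha : Summable fun k => ‖a k‖) (hf : f = mobiusSeries β a)
    {n : ℕ} (hn : 1 ≤ n) :
    (fun x => ratInterp β n f x - f x) = mobiusSeries β (errCoeff n a) := by
  funext x
  have hinterp : HasSum (fun k => (if k ∈ freqs n then ∑' l, (residueClass n k).indicator a l
      else 0) * mobius β x ^ k) (ratInterp β n f x) := by
    have hsum : ratInterp β n f x = ∑ k ∈ freqs n, (if k ∈ freqs n then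
        ∑' l, (residueClass n k).indicator a l else 0) * mobius β x ^ k :=
      Finset.sum_congr rfl fun k hk => by
        rw [if_pos hk, discreteFourierCoeff_eq_tsum hn (hasSum_toTorus hβ ha hf)]
    exact hsum ▸ hasSum_sum_of_ne_finset_zero fun k hk => by rw [if_neg hk, zero_mul]
  simp only [mobiusSeries, errCoeff, sub_mul]
  rw [(hinterp.sub (hasSum_mobiusSeries hβ ha x)).tsum_eq, hf]

theorem exists_ratInterp_sub_eq (hβ : 0 < β) (hs : 1 / 2 < s) (hf : Continuous f)
    (hF : MemSobolevTorus s (toTorus β f)) :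
    ∃ a : ℤ → ℂ, (Summable fun k => ‖a k‖) ∧
      weightedNorm 2 s a = ENNReal.ofReal (normSobolevTorus s (toTorus β f)) ∧
      ∀ n : ℕ, 1 ≤ n → (fun x => ratInterp β n f x - f x) = mobiusSeries β (errCoeff n a) := by
  have ha := summable_norm_fourierCoeff hs hF
  exact ⟨_, ha, weightedNorm_fourierCoeff hF, fun n hn =>
    ratInterp_sub_eq hβ ha (eq_mobiusSeries hβ hf hF.1 ha) hn⟩

end Identification

section DerivativeNorm

variable {β : ℝ} {q : ℝ≥0∞} {c : ℤ → ℂ}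

theorem eLpNorm_angleDeriv_mul_le (hβ : 0 < β) (hq : 1 ≤ q) (hq_top : q ≠ ⊤) (g : ℝ → ℂ) :
    eLpNorm (fun x => angleDeriv β x * g x) q volume ≤
      ENNReal.ofReal (2 / β) ^ (1 - 1 / q.toReal) * eLpNorm g q (angleMeasure β) := by
  have hq0 : q ≠ 0 := (one_pos.trans_le hq).ne'
  have hp : 1 ≤ q.toReal := by simpa using ENNReal.toReal_mono hq_top hq
  set p := q.toReal
  have hpoint : ∀ x, ‖angleDeriv β x * g x‖ₑ ^ p ≤
      ENNReal.ofReal (2 / β) ^ (p - 1) * (ENNReal.ofReal (angleDeriv β x) * ‖g x‖ₑ ^ p) := by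
    intro x
    have henorm : ‖(angleDeriv β x : ℂ)‖ₑ = ENNReal.ofReal (angleDeriv β x) := by
      rw [← ofReal_norm, Complex.norm_real, Real.norm_of_nonneg (angleDeriv_pos hβ x).le]
    have hpos : ENNReal.ofReal (angleDeriv β x) ≠ 0 := by simpa using angleDeriv_pos hβ x
    rw [enorm_mul, henorm, ENNReal.mul_rpow_of_nonneg _ _ (by linarith), ← mul_assoc]
    refine mul_le_mul_left ?_ _
    rw [← sub_add_cancel p 1, ENNReal.rpow_add _ _ hpos ENNReal.ofReal_ne_top, ENNReal.rpow_one,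
      sub_add_cancel]
    exact mul_le_mul_left (ENNReal.rpow_le_rpow
      (ENNReal.ofReal_le_ofReal (angleDeriv_le hβ x)) (by linarith)) _
  rw [eLpNorm_eq_lintegral_rpow_enorm_toReal hq0 hq_top,
    eLpNorm_eq_lintegral_rpow_enorm_toReal hq0 hq_top, lintegral_angleMeasure hβ]
  have hconst : ENNReal.ofReal (2 / β) ^ (p - 1) ≠ ⊤ :=
    ENNReal.rpow_ne_top_of_nonneg (by linarith) ENNReal.ofReal_ne_top
  refine (ENNReal.rpow_le_rpow (lintegral_mono hpoint) (by positivity)).trans_eq ?_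
  rw [lintegral_const_mul' _ _ hconst, ENNReal.mul_rpow_of_nonneg _ _ (by positivity),
    ← ENNReal.rpow_mul, sub_mul, one_mul, mul_one_div_cancel (by linarith)]

theorem exists_eLpNorm_mobiusSeries_lineDerivCoeff_le (hβ : 0 < β) (hq : 1 ≤ q) (hq2 : q ≤ 2) :
    ∃ K : ℝ≥0, ∀ c : ℤ → ℂ, weightedNorm 1 1 c ≠ ⊤ →
      eLpNorm (mobiusSeries β (lineDerivCoeff β c)) q volume ≤ K * weightedNorm 2 1 c := by
  have hq_top : q ≠ ⊤ := ne_top_of_le_ne_top ENNReal.ofNat_ne_top hq2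
  have hrpow_ne_top : ∀ b y : ℝ, 0 < b → ENNReal.ofReal b ^ y ≠ ⊤ := fun b y hb =>
    ENNReal.rpow_ne_top_of_ne_zero (by simpa using hb) ENNReal.ofReal_ne_top
  refine ⟨(ENNReal.ofReal (2 / β) ^ (1 - 1 / q.toReal) *
    (ENNReal.ofReal (2 * Real.pi) ^ (1 / 2 : ℝ) *
      ENNReal.ofReal (2 * Real.pi) ^ (1 / q.toReal - 1 / (2 : ℝ≥0∞).toReal))).toNNReal,
      fun c hc => ?_⟩
  have hd := summable_norm_derivCoeff hc
  rw [ENNReal.coe_toNNReal (by finiteness [hrpow_ne_top]),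
    funext (mobiusSeries_lineDerivCoeff hβ hc)]
  refine (eLpNorm_angleDeriv_mul_le hβ hq hq_top _).trans ?_
  rw [mul_assoc]
  refine mul_le_mul_right ?_ _
  refine (eLpNorm_le_eLpNorm_mul_rpow_measure_univ hq2
    (continuous_mobiusSeries hβ hd).aestronglyMeasurable).trans ?_
  rw [eLpNorm_mobiusSeries_angleMeasure hβ hd, angleMeasure_univ hβ, mul_right_comm]
  refine mul_le_mul_right ?_ _
  simpa using weightedNorm_derivCoeff_le (q := 2) (p := 0) (c := c)

theorem exists_eLpNorm_mobiusSeries_iterate_le (hβ : 0 < β) (hq : 1 ≤ q) (hq2 : q ≤ 2) (j : ℕ) :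
    ∃ K : ℝ≥0, ∀ c : ℤ → ℂ, weightedNorm 1 (j + 1 : ℕ) c ≠ ⊤ →
      eLpNorm (mobiusSeries β ((lineDerivCoeff β)^[j + 1] c)) q volume ≤
        K * weightedNorm 2 (j + 1 : ℕ) c := by
  obtain ⟨K₁, hK₁⟩ := exists_eLpNorm_mobiusSeries_lineDerivCoeff_le hβ hq hq2
  obtain ⟨K₂, hK₂⟩ := exists_weightedNorm_iterate_lineDerivCoeff_le β one_le_two zero_le_one j
  refine ⟨K₁ * K₂, fun c hc => ?_⟩
  rw [Nat.cast_succ, add_comm (j : ℝ) 1] at hc ⊢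
  rw [Function.iterate_succ_apply', ENNReal.coe_mul, mul_assoc]
  exact (hK₁ _ (weightedNorm_iterate_lineDerivCoeff_ne_top zero_le_one le_rfl hc)).trans
    (mul_le_mul_right (hK₂ c) _)

end DerivativeNorm

section MobiusAtInfinity

variable {β : ℝ}

theorem norm_zpow_sub_one_le {z : ℂ} (hz : ‖z‖ = 1) (k : ℤ) :
    ‖z ^ k - 1‖ ≤ |(k : ℝ)| * ‖z - 1‖ := by
  have hpow : ∀ m : ℕ, ‖z ^ m - 1‖ ≤ m * ‖z - 1‖ := fun m => by
    rw [← geom_sum_mul, norm_mul]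
    gcongr
    refine (norm_sum_le _ _).trans_eq ?_
    simp [hz]
  obtain ⟨m, rfl | rfl⟩ := k.eq_nat_or_neg
  · simpa using hpow m
  · have hz0 : z ^ m ≠ 0 := pow_ne_zero m (norm_ne_zero_iff.mp (by simp [hz]))
    have hinv : z ^ (-(m : ℤ)) - 1 = -(z ^ m)⁻¹ * (z ^ m - 1) := by
      rw [zpow_neg, zpow_natCast]
      field_simp
      ring
    rw [hinv, norm_mul, norm_neg, norm_inv, norm_pow, hz]
    simpa using hpow m

theorem abs_mul_norm_mobius_sub_one_le (hβ : 0 < β) (x : ℝ) :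
    |x| * ‖mobius β x - 1‖ ≤ 2 * β := by
  have hne := ofReal_add_I_mul_ne_zero hβ x
  have habs : |x| ≤ ‖(x : ℂ) + Complex.I * β‖ := by
    simpa using Complex.abs_re_le_norm ((x : ℂ) + Complex.I * β)
  have hsub : mobius β x - 1 = -(2 * Complex.I * β) / (x + Complex.I * β) := by
    rw [mobius]
    field_simp
    ring
  have hnum : ‖2 * Complex.I * (β : ℂ)‖ = 2 * β := by simp [abs_of_pos hβ]
  rw [hsub, norm_div, norm_neg, hnum, mul_div_assoc', div_le_iff₀ (norm_pos_iff.mpr hne),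
    mul_comm]
  gcongr

theorem norm_mobius_zpow_sub_one_sq_le (hβ : 0 < β) (k : ℤ) (x : ℝ) :
    ‖mobius β x ^ k - 1‖ ^ 2 ≤ 8 * (1 + (x / (β * weight k)) ^ 2)⁻¹ := by
  have hκ : 0 < β * weight k := mul_pos hβ (weight_pos k)
  have hbounded : ‖mobius β x ^ k - 1‖ ≤ 2 := by
    refine (norm_sub_le _ _).trans_eq ?_
    rw [norm_mobius_zpow hβ, norm_one, one_add_one_eq_two]
  have hdecay : |x / (β * weight k)| * ‖mobius β x ^ k - 1‖ ≤ 2 := by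
    rw [abs_div, abs_of_pos hκ, div_mul_eq_mul_div, div_le_iff₀ hκ]
    calc |x| * ‖mobius β x ^ k - 1‖ ≤ |x| * (|(k : ℝ)| * ‖mobius β x - 1‖) := by
          gcongr
          exact norm_zpow_sub_one_le (norm_mobius hβ x) k
      _ = |(k : ℝ)| * (|x| * ‖mobius β x - 1‖) := by ring
      _ ≤ weight k * (2 * β) := by
          exact mul_le_mul (abs_le_weight k) (abs_mul_norm_mobius_sub_one_le hβ x)
            (by positivity) (weight_pos k).le
      _ = 2 * (β * weight k) := by ring
  have hbounded_sq := pow_le_pow_left₀ (norm_nonneg _) hbounded 2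
  have hdecay_sq := pow_le_pow_left₀ (by positivity) hdecay 2
  rw [mul_pow, sq_abs] at hdecay_sq
  rw [← div_eq_mul_inv, le_div_iff₀ (by positivity)]
  linarith

theorem lintegral_mobius_zpow_sub_one_sq_le (hβ : 0 < β) (k : ℤ) :
    ∫⁻ x : ℝ, ‖mobius β x ^ k - 1‖ₑ ^ 2 ≤ ENNReal.ofReal (8 * Real.pi * β * weight k) := by
  have hκ : 0 < β * weight k := mul_pos hβ (weight_pos k)
  have hintegrable : Integrable fun x : ℝ => 8 * (1 + (x / (β * weight k)) ^ 2)⁻¹ :=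
    (integrable_inv_one_add_sq.comp_div hκ.ne').const_mul 8
  have hval : ∫ x : ℝ, 8 * (1 + (x / (β * weight k)) ^ 2)⁻¹ = 8 * Real.pi * β * weight k := by
    rw [integral_const_mul, Measure.integral_comp_div (fun x : ℝ => (1 + x ^ 2)⁻¹),
      integral_univ_inv_one_add_sq, abs_of_pos hκ, smul_eq_mul]
    ring
  rw [← hval, ofReal_integral_eq_lintegral_ofReal hintegrable (ae_of_all _ fun x => by positivity)]
  refine lintegral_mono fun x => ?_
  rw [← ofReal_norm, ← ENNReal.ofReal_pow (norm_nonneg _)]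
  exact ENNReal.ofReal_le_ofReal (norm_mobius_zpow_sub_one_sq_le hβ k x)

end MobiusAtInfinity

section PrincipalValue

variable {β : ℝ} {c : ℤ → ℂ}

theorem hasPVIntegral_of_integrable_even_part {g : ℝ → ℂ} (hg : Continuous g)
    (heven : Integrable fun x => (g x + g (-x)) / 2) :
    HasPVIntegral g (∫ x, (g x + g (-x)) / 2) := by
  refine ⟨hg.locallyIntegrable, (intervalIntegral_tendsto_integral heven
    tendsto_neg_atTop_atBot tendsto_id).congr fun R => ?_⟩
  have hreflect : ∫ x in (-R)..R, g (-x) = ∫ x in (-R)..R, g x := by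
    rw [intervalIntegral.integral_comp_neg, neg_neg]
  rw [id, intervalIntegral.integral_div, intervalIntegral.integral_add
    (hg.intervalIntegrable _ _) (Continuous.intervalIntegrable (by fun_prop) _ _), hreflect]
  ring

-- `M_β(-x) = M_β(x)⁻¹`, so the even part of `M_β^k - 1` decays like `1 / x²`, whereas `M_β^k - 1`
-- itself is not integrable.
theorem enorm_mobius_zpow_even_part (hβ : 0 < β) (k : ℤ) (x : ℝ) :
    ‖(mobius β x ^ k + mobius β (-x : ℝ) ^ k) / 2 - 1‖ₑ = 2⁻¹ * ‖mobius β x ^ k - 1‖ₑ ^ 2 := by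
  have hne : mobius β x ^ k ≠ 0 := zpow_ne_zero k (mobius_ne_zero hβ x)
  have hsq : (mobius β x ^ k + (mobius β x ^ k)⁻¹) / 2 - 1 =
      2⁻¹ * (mobius β x ^ k)⁻¹ * (mobius β x ^ k - 1) ^ 2 := by
    field_simp
    ring
  have hunit : ‖mobius β x ^ k‖ₑ = 1 := by
    rw [← ofReal_norm, norm_mobius_zpow hβ, ENNReal.ofReal_one]
  have htwo : ‖(2 : ℂ)‖ₑ = 2 := by
    rw [← ofReal_norm, Complex.norm_ofNat, ENNReal.ofReal_ofNat]
  rw [mobius_neg, inv_zpow, hsq, enorm_mul, enorm_mul, enorm_pow, enorm_inv hne, hunit, inv_one,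
    mul_one, enorm_inv two_ne_zero, htwo]

theorem lintegral_mobiusSeries_even_part_le (hβ : 0 < β) (hc : Summable fun k => ‖c k‖)
    (hsum : ∑' k, c k = 0) :
    ∫⁻ x : ℝ, ‖(mobiusSeries β c x + mobiusSeries β c (-x)) / 2‖ₑ ≤
      ENNReal.ofReal (4 * Real.pi * β) * weightedNorm 1 1 c := by
  have hterm : ∀ x : ℝ, ‖(mobiusSeries β c x + mobiusSeries β c (-x)) / 2‖ₑ ≤
      ∑' k, ‖c k‖ₑ * (2⁻¹ * ‖mobius β x ^ k - 1‖ₑ ^ 2) := fun x => by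
    have hseries := (((hasSum_mobiusSeries hβ hc x).add
      (hasSum_mobiusSeries hβ hc (-x))).div_const 2).sub (hsum ▸ hc.of_norm.hasSum)
    rw [sub_zero] at hseries
    rw [← hseries.tsum_eq]
    refine enorm_tsum_le_tsum_enorm.trans_eq (tsum_congr fun k => ?_)
    rw [← enorm_mobius_zpow_even_part hβ, ← enorm_mul]
    congr 1
    push_cast
    ring
  have hmeas : ∀ k, AEMeasurable fun x : ℝ => ‖c k‖ₑ * (2⁻¹ * ‖mobius β x ^ k - 1‖ₑ ^ 2) :=
    fun k => ((((continuous_mobius_zpow hβ k).sub continuous_const).enorm.measurable.pow_const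
      2).const_mul _ |>.const_mul _).aemeasurable
  refine (lintegral_mono hterm).trans ?_
  rw [lintegral_tsum hmeas, weightedNorm_one, ← ENNReal.tsum_mul_left]
  refine ENNReal.tsum_le_tsum fun k => ?_
  rw [lintegral_const_mul' _ _ enorm_ne_top, lintegral_const_mul' _ _ (by simp)]
  refine (mul_le_mul_right (mul_le_mul_right (lintegral_mobius_zpow_sub_one_sq_le hβ k) _)
    _).trans_eq ?_
  have hconst : (2 : ℝ≥0∞)⁻¹ * ENNReal.ofReal (8 * Real.pi * β * weight k) =
      ENNReal.ofReal (4 * Real.pi * β) * ENNReal.ofReal (weight k ^ (1 : ℝ)) := by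
    rw [← ENNReal.ofReal_ofNat, ← ENNReal.ofReal_inv_of_pos two_pos,
      ← ENNReal.ofReal_mul (by positivity), ← ENNReal.ofReal_mul (by positivity), Real.rpow_one]
    ring_nf
  rw [hconst, enorm_weight_rpow_smul]
  ring

theorem exists_hasPVIntegral_mobiusSeries (hβ : 0 < β) (hc : weightedNorm 1 1 c ≠ ⊤)
    (hsum : ∑' k, c k = 0) :
    ∃ I, HasPVIntegral (mobiusSeries β c) I ∧
      ‖I‖ₑ ≤ ENNReal.ofReal (4 * Real.pi * β) * weightedNorm 1 1 c := by
  have hc0 := summable_norm_of_weightedNorm zero_le_one hc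
  have hcont := continuous_mobiusSeries hβ hc0
  have hle := lintegral_mobiusSeries_even_part_le hβ hc0 hsum
  have hintegrable : Integrable fun x => (mobiusSeries β c x + mobiusSeries β c (-x)) / 2 :=
    ⟨((hcont.add (hcont.comp continuous_neg)).div_const 2).aestronglyMeasurable,
      hle.trans_lt (ENNReal.mul_lt_top ENNReal.ofReal_lt_top hc.lt_top)⟩
  exact ⟨_, hasPVIntegral_of_integrable_even_part hcont hintegrable,
    (enorm_integral_le_lintegral_enorm _).trans hle⟩

end PrincipalValue

section Truncation

variable {q : ℝ≥0∞} {s : ℝ} {β : ℝ} {c d : ℤ → ℂ}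

theorem tendsto_weightedNorm_compl_indicator (hq : q ≠ 0) (hq_top : q ≠ ⊤)
    (hc : weightedNorm q s c ≠ ⊤) :
    Tendsto (fun S : Finset ℤ => weightedNorm q s ((S : Set ℤ)ᶜ.indicator c)) atTop (𝓝 0) := by
  have hpow := lintegral_rpow_enorm_lt_top_of_eLpNorm_lt_top hq hq_top hc.lt_top
  rw [lintegral_count] at hpow
  have htail := ENNReal.tendsto_tsum_compl_atTop_zero hpow.ne
  have hroot := htail.ennrpow_const (1 / q.toReal)
  rw [ENNReal.zero_rpow_of_pos (one_div_pos.mpr (ENNReal.toReal_pos hq hq_top))] at hroot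
  refine hroot.congr fun S => ?_
  rw [weightedNorm, eLpNorm_eq_lintegral_rpow_enorm_toReal hq hq_top, lintegral_count]
  congr 1
  change ∑' b : ((S : Set ℤ)ᶜ : Set ℤ), _ = _
  rw [tsum_subtype (S : Set ℤ)ᶜ fun k => ‖(weight k ^ s) • c k‖ₑ ^ q.toReal]
  refine tsum_congr fun k => ?_
  by_cases hk : k ∈ (S : Set ℤ)ᶜ
  · simp only [Set.indicator_of_mem hk]
  · simp only [Set.indicator_of_notMem hk, smul_zero, enorm_zero,
      ENNReal.zero_rpow_of_pos (ENNReal.toReal_pos hq hq_top)]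

theorem weightedNorm_sub_ne_top (hq : 1 ≤ q) (hc : weightedNorm q s c ≠ ⊤)
    (hd : weightedNorm q s d ≠ ⊤) : weightedNorm q s (c - d) ≠ ⊤ := by
  rw [sub_eq_add_neg]
  refine ne_top_of_le_ne_top (ENNReal.add_ne_top.mpr ⟨hc, ?_⟩) (weightedNorm_add_le hq)
  rwa [weightedNorm_neg]

theorem weightedNorm_one_indicator_ne_top (S : Finset ℤ) :
    weightedNorm 1 s ((S : Set ℤ).indicator c) ≠ ⊤ := by
  rw [weightedNorm_one, tsum_eq_sum (s := S) fun k hk => by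
    rw [Set.indicator_of_notMem (by simpa using hk), smul_zero, enorm_zero]]
  exact ENNReal.sum_ne_top.mpr fun k _ => enorm_ne_top

theorem weightedNorm_indicator_sub_indicator_le {N S : Set ℤ} (hNS : N ⊆ S) :
    weightedNorm q s (S.indicator c - N.indicator c) ≤ weightedNorm q s (Nᶜ.indicator c) := by
  refine weightedNorm_mono fun k => ?_
  refine mul_le_mul_of_nonneg_left ?_ (weight_rpow_pos k s).le
  by_cases hN : k ∈ N
  · simp [hN, hNS hN]
  · rw [Pi.sub_apply, Set.indicator_of_notMem hN, sub_zero,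
      Set.indicator_of_mem (s := Nᶜ) (by simpa)]
    exact norm_indicator_le_norm_self c k

theorem mobiusSeries_sub (hβ : 0 < β) (hc : Summable fun k => ‖c k‖)
    (hd : Summable fun k => ‖d k‖) :
    mobiusSeries β (c - d) = mobiusSeries β c - mobiusSeries β d := by
  funext x
  have hdiff := (hasSum_mobiusSeries hβ hc x).sub (hasSum_mobiusSeries hβ hd x)
  simpa only [mobiusSeries, Pi.sub_apply, sub_mul] using hdiff.tsum_eq

end Truncation

section WeakDerivative

theorem exists_memLp_tendsto_eLpNorm_sub {α E ι : Type*} [MeasurableSpace α] {μ : Measure α}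
    [NormedAddCommGroup E] [CompleteSpace E] [SemilatticeSup ι] [Nonempty ι] {p : ℝ≥0∞}
    (hp : 1 ≤ p) {g : ι → α → E} {b : ι → ℝ≥0∞} (hg : ∀ i, MemLp (g i) p μ)
    (hgb : ∀ N i, N ≤ i → eLpNorm (g i - g N) p μ ≤ b N) (hb : Tendsto b atTop (𝓝 0)) :
    ∃ w : α → E, MemLp w p μ ∧ Tendsto (fun i => eLpNorm (g i - w) p μ) atTop (𝓝 0) := by
  have : Fact (1 ≤ p) := ⟨hp⟩
  have hcauchy : CauchySeq fun i => (hg i).toLp := by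
    refine EMetric.cauchySeq_iff'.mpr fun ε hε => ?_
    obtain ⟨N, hN⟩ := (hb.eventually_lt_const hε).exists
    exact ⟨N, fun i hi => by rw [Lp.edist_toLp_toLp]; exact (hgb N i hi).trans_lt hN⟩
  obtain ⟨w, hw⟩ := cauchySeq_tendsto_of_complete hcauchy
  rw [← Lp.toLp_coeFn w (Lp.memLp w), Lp.tendsto_Lp_iff_tendsto_eLpNorm''] at hw
  exact ⟨w, Lp.memLp w, hw⟩

theorem tendsto_integral_mul_of_tendsto_lintegral_compact {ι : Type*} {l : Filter ι}
    {g : ι → ℝ → ℂ} {g₀ : ℝ → ℂ} (hg : ∀ i, LocallyIntegrable (g i))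
    (hg₀ : LocallyIntegrable g₀)
    (hlim : ∀ K : Set ℝ, IsCompact K →
      Tendsto (fun i => ∫⁻ x in K, ‖g i x - g₀ x‖ₑ) l (𝓝 0))
    {φ : ℝ → ℝ} (hφ : Continuous φ) (hsupp : HasCompactSupport φ) :
    Tendsto (fun i => ∫ x, (φ x : ℂ) * g i x) l (𝓝 (∫ x, (φ x : ℂ) * g₀ x)) := by
  have hφc : Continuous fun x => (φ x : ℂ) := Complex.continuous_ofReal.comp hφ
  have hφs : HasCompactSupport fun x => (φ x : ℂ) := hsupp.comp_left Complex.ofReal_zero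
  obtain ⟨M, hM⟩ := hφs.exists_bound_of_continuous hφc
  refine tendsto_integral_of_L1 _
    (hg₀.integrable_smul_left_of_hasCompactSupport hφc hφs).aestronglyMeasurable
    (Eventually.of_forall fun i =>
      (hg i).integrable_smul_left_of_hasCompactSupport hφc hφs) ?_
  have hzero := ENNReal.Tendsto.const_mul (hlim _ hφs)
    (Or.inr (ENNReal.ofReal_ne_top (r := M)))
  rw [mul_zero] at hzero
  refine tendsto_of_tendsto_of_tendsto_of_le_of_le tendsto_const_nhds hzero
    (fun _ => zero_le) fun i => ?_
  dsimp only
  rw [← lintegral_const_mul' _ _ ENNReal.ofReal_ne_top,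
    ← lintegral_indicator (isClosed_tsupport _).measurableSet]
  refine lintegral_mono fun x => ?_
  by_cases hx : x ∈ tsupport fun x => (φ x : ℂ)
  · rw [Set.indicator_of_mem hx, smul_eq_mul, ← mul_sub, enorm_mul]
    gcongr
    rw [← ofReal_norm]
    exact ENNReal.ofReal_le_ofReal (hM x)
  · simp [image_eq_zero_of_notMem_tsupport hx]

theorem hasCompactSupport_iteratedDeriv {φ : ℝ → ℝ} (hφ : HasCompactSupport φ) (j : ℕ) :
    HasCompactSupport (iteratedDeriv j φ) := by
  induction j with
  | zero => simpa
  | succ j ih =>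
    rw [iteratedDeriv_succ]
    exact ih.deriv

theorem IsWeakDeriv.of_tendsto {ι : Type*} {l : Filter ι} [l.NeBot] {j : ℕ} {g w : ι → ℝ → ℂ}
    {g₀ w₀ : ℝ → ℂ} (h : ∀ i, IsWeakDeriv j (g i) (w i)) (hg₀ : LocallyIntegrable g₀)
    (hw₀ : LocallyIntegrable w₀)
    (hg : ∀ K : Set ℝ, IsCompact K → Tendsto (fun i => ∫⁻ x in K, ‖g i x - g₀ x‖ₑ) l (𝓝 0))
    (hw : ∀ K : Set ℝ, IsCompact K → Tendsto (fun i => ∫⁻ x in K, ‖w i x - w₀ x‖ₑ) l (𝓝 0)) :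
    IsWeakDeriv j g₀ w₀ := by
  refine ⟨hg₀, hw₀, fun φ hφ hsupp => ?_⟩
  have hleft := tendsto_integral_mul_of_tendsto_lintegral_compact (fun i => (h i).1) hg₀ hg
    (hφ.continuous_iteratedDeriv j (by exact_mod_cast le_top))
    (hasCompactSupport_iteratedDeriv hsupp j)
  have hright := tendsto_integral_mul_of_tendsto_lintegral_compact (fun i => (h i).2.1) hw₀ hw
    hφ.continuous hsupp
  refine tendsto_nhds_unique hleft ((hright.const_mul ((-1) ^ j)).congr fun i => ?_)
  exact ((h i).2.2 φ hφ hsupp).symm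

theorem integral_deriv_mul_eq_neg {φ : ℝ → ℝ} {g g' : ℝ → ℂ} (hφ : ContDiff ℝ 1 φ)
    (hsupp : HasCompactSupport φ) (hg : ∀ x, HasDerivAt g (g' x) x) (hg' : Continuous g') :
    ∫ x, ((deriv φ x : ℝ) : ℂ) * g x = -∫ x, (φ x : ℂ) * g' x := by
  have hcompact : ∀ {ψ : ℝ → ℝ} {h : ℝ → ℂ}, Continuous ψ → HasCompactSupport ψ → Continuous h →
      Integrable fun x => (ψ x : ℂ) * h x := fun hψ hψs hh =>
    hh.locallyIntegrable.integrable_smul_left_of_hasCompactSupport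
      (Complex.continuous_ofReal.comp hψ) (hψs.comp_left Complex.ofReal_zero)
  have hgc : Continuous g := continuous_iff_continuousAt.mpr fun x => (hg x).continuousAt
  have hφ' : Continuous (deriv φ) := hφ.continuous_deriv le_rfl
  have hparts := integral_mul_deriv_eq_deriv_mul_of_integrable (A := ℂ)
    (fun x _ => ((hφ.differentiable one_ne_zero) x).hasDerivAt.ofReal_comp) (fun x _ => hg x)
    (hcompact hφ.continuous hsupp hg') (hcompact hφ' hsupp.deriv hgc)
    (hcompact hφ.continuous hsupp hgc)
  rw [hparts, neg_neg]

theorem isWeakDeriv_iteratedDeriv {j : ℕ} {g : ℝ → ℂ} (hg : ContDiff ℝ j g) :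
    IsWeakDeriv j g (iteratedDeriv j g) := by
  refine ⟨hg.continuous.locallyIntegrable,
    (hg.continuous_iteratedDeriv j le_rfl).locallyIntegrable, fun φ hφ hsupp => ?_⟩
  induction j generalizing φ with
  | zero => simp
  | succ j ih =>
    have hderiv : ∀ x, HasDerivAt (iteratedDeriv j g) (iteratedDeriv (j + 1) g x) x := fun x => by
      rw [iteratedDeriv_succ]
      exact (hg.differentiable_iteratedDeriv j (by exact_mod_cast j.lt_succ_self) x).hasDerivAt
    rw [iteratedDeriv_succ', ih (hg.of_le (by exact_mod_cast j.le_succ)) (deriv φ)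
      (contDiff_infty_iff_deriv.mp hφ).2 hsupp.deriv,
      integral_deriv_mul_eq_neg (hφ.of_le (by exact_mod_cast le_top)) hsupp hderiv
        (hg.continuous_iteratedDeriv (j + 1) le_rfl), pow_succ]
    ring

end WeakDerivative

section MobiusWeakDerivative

variable {β : ℝ} {c : ℤ → ℂ}

theorem enorm_mobiusSeries_indicator_sub_le (hβ : 0 < β) (hc : weightedNorm 1 0 c ≠ ⊤)
    (S : Set ℤ) (x : ℝ) :
    ‖mobiusSeries β (S.indicator c) x - mobiusSeries β c x‖ₑ ≤
      weightedNorm 1 0 (Sᶜ.indicator c) := by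
  have hsub := mobiusSeries_sub hβ (summable_norm_of_weightedNorm le_rfl hc)
    (summable_norm_of_weightedNorm le_rfl
      (ne_top_of_le_ne_top hc (weightedNorm_indicator_le S)))
  rw [enorm_sub_rev, ← Pi.sub_apply, ← hsub, ← Set.indicator_compl]
  exact enorm_mobiusSeries_le hβ _ x

theorem tendsto_lintegral_compact_mobiusSeries_indicator (hβ : 0 < β)
    (hc : weightedNorm 1 0 c ≠ ⊤) {K : Set ℝ} (hK : IsCompact K) :
    Tendsto (fun S : Finset ℤ =>
      ∫⁻ x in K, ‖mobiusSeries β ((S : Set ℤ).indicator c) x - mobiusSeries β c x‖ₑ)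
      atTop (𝓝 0) := by
  have htail := ENNReal.Tendsto.mul_const
    (tendsto_weightedNorm_compl_indicator one_ne_zero ENNReal.one_ne_top hc)
    (Or.inr (hK.measure_lt_top (μ := volume)).ne)
  rw [zero_mul] at htail
  refine tendsto_of_tendsto_of_tendsto_of_le_of_le tendsto_const_nhds htail
    (fun _ => zero_le) fun S => ?_
  exact (lintegral_mono (enorm_mobiusSeries_indicator_sub_le hβ hc S)).trans_eq
    (setLIntegral_const K _)

theorem iteratedDeriv_mobiusSeries_sub (hβ : 0 < β) {j : ℕ} {d : ℤ → ℂ}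
    (hc : weightedNorm 1 j c ≠ ⊤) (hd : weightedNorm 1 j d ≠ ⊤) :
    iteratedDeriv j (mobiusSeries β (c - d)) =
      iteratedDeriv j (mobiusSeries β c) - iteratedDeriv j (mobiusSeries β d) := by
  rw [mobiusSeries_sub hβ (summable_norm_of_weightedNorm j.cast_nonneg hc)
    (summable_norm_of_weightedNorm j.cast_nonneg hd)]
  funext x
  exact iteratedDeriv_sub (contDiff_mobiusSeries hβ hc).contDiffAt
    (contDiff_mobiusSeries hβ hd).contDiffAt

theorem exists_eLpNorm_iteratedDeriv_mobiusSeries_le (hβ : 0 < β) {p : ℝ≥0∞} (hp : 1 ≤ p)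
    (hp2 : p ≤ 2) (j : ℕ) :
    ∃ C : ℝ≥0, ∀ c : ℤ → ℂ, weightedNorm 1 (j + 1 : ℕ) c ≠ ⊤ →
      eLpNorm (iteratedDeriv (j + 1) (mobiusSeries β c)) p volume ≤
        C * weightedNorm 2 (j + 1 : ℕ) c := by
  obtain ⟨C, hC⟩ := exists_eLpNorm_mobiusSeries_iterate_le hβ hp hp2 j
  exact ⟨C, fun c hc => by rw [iteratedDeriv_mobiusSeries hβ hc]; exact hC c hc⟩

-- `c` need not lie in the weighted `ℓ¹`, so the series need not be `C^(j + 1)`; the derivatives of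
-- its partial sums are only Cauchy in `L¹`.
theorem exists_tendsto_iteratedDeriv_mobiusSeries (hβ : 0 < β) (j : ℕ) :
    ∃ C : ℝ≥0, ∀ c : ℤ → ℂ, weightedNorm 2 (j + 1 : ℕ) c ≠ ⊤ →
      ∃ w : ℝ → ℂ, MemLp w 1 volume ∧ eLpNorm w 1 volume ≤ C * weightedNorm 2 (j + 1 : ℕ) c ∧
        Tendsto (fun S : Finset ℤ => eLpNorm
          (iteratedDeriv (j + 1) (mobiusSeries β ((S : Set ℤ).indicator c)) - w) 1 volume)
          atTop (𝓝 0) := by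
  obtain ⟨C, hC⟩ := exists_eLpNorm_iteratedDeriv_mobiusSeries_le hβ le_rfl one_le_two j
  refine ⟨C, fun c hc => ?_⟩
  have hfin : ∀ S : Finset ℤ, weightedNorm 1 (j + 1 : ℕ) ((S : Set ℤ).indicator c) ≠ ⊤ := fun S =>
    weightedNorm_one_indicator_ne_top S
  set G : Finset ℤ → ℝ → ℂ := fun S =>
    iteratedDeriv (j + 1) (mobiusSeries β ((S : Set ℤ).indicator c)) with hG
  have hGc : ∀ S, Continuous (G S) := fun S =>
    (contDiff_mobiusSeries hβ (hfin S)).continuous_iteratedDeriv _ le_rfl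
  have hGle : ∀ S, eLpNorm (G S) 1 volume ≤ C * weightedNorm 2 (j + 1 : ℕ) c := fun S =>
    (hC _ (hfin S)).trans (mul_le_mul_right (weightedNorm_indicator_le _) _)
  have hGmem : ∀ S, MemLp (G S) 1 volume := fun S =>
    ⟨(hGc S).aestronglyMeasurable,
      (hGle S).trans_lt (ENNReal.mul_lt_top ENNReal.coe_lt_top hc.lt_top)⟩
  have htail := ENNReal.Tendsto.const_mul
    (tendsto_weightedNorm_compl_indicator two_ne_zero ENNReal.ofNat_ne_top hc)
    (Or.inr (ENNReal.coe_ne_top (r := C)))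
  rw [mul_zero] at htail
  obtain ⟨w, hw, hlim⟩ := exists_memLp_tendsto_eLpNorm_sub le_rfl hGmem (fun N S hNS => by
    rw [hG, ← iteratedDeriv_mobiusSeries_sub hβ (hfin S) (hfin N)]
    exact (hC _ (weightedNorm_sub_ne_top le_rfl (hfin S) (hfin N))).trans (mul_le_mul_right
      (weightedNorm_indicator_sub_indicator_le (Finset.coe_subset.mpr hNS)) _)) htail
  refine ⟨w, hw, ?_, hlim⟩
  have hbound := hlim.add_const (C * weightedNorm 2 (j + 1 : ℕ) c)
  rw [zero_add] at hbound
  refine ge_of_tendsto' hbound fun S => ?_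
  calc eLpNorm w 1 volume = eLpNorm (w - G S + G S) 1 volume := by rw [sub_add_cancel]
    _ ≤ eLpNorm (w - G S) 1 volume + eLpNorm (G S) 1 volume :=
        eLpNorm_add_le (hw.sub (hGmem S)).1 (hGmem S).1 le_rfl
    _ ≤ _ := by rw [eLpNorm_sub_comm]; gcongr; exact hGle S

theorem exists_isWeakDeriv_mobiusSeries (hβ : 0 < β) (j : ℕ) :
    ∃ C : ℝ≥0, ∀ c : ℤ → ℂ, weightedNorm 2 (j + 1 : ℕ) c ≠ ⊤ →
      ∃ w : ℝ → ℂ, IsWeakDeriv (j + 1) (mobiusSeries β c) w ∧ Integrable w ∧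
        eLpNorm w 1 volume ≤ C * weightedNorm 2 (j + 1 : ℕ) c := by
  obtain ⟨C, hC⟩ := exists_tendsto_iteratedDeriv_mobiusSeries hβ j
  refine ⟨C, fun c hc => ?_⟩
  obtain ⟨w, hw, hwC, hlim⟩ := hC c hc
  have hw_int : Integrable w := memLp_one_iff_integrable.mp hw
  have hc1 : weightedNorm 1 0 c ≠ ⊤ := by
    obtain ⟨B, hB⟩ := exists_weightedNorm_one_le (r := 0) (s := (j + 1 : ℕ))
      (by push_cast; linarith [(j.cast_nonneg : (0 : ℝ) ≤ j)])
    exact ne_top_of_le_ne_top (ENNReal.mul_ne_top ENNReal.coe_ne_top hc) (hB c)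
  refine ⟨w, .of_tendsto
    (fun S : Finset ℤ => isWeakDeriv_iteratedDeriv
      (contDiff_mobiusSeries hβ (weightedNorm_one_indicator_ne_top S)))
    (continuous_mobiusSeries hβ (summable_norm_of_weightedNorm le_rfl hc1)).locallyIntegrable
    hw_int.locallyIntegrable
    (fun K hK => tendsto_lintegral_compact_mobiusSeries_indicator hβ hc1 hK)
    fun K _ => ?_, hw_int, hwC⟩
  simp only [eLpNorm_one_eq_lintegral_enorm] at hlim
  exact tendsto_of_tendsto_of_tendsto_of_le_of_le tendsto_const_nhds hlim
    (fun _ => zero_le) fun S => setLIntegral_le_lintegral K _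

end MobiusWeakDerivative

section FourierTransform

variable {g h : ℝ → ℂ}

theorem fourierL2_of_memLp (hg : MemLp g 2 (volume : Measure ℝ)) (k : ℝ) :
    fourierL2 g k = (𝓕 (hg.toLp g) : Lp ℂ 2 (volume : Measure ℝ)) (k / (2 * Real.pi)) := by
  rw [fourierL2, dif_pos hg]

theorem map_volume_div_const {a : ℝ} (ha : a ≠ 0) :
    Measure.map (fun k : ℝ => k / a) volume = ENNReal.ofReal |a| • volume := by
  simp only [div_eq_inv_mul]
  rw [Real.map_volume_mul_left (inv_ne_zero ha), inv_inv]

theorem quasiMeasurePreserving_div_const {a : ℝ} (ha : a ≠ 0) :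
    Measure.QuasiMeasurePreserving (fun k : ℝ => k / a) :=
  ⟨measurable_id.div_const a, by
    rw [map_volume_div_const ha]
    exact Measure.smul_absolutelyContinuous⟩

theorem aestronglyMeasurable_fourierL2 (g : ℝ → ℂ) :
    AEStronglyMeasurable (fourierL2 g) (volume : Measure ℝ) := by
  by_cases hg : MemLp g 2 (volume : Measure ℝ)
  · simp only [funext (fourierL2_of_memLp hg)]
    exact (Lp.aestronglyMeasurable _).comp_quasiMeasurePreserving
      (quasiMeasurePreserving_div_const Real.two_pi_pos.ne')
  · rw [show fourierL2 g = fun _ => 0 from funext fun _ => dif_neg hg]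
    exact aestronglyMeasurable_const

theorem lintegral_fourierL2_sq (hg : MemLp g 2 (volume : Measure ℝ)) :
    ∫⁻ k, ‖fourierL2 g k‖ₑ ^ 2 = ENNReal.ofReal (2 * Real.pi) * eLpNorm g 2 volume ^ 2 := by
  have hscale := lintegral_map' (μ := volume) (g := fun k : ℝ => k / (2 * Real.pi))
    (f := fun ξ => ‖(𝓕 (hg.toLp g) : Lp ℂ 2 (volume : Measure ℝ)) ξ‖ₑ ^ 2)
    ((Lp.aestronglyMeasurable _).mono_ac (quasiMeasurePreserving_div_const
      Real.two_pi_pos.ne').absolutelyContinuous |>.enorm.pow_const 2) (by fun_prop)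
  rw [map_volume_div_const Real.two_pi_pos.ne', lintegral_smul_measure, smul_eq_mul,
    abs_of_pos Real.two_pi_pos, ← eLpNorm_two_sq, ← Lp.enorm_def, ← ofReal_norm,
    Lp.norm_fourier_eq, ofReal_norm, Lp.enorm_toLp] at hscale
  simp only [fourierL2_of_memLp hg, hscale]

theorem fourierL2_sub_ae (hg : MemLp g 2 (volume : Measure ℝ))
    (hh : MemLp h 2 (volume : Measure ℝ)) :
    fourierL2 (g - h) =ᵐ[volume] fourierL2 g - fourierL2 h := by
  have hsub : (𝓕 ((hg.sub hh).toLp (g - h)) : Lp ℂ 2 (volume : Measure ℝ)) =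
      𝓕 (hg.toLp g) - 𝓕 (hh.toLp h) := by
    rw [MemLp.toLp_sub hg hh]
    exact map_sub (Lp.fourierTransformₗᵢ ℝ ℂ) _ _
  filter_upwards [(quasiMeasurePreserving_div_const Real.two_pi_pos.ne').ae (Lp.coeFn_sub
    (𝓕 (hg.toLp g) : Lp ℂ 2 (volume : Measure ℝ)) (𝓕 (hh.toLp h)))] with k hk
  rw [Pi.sub_apply, fourierL2_of_memLp hg, fourierL2_of_memLp hh, fourierL2_of_memLp (hg.sub hh),
    hsub, hk, Pi.sub_apply]

theorem lineDerivOp_toTemperedDistribution {g' : ℝ → ℂ} (hderiv : ∀ x, HasDerivAt g (g' x) x)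
    (hg : MemLp g 2 (volume : Measure ℝ)) (hg' : MemLp g' 2 (volume : Measure ℝ)) :
    LineDeriv.lineDerivOp (1 : ℝ) (Lp.toTemperedDistribution (hg.toLp g)) =
      Lp.toTemperedDistribution (hg'.toLp g') := by
  ext φ
  set φ' := LineDeriv.lineDerivOp (1 : ℝ) φ
  have hφ : MemLp (fun x => φ x) 2 (volume : Measure ℝ) := φ.memLp 2
  have hφ' : MemLp (fun x => φ' x) 2 (volume : Measure ℝ) := φ'.memLp 2
  have hφderiv : ∀ x, HasDerivAt (fun x => φ x) (φ' x) x := fun x => by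
    have hx := (φ.differentiableAt (x := x)).hasDerivAt
    rwa [← SchwartzMap.derivCLM_apply (𝕜 := ℂ)] at hx
  have hpairing : ∫ x, φ x • hg'.toLp g' x = ∫ x, φ x * g' x :=
    integral_congr_ae <| by
      filter_upwards [hg'.coeFn_toLp] with x hx
      rw [hx, smul_eq_mul]
  have hpairing' : ∫ x, (-φ') x • hg.toLp g x = -∫ x, φ' x * g x := by
    rw [← integral_neg]
    refine integral_congr_ae ?_
    filter_upwards [hg.coeFn_toLp] with x hx
    rw [hx, smul_eq_mul, neg_apply, neg_mul]
  rw [TemperedDistribution.lineDerivOp_apply_apply, Lp.toTemperedDistribution_apply,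
    Lp.toTemperedDistribution_apply, hpairing, hpairing']
  exact (integral_mul_deriv_eq_deriv_mul_of_integrable (A := ℂ) (fun x _ => hφderiv x)
    (fun x _ => hderiv x) (hφ.integrable_mul hg') (hφ'.integrable_mul hg)
    (hφ.integrable_mul hg)).symm

theorem fourier_toLp_deriv_ae {g' : ℝ → ℂ} (hderiv : ∀ x, HasDerivAt g (g' x) x)
    (hg : MemLp g 2 (volume : Measure ℝ)) (hg' : MemLp g' 2 (volume : Measure ℝ)) :
    ∀ᵐ ξ : ℝ, (𝓕 (hg'.toLp g') : Lp ℂ 2 (volume : Measure ℝ)) ξ =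
      2 * Real.pi * Complex.I * ξ * (𝓕 (hg.toLp g) : Lp ℂ 2 (volume : Measure ℝ)) ξ := by
  have hdist := congrArg (fun T => 𝓕 T) (lineDerivOp_toTemperedDistribution hderiv hg hg')
  simp only [TemperedDistribution.fourier_lineDerivOp_eq,
    Lp.fourier_toTemperedDistribution_eq] at hdist
  have hloc : ∀ Φ : Lp ℂ 2 (volume : Measure ℝ), LocallyIntegrable Φ := fun Φ =>
    (Lp.memLp Φ).locallyIntegrable one_le_two
  refine ae_eq_of_integral_contDiff_smul_eq (hloc _)
    ((hloc _).continuous_mul (g := fun ξ : ℝ => (2 * Real.pi * Complex.I * ξ : ℂ))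
      (by fun_prop)) fun φ hφ hsupp => ?_
  have hsuppC : HasCompactSupport (Complex.ofRealCLM ∘ φ) := hsupp.comp_left rfl
  have hφC : ContDiff ℝ ∞ (Complex.ofRealCLM ∘ φ) := by fun_prop
  have htest := congrArg (fun T => T (hsuppC.toSchwartzMap hφC)) hdist
  have hgrowth : (fun ξ : ℝ => (ξ : ℂ)).HasTemperateGrowth := by fun_prop
  simp only [RCLike.inner_apply, Real.ringHom_apply, one_mul, smul_apply,
    TemperedDistribution.smulLeftCLM_apply_apply, Lp.toTemperedDistribution_apply, smul_eq_mul,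
    HasCompactSupport.toSchwartzMap_toFun, Function.comp_apply, Complex.ofRealCLM_apply] at htest
  rw [← integral_const_mul] at htest
  refine Eq.trans ?_ (htest.symm.trans ?_)
  · simp
  · refine integral_congr_ae (Eventually.of_forall fun x => ?_)
    simp only [SchwartzMap.smulLeftCLM_apply_apply hgrowth, HasCompactSupport.toSchwartzMap_toFun,
      Function.comp_apply, Complex.ofRealCLM_apply, smul_eq_mul, Complex.real_smul]
    ring

theorem fourierL2_deriv_ae {g' : ℝ → ℂ} (hderiv : ∀ x, HasDerivAt g (g' x) x)
    (hg : MemLp g 2 (volume : Measure ℝ)) (hg' : MemLp g' 2 (volume : Measure ℝ)) :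
    ∀ᵐ k : ℝ, fourierL2 g' k = Complex.I * k * fourierL2 g k := by
  filter_upwards [(quasiMeasurePreserving_div_const Real.two_pi_pos.ne').ae
    (fourier_toLp_deriv_ae hderiv hg hg')] with k hk
  rw [fourierL2_of_memLp hg, fourierL2_of_memLp hg', hk]
  push_cast
  field_simp

theorem fourierL2_iteratedDeriv_ae {m : ℕ} (hg : ContDiff ℝ m g)
    (hmem : ∀ i ≤ m, MemLp (iteratedDeriv i g) 2 (volume : Measure ℝ)) :
    ∀ᵐ k : ℝ, fourierL2 (iteratedDeriv m g) k = (Complex.I * k) ^ m * fourierL2 g k := by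
  induction m with
  | zero => simp
  | succ m ih =>
    have hderiv : ∀ x, HasDerivAt (iteratedDeriv m g) (iteratedDeriv (m + 1) g x) x := fun x => by
      rw [iteratedDeriv_succ]
      exact (hg.differentiable_iteratedDeriv m (by exact_mod_cast m.lt_succ_self) x).hasDerivAt
    filter_upwards [ih (hg.of_le (by exact_mod_cast m.le_succ)) fun i hi => hmem i (by omega),
      fourierL2_deriv_ae hderiv (hmem m m.le_succ) (hmem (m + 1) le_rfl)] with k hm hsucc
    rw [hsucc, hm]
    ring

theorem lintegral_enorm_pow_mul_fourierL2_sq {m : ℕ} (hg : ContDiff ℝ m g)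
    (hmem : ∀ i ≤ m, MemLp (iteratedDeriv i g) 2 (volume : Measure ℝ)) :
    ∫⁻ k, ‖k‖ₑ ^ (2 * m) * ‖fourierL2 g k‖ₑ ^ 2 =
      ENNReal.ofReal (2 * Real.pi) * eLpNorm (iteratedDeriv m g) 2 volume ^ 2 := by
  rw [← lintegral_fourierL2_sq (hmem m le_rfl)]
  refine lintegral_congr_ae ?_
  filter_upwards [fourierL2_iteratedDeriv_ae hg hmem] with k hk
  rw [hk, enorm_mul, enorm_pow, enorm_mul, mul_pow, ← pow_mul, mul_comm m 2]
  congr 2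
  simp [← ofReal_norm]

theorem lintegral_mul_fourierL2_sq_le_of_tendsto {ι : Type*} {l : Filter ι} [l.NeBot]
    [l.IsCountablyGenerated] {u : ι → ℝ → ℂ} {w : ℝ → ℝ≥0∞} {B : ℝ≥0∞}
    (hw : Measurable w) (hw_top : ∀ k, w k ≠ ⊤)
    (hu : ∀ i, MemLp (u i) 2 (volume : Measure ℝ)) (hg : MemLp g 2 (volume : Measure ℝ))
    (hlim : Tendsto (fun i => eLpNorm (u i - g) 2 volume) l (𝓝 0))
    (hB : ∀ i, ∫⁻ k, w k * ‖fourierL2 (u i) k‖ₑ ^ 2 ≤ B) :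
    ∫⁻ k, w k * ‖fourierL2 g k‖ₑ ^ 2 ≤ B := by
  have hlimF : Tendsto (fun i => eLpNorm (fourierL2 (u i) - fourierL2 g) 2 volume) l (𝓝 0) := by
    have hsq : Tendsto (fun i => eLpNorm (fourierL2 (u i) - fourierL2 g) 2 volume ^ 2) l
        (𝓝 0) := by
      have hconst := ENNReal.Tendsto.const_mul (hlim.ennrpow_const 2)
        (Or.inr (ENNReal.ofReal_ne_top (r := 2 * Real.pi)))
      simp only [ENNReal.rpow_ofNat, zero_pow two_ne_zero, mul_zero] at hconst
      refine hconst.congr fun i => ?_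
      rw [← lintegral_fourierL2_sq ((hu i).sub hg), eLpNorm_two_sq]
      refine lintegral_congr_ae ?_
      filter_upwards [fourierL2_sub_ae (hu i) hg] with k hk
      rw [hk]
    have hroot := hsq.ennrpow_const (2 : ℝ)⁻¹
    rw [ENNReal.zero_rpow_of_pos (by positivity)] at hroot
    refine hroot.congr fun i => ?_
    rw [← ENNReal.rpow_two, ← ENNReal.rpow_mul, mul_inv_cancel₀ two_ne_zero, ENNReal.rpow_one]
  obtain ⟨φ, -, hφ⟩ := (tendstoInMeasure_of_tendsto_eLpNorm two_ne_zero
    (fun i => aestronglyMeasurable_fourierL2 (u i)) (aestronglyMeasurable_fourierL2 g)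
    hlimF).exists_seq_tendsto_ae'
  have hmeas : ∀ i, AEMeasurable fun k => w k * ‖fourierL2 (u (φ i)) k‖ₑ ^ 2 := fun i =>
    hw.aemeasurable.mul ((aestronglyMeasurable_fourierL2 (u (φ i))).enorm.pow_const 2)
  calc ∫⁻ k, w k * ‖fourierL2 g k‖ₑ ^ 2
      ≤ ∫⁻ k, liminf (fun i => w k * ‖fourierL2 (u (φ i)) k‖ₑ ^ 2) atTop := by
        refine lintegral_mono_ae ?_
        filter_upwards [hφ] with k hk
        exact (ENNReal.Tendsto.const_mul (((ENNReal.continuous_pow 2).tendsto _).comp hk.enorm)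
          (Or.inr (hw_top k))).liminf_eq.ge
    _ ≤ liminf (fun i => ∫⁻ k, w k * ‖fourierL2 (u (φ i)) k‖ₑ ^ 2) atTop :=
        lintegral_liminf_le' hmeas
    _ ≤ B := liminf_le_of_frequently_le' (Frequently.of_forall fun i => hB _)

end FourierTransform

theorem eLpNorm_le_tsum_of_hasSum {ι α E : Type*} [Countable ι] [MeasurableSpace α]
    {μ : Measure α} [NormedAddCommGroup E] {p : ℝ≥0∞} (hp : 1 ≤ p) {f : ι → α → E} {g : α → E}
    (hf : ∀ i, AEStronglyMeasurable (f i) μ) (hfg : ∀ x, HasSum (fun i => f i x) (g x)) :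
    eLpNorm g p μ ≤ ∑' i, eLpNorm (f i) p μ := by
  obtain ⟨S, hS⟩ := exists_seq_tendsto (atTop : Filter (Finset ι))
  refine (Lp.eLpNorm_lim_le_liminf_eLpNorm (f := fun n => ∑ i ∈ S n, f i)
    (fun n => Finset.aestronglyMeasurable_sum _ fun i _ => hf i) g (ae_of_all _ fun x => by
      simpa only [Finset.sum_apply, Function.comp_def] using Tendsto.comp (hfg x) hS)).trans ?_
  exact liminf_le_of_frequently_le' <| Frequently.of_forall fun n =>
    (eLpNorm_sum_le (fun i _ => hf i) hp).trans (ENNReal.sum_le_tsum _)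

section CenteredSeries

variable {β : ℝ} {c d : ℤ → ℂ}

/-- The series `∑ c_k (M_β(x)^k - 1)`, which unlike `∑ c_k M_β(x)^k` decays at infinity. The two
agree if `∑ c_k = 0`. -/
def centeredSeries (β : ℝ) (c : ℤ → ℂ) (x : ℝ) : ℂ := mobiusSeries β c x - ∑' k, c k

theorem centeredSeries_of_tsum_eq_zero (hsum : ∑' k, c k = 0) :
    centeredSeries β c = mobiusSeries β c := by
  funext x
  rw [centeredSeries, hsum, sub_zero]

theorem hasSum_centeredSeries (hβ : 0 < β) (hc : Summable fun k => ‖c k‖) (x : ℝ) :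
    HasSum (fun k => c k * (mobius β x ^ k - 1)) (centeredSeries β c x) := by
  simp only [mul_sub, mul_one]
  exact (hasSum_mobiusSeries hβ hc x).sub hc.of_norm.hasSum

theorem continuous_centeredSeries (hβ : 0 < β) (hc : Summable fun k => ‖c k‖) :
    Continuous (centeredSeries β c) :=
  (continuous_mobiusSeries hβ hc).sub continuous_const

theorem centeredSeries_sub (hβ : 0 < β) (hc : Summable fun k => ‖c k‖)
    (hd : Summable fun k => ‖d k‖) :
    centeredSeries β (c - d) = centeredSeries β c - centeredSeries β d := by
  funext x
  have hdiff := (hasSum_centeredSeries hβ hc x).sub (hasSum_centeredSeries hβ hd x)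
  simp only [← sub_mul] at hdiff
  exact (hasSum_centeredSeries hβ ((hc.of_norm.sub hd.of_norm).norm) x).unique hdiff

theorem iteratedDeriv_succ_centeredSeries (j : ℕ) :
    iteratedDeriv (j + 1) (centeredSeries β c) = iteratedDeriv (j + 1) (mobiusSeries β c) := by
  rw [iteratedDeriv_succ', iteratedDeriv_succ']
  congr 1
  funext x
  exact deriv_sub_const _

theorem eLpNorm_mobius_zpow_sub_one_le (hβ : 0 < β) (k : ℤ) :
    eLpNorm (fun x : ℝ => mobius β x ^ k - 1) 2 volume ≤
      ENNReal.ofReal (√(8 * Real.pi * β) * weight k ^ (1 / 2 : ℝ)) := by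
  refine (ENNReal.pow_le_pow_left_iff two_ne_zero).mp ?_
  have hrpow := (weight_rpow_pos k (1 / 2)).le
  rw [eLpNorm_two_sq, ← ENNReal.ofReal_pow (by positivity), mul_pow, Real.sq_sqrt (by positivity),
    weight_rpow_sq, mul_one_div_cancel two_ne_zero, Real.rpow_one]
  exact lintegral_mobius_zpow_sub_one_sq_le hβ k

theorem eLpNorm_centeredSeries_le (hβ : 0 < β) (hc : Summable fun k => ‖c k‖) :
    eLpNorm (centeredSeries β c) 2 volume ≤
      ENNReal.ofReal √(8 * Real.pi * β) * weightedNorm 1 (1 / 2) c := by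
  refine (eLpNorm_le_tsum_of_hasSum one_le_two (fun k => (((continuous_mobius_zpow hβ k).sub
    continuous_const).const_mul _).aestronglyMeasurable) (hasSum_centeredSeries hβ hc)).trans ?_
  rw [weightedNorm_one, ← ENNReal.tsum_mul_left]
  refine ENNReal.tsum_le_tsum fun k => ?_
  calc eLpNorm (c k • fun x : ℝ => mobius β x ^ k - 1) 2 volume
      = ‖c k‖ₑ * eLpNorm (fun x : ℝ => mobius β x ^ k - 1) 2 volume := eLpNorm_const_smul ..
    _ ≤ ‖c k‖ₑ * ENNReal.ofReal (√(8 * Real.pi * β) * weight k ^ (1 / 2 : ℝ)) := by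
        gcongr
        exact eLpNorm_mobius_zpow_sub_one_le hβ k
    _ = _ := by
        rw [enorm_weight_rpow_smul, ENNReal.ofReal_mul (Real.sqrt_nonneg _)]
        ring

theorem memLp_centeredSeries (hβ : 0 < β) (hc : weightedNorm 1 (1 / 2) c ≠ ⊤) :
    MemLp (centeredSeries β c) 2 volume := by
  have hc0 := summable_norm_of_weightedNorm one_half_pos.le hc
  exact ⟨(continuous_centeredSeries hβ hc0).aestronglyMeasurable,
    (eLpNorm_centeredSeries_le hβ hc0).trans_lt
      (ENNReal.mul_lt_top ENNReal.ofReal_lt_top hc.lt_top)⟩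

theorem tendsto_eLpNorm_centeredSeries_indicator_sub (hβ : 0 < β)
    (hc : weightedNorm 1 (1 / 2) c ≠ ⊤) :
    Tendsto (fun S : Finset ℤ => eLpNorm
      (centeredSeries β ((S : Set ℤ).indicator c) - centeredSeries β c) 2 volume) atTop (𝓝 0) := by
  have hc0 := summable_norm_of_weightedNorm one_half_pos.le hc
  have htail := ENNReal.Tendsto.const_mul
    (tendsto_weightedNorm_compl_indicator one_ne_zero ENNReal.one_ne_top hc)
    (Or.inr (ENNReal.ofReal_ne_top (r := √(8 * Real.pi * β))))
  rw [mul_zero] at htail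
  refine tendsto_of_tendsto_of_tendsto_of_le_of_le tendsto_const_nhds htail
    (fun _ => zero_le) fun S => ?_
  have hS : Summable fun k => ‖(S : Set ℤ).indicator c k‖ :=
    summable_norm_of_weightedNorm le_rfl (weightedNorm_one_indicator_ne_top S)
  rw [eLpNorm_sub_comm, ← centeredSeries_sub hβ hc0 hS, ← Set.indicator_compl]
  exact eLpNorm_centeredSeries_le hβ ((hc0.of_norm.indicator _).norm)

theorem exists_lintegral_pow_mul_fourierL2_centeredSeries_le (hβ : 0 < β) (j : ℕ) :
    ∃ C : ℝ≥0, ∀ c : ℤ → ℂ, weightedNorm 1 (j + 1 : ℕ) c ≠ ⊤ →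
      ∫⁻ k, ‖k‖ₑ ^ (2 * (j + 1)) * ‖fourierL2 (centeredSeries β c) k‖ₑ ^ 2 ≤
        C * weightedNorm 2 (j + 1 : ℕ) c ^ 2 := by
  choose C hC using exists_eLpNorm_iteratedDeriv_mobiusSeries_le hβ one_le_two le_rfl
  refine ⟨(2 * Real.pi).toNNReal * C j ^ 2, fun c hc => ?_⟩
  have hmono : ∀ {r : ℝ}, r ≤ (j + 1 : ℕ) → weightedNorm 1 r c ≠ ⊤ := fun hr =>
    ne_top_of_le_ne_top hc (weightedNorm_mono_exponent hr)
  have hsmooth : ContDiff ℝ (j + 1 : ℕ) (centeredSeries β c) :=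
    (contDiff_mobiusSeries hβ hc).sub contDiff_const
  have hmem : ∀ i ≤ j + 1, MemLp (iteratedDeriv i (centeredSeries β c)) 2 volume := by
    rintro (_ | i) hi
    · rw [iteratedDeriv_zero]
      refine memLp_centeredSeries hβ (hmono ?_)
      push_cast
      linarith [(j.cast_nonneg : (0 : ℝ) ≤ j)]
    · have hci := hmono (r := (i + 1 : ℕ)) (by exact_mod_cast hi)
      refine ⟨(hsmooth.continuous_iteratedDeriv _ (by exact_mod_cast hi)).aestronglyMeasurable, ?_⟩
      rw [iteratedDeriv_succ_centeredSeries]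
      exact (hC i c hci).trans_lt (ENNReal.mul_lt_top ENNReal.coe_lt_top
        ((weightedNorm_two_le_one _ c).trans_lt hci.lt_top))
  rw [lintegral_enorm_pow_mul_fourierL2_sq hsmooth hmem, iteratedDeriv_succ_centeredSeries]
  push_cast
  rw [mul_assoc, ← mul_pow]
  gcongr
  · rfl
  · exact_mod_cast hC j c hc

end CenteredSeries

section Interpolation

variable {β : ℝ} {c : ℤ → ℂ}

theorem lintegral_rpow_mul_eq_lintegral_tail {f : ℝ → ℝ≥0∞} (hf : AEMeasurable f) {p : ℝ}
    (hp : 0 < p) :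
    ∫⁻ k, ENNReal.ofReal (|k| ^ p) * f k = ENNReal.ofReal p *
      ∫⁻ R in Set.Ioi 0, (∫⁻ k in {k : ℝ | R < |k|}, f k) * ENNReal.ofReal (R ^ (p - 1)) := by
  have hcake := lintegral_rpow_eq_lintegral_meas_lt_mul (volume.withDensity f)
    (f := fun k : ℝ => |k|) (ae_of_all _ abs_nonneg) continuous_abs.aemeasurable hp
  rw [lintegral_withDensity_eq_lintegral_mul₀ hf (by fun_prop)] at hcake
  simp only [Pi.mul_apply, withDensity_apply _ (measurableSet_lt measurable_const measurable_abs),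
    mul_comm (f _)] at hcake
  exact hcake

theorem setLIntegral_Ioc_rpow {p w : ℝ} (hp : 0 < p) (hw : 0 ≤ w) :
    ∫⁻ R in Set.Ioc 0 w, ENNReal.ofReal (R ^ (p - 1)) = ENNReal.ofReal (p⁻¹ * w ^ p) := by
  have hintegrable : IntegrableOn (fun R : ℝ => R ^ (p - 1)) (Set.Ioc 0 w) :=
    (intervalIntegrable_iff_integrableOn_Ioc_of_le hw).mp
      (intervalIntegral.intervalIntegrable_rpow' (by linarith))
  rw [← ofReal_integral_eq_lintegral_ofReal hintegrable ((ae_restrict_iff' measurableSet_Ioc).mpr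
    (ae_of_all _ fun R hR => Real.rpow_nonneg hR.1.le _)),
    ← intervalIntegral.integral_of_le hw, integral_rpow (Or.inl (by linarith)), sub_add_cancel,
    Real.zero_rpow hp.ne', sub_zero, div_eq_inv_mul]

theorem setLIntegral_Ioi_rpow {p w : ℝ} (hp : 0 < p) (hw : 0 < w) :
    ∫⁻ R in Set.Ioi w, ENNReal.ofReal (R ^ (-p - 1)) = ENNReal.ofReal (p⁻¹ * w ^ (-p)) := by
  have hexp : -p - 1 < -1 := by linarith
  rw [← ofReal_integral_eq_lintegral_ofReal (integrableOn_Ioi_rpow_of_lt hexp hw)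
    ((ae_restrict_iff' measurableSet_Ioi).mpr
      (ae_of_all _ fun R hR => Real.rpow_nonneg (hw.trans hR).le _)),
    integral_Ioi_rpow_of_lt hexp hw, sub_add_cancel, neg_div_neg_eq, div_eq_inv_mul]

theorem measurable_weightedNorm_indicator_sq (u : ℝ) {S : ℝ → Set ℤ}
    (hS : ∀ k, MeasurableSet {R | k ∈ S R}) :
    Measurable fun R => weightedNorm 2 u ((S R).indicator c) ^ 2 := by
  simp only [weightedNorm_two_sq]
  have hterm : ∀ k, Measurable fun R => (S R).indicator c k := fun k =>
    measurable_const.indicator (hS k) (f := fun _ => c k)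
  exact Measurable.tsum fun k =>
    ((hterm k).const_smul (weight k ^ u)).enorm.pow_const 2

theorem lintegral_mul_weightedNorm_indicator_sq {f : ℝ → ℝ≥0∞} (hf : Measurable f) (u : ℝ)
    {S : ℝ → Set ℤ} (hS : ∀ k, MeasurableSet {R | k ∈ S R}) :
    ∫⁻ R in Set.Ioi 0, f R * weightedNorm 2 u ((S R).indicator c) ^ 2 =
      ∑' k, (∫⁻ R in Set.Ioi 0 ∩ {R | k ∈ S R}, f R) * ‖(weight k ^ u) • c k‖ₑ ^ 2 := by
  have hterm : ∀ R k, f R * ‖(weight k ^ u) • (S R).indicator c k‖ₑ ^ 2 =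
      {R | k ∈ S R}.indicator f R * ‖(weight k ^ u) • c k‖ₑ ^ 2 := fun R k => by
    by_cases hk : k ∈ S R
    · rw [Set.indicator_of_mem hk, Set.indicator_of_mem (s := {R | k ∈ S R}) hk]
    · rw [Set.indicator_of_notMem hk, Set.indicator_of_notMem (s := {R | k ∈ S R}) hk]
      simp
  simp only [weightedNorm_two_sq, ← ENNReal.tsum_mul_left, hterm]
  rw [lintegral_tsum fun k => ((hf.indicator (hS k)).mul_const _).aemeasurable]
  refine tsum_congr fun k => ?_
  rw [lintegral_mul_const _ (hf.indicator (hS k)), setLIntegral_indicator (hS k),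
    Set.inter_comm]

theorem ofReal_weight_rpow_mul_enorm_sq (k : ℤ) (a u : ℝ) (z : ℂ) :
    ENNReal.ofReal (weight k ^ a) * ‖(weight k ^ u) • z‖ₑ ^ 2 =
      ‖(weight k ^ (u + a / 2)) • z‖ₑ ^ 2 := by
  have hsq : weight k ^ a = (weight k ^ (a / 2)) ^ 2 := by
    rw [weight_rpow_sq, mul_div_cancel₀ _ two_ne_zero]
  rw [hsq, ENNReal.ofReal_pow (weight_rpow_pos k _).le, ← mul_pow, ← enorm_weight_rpow_smul,
    smul_smul, ← Real.rpow_add (weight_pos k), add_comm]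

theorem lintegral_rpow_mul_weightedNorm_high_sq {p : ℝ} (hp : 0 < p) (u : ℝ) (c : ℤ → ℂ) :
    ∫⁻ R in Set.Ioi 0, ENNReal.ofReal (R ^ (p - 1)) *
        weightedNorm 2 u ({k | R ≤ weight k}.indicator c) ^ 2 =
      ENNReal.ofReal p⁻¹ * weightedNorm 2 (u + p / 2) c ^ 2 := by
  rw [lintegral_mul_weightedNorm_indicator_sq (f := fun R => ENNReal.ofReal (R ^ (p - 1)))
    (by fun_prop) u (S := fun R => {k | R ≤ weight k}) (fun k => measurableSet_Iic),
    weightedNorm_two_sq, ← ENNReal.tsum_mul_left]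
  refine tsum_congr fun k => ?_
  have hset : Set.Ioi 0 ∩ {R | k ∈ {k | R ≤ weight k}} = Set.Ioc 0 (weight k) := rfl
  rw [hset, setLIntegral_Ioc_rpow hp (weight_pos k).le,
    ENNReal.ofReal_mul (inv_nonneg.mpr hp.le), mul_assoc, ofReal_weight_rpow_mul_enorm_sq]

theorem lintegral_rpow_mul_weightedNorm_low_sq {p : ℝ} (hp : 0 < p) (u : ℝ) (c : ℤ → ℂ) :
    ∫⁻ R in Set.Ioi 0, ENNReal.ofReal (R ^ (-p - 1)) *
        weightedNorm 2 u ({k | weight k < R}.indicator c) ^ 2 =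
      ENNReal.ofReal p⁻¹ * weightedNorm 2 (u - p / 2) c ^ 2 := by
  rw [lintegral_mul_weightedNorm_indicator_sq (f := fun R => ENNReal.ofReal (R ^ (-p - 1)))
    (by fun_prop) u (S := fun R => {k | weight k < R}) (fun k => measurableSet_Ioi),
    weightedNorm_two_sq, ← ENNReal.tsum_mul_left]
  refine tsum_congr fun k => ?_
  have hset : Set.Ioi 0 ∩ {R | k ∈ {k | weight k < R}} = Set.Ioi (weight k) :=
    Set.inter_eq_right.mpr (Set.Ioi_subset_Ioi (weight_pos k).le)
  rw [hset, setLIntegral_Ioi_rpow hp (weight_pos k), ENNReal.ofReal_mul (inv_nonneg.mpr hp.le),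
    mul_assoc, ofReal_weight_rpow_mul_enorm_sq, neg_div, ← sub_eq_add_neg]

theorem fourierL2_centeredSeries_sq_le_ae (hβ : 0 < β) (hc : weightedNorm 1 (1 / 2) c ≠ ⊤)
    (S : Set ℤ) :
    ∀ᵐ k : ℝ, ‖fourierL2 (centeredSeries β c) k‖ₑ ^ 2 ≤
      2 * (‖fourierL2 (centeredSeries β (S.indicator c)) k‖ₑ ^ 2 +
        ‖fourierL2 (centeredSeries β (Sᶜ.indicator c)) k‖ₑ ^ 2) := by
  have hS : weightedNorm 1 (1 / 2) (S.indicator c) ≠ ⊤ :=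
    ne_top_of_le_ne_top hc (weightedNorm_indicator_le S)
  have hsub : centeredSeries β (Sᶜ.indicator c) =
      centeredSeries β c - centeredSeries β (S.indicator c) := by
    rw [Set.indicator_compl, centeredSeries_sub hβ
      (summable_norm_of_weightedNorm one_half_pos.le hc)
      (summable_norm_of_weightedNorm one_half_pos.le hS)]
  filter_upwards [fourierL2_sub_ae (memLp_centeredSeries hβ hc) (memLp_centeredSeries hβ hS)]
    with k hk
  rw [hsub, hk, Pi.sub_apply]
  have htri : ‖fourierL2 (centeredSeries β c) k‖ₑ ≤
      ‖fourierL2 (centeredSeries β (S.indicator c)) k‖ₑ +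
        ‖fourierL2 (centeredSeries β c) k - fourierL2 (centeredSeries β (S.indicator c)) k‖ₑ := by
    simpa using enorm_add_le (fourierL2 (centeredSeries β (S.indicator c)) k)
      (fourierL2 (centeredSeries β c) k - fourierL2 (centeredSeries β (S.indicator c)) k)
  refine (ENNReal.pow_le_pow_left htri).trans ?_
  have hconvex := ENNReal.rpow_add_le_mul_rpow_add_rpow
    ‖fourierL2 (centeredSeries β (S.indicator c)) k‖ₑ
    ‖fourierL2 (centeredSeries β c) k - fourierL2 (centeredSeries β (S.indicator c)) k‖ₑ
    one_le_two
  norm_num at hconvex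
  exact hconvex

theorem aemeasurable_sq_mul_fourierL2_sq (g : ℝ → ℂ) :
    AEMeasurable fun k : ℝ => ‖k‖ₑ ^ 2 * ‖fourierL2 g k‖ₑ ^ 2 :=
  (measurable_enorm.pow_const 2).aemeasurable.mul
    ((aestronglyMeasurable_fourierL2 g).enorm.pow_const 2)

theorem setLIntegral_fourierL2_centeredSeries_le_indicator_add (hβ : 0 < β)
    (hc : weightedNorm 1 (1 / 2) c ≠ ⊤) (S : Set ℤ) (A : Set ℝ) :
    ∫⁻ k in A, ‖k‖ₑ ^ 2 * ‖fourierL2 (centeredSeries β c) k‖ₑ ^ 2 ≤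
      2 * ((∫⁻ k in A, ‖k‖ₑ ^ 2 * ‖fourierL2 (centeredSeries β (S.indicator c)) k‖ₑ ^ 2) +
        ∫⁻ k in A, ‖k‖ₑ ^ 2 * ‖fourierL2 (centeredSeries β (Sᶜ.indicator c)) k‖ₑ ^ 2) := by
  rw [← lintegral_add_left' (aemeasurable_sq_mul_fourierL2_sq _).restrict,
    ← lintegral_const_mul' _ _ ENNReal.ofNat_ne_top]
  refine lintegral_mono_ae (ae_restrict_of_ae ?_)
  filter_upwards [fourierL2_centeredSeries_sq_le_ae hβ hc S] with k hk
  rw [← mul_add, mul_left_comm]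
  gcongr

theorem setLIntegral_tail_sq_mul_le (f : ℝ → ℝ≥0∞) {R : ℝ} (hR : 0 < R) (j : ℕ) :
    ∫⁻ k in {k : ℝ | R < |k|}, ‖k‖ₑ ^ 2 * f k ≤
      ENNReal.ofReal (R ^ (-(2 * j : ℝ))) * ∫⁻ k, ‖k‖ₑ ^ (2 * (j + 1)) * f k := by
  rw [← lintegral_const_mul' _ _ ENNReal.ofReal_ne_top]
  refine (setLIntegral_mono' (measurableSet_lt measurable_const measurable_abs)
    fun k hk => ?_).trans (setLIntegral_le_lintegral _ _)
  rw [← mul_assoc]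
  gcongr
  rw [Real.enorm_eq_ofReal_abs, ← ENNReal.ofReal_pow (abs_nonneg k),
    ← ENNReal.ofReal_pow (abs_nonneg k), ← ENNReal.ofReal_mul (by positivity)]
  refine ENNReal.ofReal_le_ofReal ?_
  have hRk : R ^ (2 * j) ≤ |k| ^ (2 * j) := pow_le_pow_left₀ hR.le (le_of_lt hk) _
  rw [Real.rpow_neg hR.le, inv_mul_eq_div, le_div_iff₀ (by positivity)]
  calc |k| ^ 2 * R ^ (2 * j : ℝ) = |k| ^ 2 * R ^ (2 * j) := by norm_cast
    _ ≤ |k| ^ 2 * |k| ^ (2 * j) := by gcongr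
    _ = |k| ^ (2 * (j + 1)) := by ring

-- Frequencies below the height `R` of the tail can afford `j + 1` derivatives, those above it only
-- one.
theorem exists_setLIntegral_tail_fourierL2_centeredSeries_le (hβ : 0 < β) (j : ℕ) :
    ∃ C : ℝ≥0, ∀ c : ℤ → ℂ, weightedNorm 1 (j + 1 : ℕ) c ≠ ⊤ → ∀ R : ℝ, 0 < R →
      ∫⁻ k in {k : ℝ | R < |k|}, ‖k‖ₑ ^ 2 * ‖fourierL2 (centeredSeries β c) k‖ₑ ^ 2 ≤
        C * (ENNReal.ofReal (R ^ (-(2 * j : ℝ))) *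
            weightedNorm 2 (j + 1 : ℕ) ({k | weight k < R}.indicator c) ^ 2 +
          weightedNorm 2 1 ({k | R ≤ weight k}.indicator c) ^ 2) := by
  choose C hC using exists_lintegral_pow_mul_fourierL2_centeredSeries_le hβ
  refine ⟨2 * max (C j) (C 0), fun c hc R hR => ?_⟩
  have hj : (0 : ℝ) ≤ j := j.cast_nonneg
  have hmono : ∀ {r : ℝ} (S : Set ℤ), r ≤ (j + 1 : ℕ) → weightedNorm 1 r (S.indicator c) ≠ ⊤ :=
    fun S hr => ne_top_of_le_ne_top hc
      ((weightedNorm_mono_exponent hr).trans (weightedNorm_indicator_le S))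
  set S : Set ℤ := {k | weight k < R} with hS
  have hSc : {k : ℤ | R ≤ weight k} = Sᶜ := by
    ext k
    simp [hS]
  rw [hSc]
  calc ∫⁻ k in {k : ℝ | R < |k|}, ‖k‖ₑ ^ 2 * ‖fourierL2 (centeredSeries β c) k‖ₑ ^ 2
      ≤ 2 * ((∫⁻ k in {k : ℝ | R < |k|},
            ‖k‖ₑ ^ 2 * ‖fourierL2 (centeredSeries β (S.indicator c)) k‖ₑ ^ 2) +
          ∫⁻ k in {k : ℝ | R < |k|},
            ‖k‖ₑ ^ 2 * ‖fourierL2 (centeredSeries β (Sᶜ.indicator c)) k‖ₑ ^ 2) :=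
        setLIntegral_fourierL2_centeredSeries_le_indicator_add hβ (ne_top_of_le_ne_top hc
          (weightedNorm_mono_exponent (by push_cast; linarith))) S _
    _ ≤ 2 * (ENNReal.ofReal (R ^ (-(2 * j : ℝ))) *
          (max (C j) (C 0) * weightedNorm 2 (j + 1 : ℕ) (S.indicator c) ^ 2) +
          max (C j) (C 0) * weightedNorm 2 1 (Sᶜ.indicator c) ^ 2) := by
        gcongr
        · refine (setLIntegral_tail_sq_mul_le _ hR j).trans (mul_le_mul_right ?_ _)
          exact (hC j _ (hmono S le_rfl)).trans (by gcongr; exact le_max_left _ _)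
        · have hhigh := hC 0 _ (hmono Sᶜ (by push_cast; linarith))
          simp only [zero_add, mul_one, Nat.cast_one] at hhigh
          exact (setLIntegral_le_lintegral _ _).trans
            (hhigh.trans (by gcongr; exact le_max_right _ _))
    _ = _ := by
        push_cast
        ring

theorem lintegral_rpow_mul_weightedNorm_low_add_high {τ : ℝ} (hτ : 1 < τ) {j : ℕ} (hj : τ < j + 1)
    (c : ℤ → ℂ) :
    ∫⁻ R in Set.Ioi 0, (ENNReal.ofReal (R ^ (-(2 * j : ℝ))) *
          weightedNorm 2 (j + 1 : ℕ) ({k | weight k < R}.indicator c) ^ 2 +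
        weightedNorm 2 1 ({k | R ≤ weight k}.indicator c) ^ 2) *
          ENNReal.ofReal (R ^ (2 * τ - 2 - 1)) =
      (ENNReal.ofReal (2 * (j + 1) - 2 * τ)⁻¹ + ENNReal.ofReal (2 * τ - 2)⁻¹) *
        weightedNorm 2 τ c ^ 2 := by
  set q : ℝ := 2 * (j + 1) - 2 * τ with hq
  have hlow := lintegral_rpow_mul_weightedNorm_low_sq (p := q) (by linarith) (j + 1 : ℕ) c
  have hhigh := lintegral_rpow_mul_weightedNorm_high_sq (p := 2 * τ - 2) (by linarith) 1 c
  have hexpLow : ((j + 1 : ℕ) : ℝ) - q / 2 = τ := by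
    push_cast
    linarith
  have hexpHigh : 1 + (2 * τ - 2) / 2 = τ := by ring
  rw [hexpLow] at hlow
  rw [hexpHigh] at hhigh
  rw [add_mul, ← hlow, ← hhigh, ← lintegral_add_left]
  · refine setLIntegral_congr_fun measurableSet_Ioi fun R hR => ?_
    have hpow : R ^ (-q - 1) = R ^ (-(2 * j : ℝ)) * R ^ (2 * τ - 2 - 1) := by
      rw [← Real.rpow_add hR]
      congr 1
      ring
    rw [hpow, ENNReal.ofReal_mul (Real.rpow_nonneg (le_of_lt hR) _)]
    ring
  · exact Measurable.mul (by fun_prop)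
      (measurable_weightedNorm_indicator_sq _ (S := fun R => {k | weight k < R})
        fun k => measurableSet_Ioi)

theorem ofReal_abs_rpow_eq_mul_enorm_sq {p : ℝ} (hp : 0 < p) (k : ℝ) :
    ENNReal.ofReal (|k| ^ p) = ENNReal.ofReal (|k| ^ (p - 2)) * ‖k‖ₑ ^ 2 := by
  rw [Real.enorm_eq_ofReal_abs, ← ENNReal.ofReal_pow (abs_nonneg k),
    ← ENNReal.ofReal_mul (by positivity), ← Real.rpow_natCast,
    ← Real.rpow_add' (abs_nonneg k) (by simpa using hp.ne')]
  simp

theorem exists_lintegral_rpow_mul_fourierL2_centeredSeries_le (hβ : 0 < β) {τ : ℝ} (hτ : 1 < τ) :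
    ∃ C : ℝ≥0, ∀ c : ℤ → ℂ, weightedNorm 1 (⌊τ⌋₊ + 1 : ℕ) c ≠ ⊤ →
      ∫⁻ k : ℝ, ENNReal.ofReal (|k| ^ (2 * τ)) * ‖fourierL2 (centeredSeries β c) k‖ₑ ^ 2 ≤
        C * weightedNorm 2 τ c ^ 2 := by
  set j := ⌊τ⌋₊
  obtain ⟨C, hC⟩ := exists_setLIntegral_tail_fourierL2_centeredSeries_le hβ j
  have hp : 0 < 2 * τ - 2 := by linarith
  refine ⟨(2 * τ - 2).toNNReal *
    (C * ((2 * (j + 1) - 2 * τ)⁻¹.toNNReal + (2 * τ - 2)⁻¹.toNNReal)), fun c hc => ?_⟩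
  calc ∫⁻ k : ℝ, ENNReal.ofReal (|k| ^ (2 * τ)) * ‖fourierL2 (centeredSeries β c) k‖ₑ ^ 2
      = ∫⁻ k : ℝ, ENNReal.ofReal (|k| ^ (2 * τ - 2)) *
          (‖k‖ₑ ^ 2 * ‖fourierL2 (centeredSeries β c) k‖ₑ ^ 2) := by
        simp only [ofReal_abs_rpow_eq_mul_enorm_sq (by linarith : 0 < 2 * τ), mul_assoc]
    _ = ENNReal.ofReal (2 * τ - 2) * ∫⁻ R in Set.Ioi 0, (∫⁻ k in {k : ℝ | R < |k|},
          ‖k‖ₑ ^ 2 * ‖fourierL2 (centeredSeries β c) k‖ₑ ^ 2) *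
            ENNReal.ofReal (R ^ (2 * τ - 2 - 1)) :=
        lintegral_rpow_mul_eq_lintegral_tail (aemeasurable_sq_mul_fourierL2_sq _) hp
    _ ≤ ENNReal.ofReal (2 * τ - 2) * ∫⁻ R in Set.Ioi 0,
          C * ((ENNReal.ofReal (R ^ (-(2 * j : ℝ))) *
              weightedNorm 2 (j + 1 : ℕ) ({k | weight k < R}.indicator c) ^ 2 +
            weightedNorm 2 1 ({k | R ≤ weight k}.indicator c) ^ 2) *
              ENNReal.ofReal (R ^ (2 * τ - 2 - 1))) := by
        refine mul_le_mul_right (setLIntegral_mono' measurableSet_Ioi fun R hR => ?_) _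
        rw [← mul_assoc]
        exact mul_le_mul_left (hC c hc R hR) _
    _ = _ := by
        rw [lintegral_const_mul' _ _ ENNReal.coe_ne_top,
          lintegral_rpow_mul_weightedNorm_low_add_high hτ (Nat.lt_floor_add_one τ)]
        simp only [ENNReal.ofReal]
        push_cast
        ring

end Interpolation

section SobolevLine

variable {β τ : ℝ}

theorem exists_lintegral_rpow_mul_fourierL2_centeredSeries_le_of_ne_top (hβ : 0 < β)
    (hτ : 1 < τ) :
    ∃ C : ℝ≥0, ∀ c : ℤ → ℂ, weightedNorm 2 τ c ≠ ⊤ →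
      ∫⁻ k : ℝ, ENNReal.ofReal (|k| ^ (2 * τ)) * ‖fourierL2 (centeredSeries β c) k‖ₑ ^ 2 ≤
        C * weightedNorm 2 τ c ^ 2 := by
  obtain ⟨C, hC⟩ := exists_lintegral_rpow_mul_fourierL2_centeredSeries_le hβ hτ
  obtain ⟨K, hK⟩ := exists_weightedNorm_one_le (r := 1 / 2) (s := τ) (by linarith)
  refine ⟨C, fun c hc => ?_⟩
  have hc1 : weightedNorm 1 (1 / 2) c ≠ ⊤ :=
    ne_top_of_le_ne_top (ENNReal.mul_ne_top ENNReal.coe_ne_top hc) (hK c)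
  refine lintegral_mul_fourierL2_sq_le_of_tendsto (by fun_prop) (fun _ => ENNReal.ofReal_ne_top)
    (fun S => memLp_centeredSeries hβ (weightedNorm_one_indicator_ne_top S))
    (memLp_centeredSeries hβ hc1) (tendsto_eLpNorm_centeredSeries_indicator_sub hβ hc1)
    fun S => (hC _ (weightedNorm_one_indicator_ne_top S)).trans ?_
  gcongr
  exact weightedNorm_indicator_le _

theorem ofReal_one_add_rpow_le (hτ : 1 ≤ τ) {x : ℝ} (hx : 0 ≤ x) :
    ENNReal.ofReal ((1 + x) ^ τ) ≤
      ENNReal.ofReal (2 ^ (τ - 1)) * (1 + ENNReal.ofReal (x ^ τ)) := by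
  rw [← ENNReal.ofReal_one, ← ENNReal.ofReal_add zero_le_one (by positivity),
    ← ENNReal.ofReal_mul (by positivity)]
  refine ENNReal.ofReal_le_ofReal ?_
  lift x to ℝ≥0 using hx
  simpa using NNReal.coe_le_coe.mpr (NNReal.rpow_add_le_mul_rpow_add_rpow 1 x hτ)

theorem lintegral_one_add_rpow_mul_fourierL2_sq_le {g : ℝ → ℂ} (hg : MemLp g 2 volume)
    (hτ : 1 ≤ 2 * τ) :
    ∫⁻ k : ℝ, ENNReal.ofReal ((1 + |k|) ^ (2 * τ)) * ‖fourierL2 g k‖ₑ ^ 2 ≤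
      ENNReal.ofReal (2 ^ (2 * τ - 1)) * (ENNReal.ofReal (2 * Real.pi) * eLpNorm g 2 volume ^ 2 +
        ∫⁻ k : ℝ, ENNReal.ofReal (|k| ^ (2 * τ)) * ‖fourierL2 g k‖ₑ ^ 2) := by
  rw [← lintegral_fourierL2_sq hg,
    ← lintegral_add_left' ((aestronglyMeasurable_fourierL2 _).enorm.pow_const 2),
    ← lintegral_const_mul' _ _ ENNReal.ofReal_ne_top]
  refine lintegral_mono fun k => ?_
  rw [← one_add_mul, ← mul_assoc]
  gcongr
  exact ofReal_one_add_rpow_le hτ (abs_nonneg k)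

theorem exists_lintegral_one_add_rpow_mul_fourierL2_centeredSeries_le (hβ : 0 < β) (hτ : 1 < τ) :
    ∃ C : ℝ≥0, ∀ c : ℤ → ℂ, weightedNorm 2 τ c ≠ ⊤ →
      MemLp (centeredSeries β c) 2 volume ∧
      ∫⁻ k : ℝ, ENNReal.ofReal ((1 + |k|) ^ (2 * τ)) * ‖fourierL2 (centeredSeries β c) k‖ₑ ^ 2 ≤
        C * weightedNorm 2 τ c ^ 2 := by
  obtain ⟨C, hC⟩ := exists_lintegral_rpow_mul_fourierL2_centeredSeries_le_of_ne_top hβ hτ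
  obtain ⟨K, hK⟩ := exists_weightedNorm_one_le (r := 1 / 2) (s := τ) (by linarith)
  refine ⟨((2 : ℝ) ^ (2 * τ - 1)).toNNReal *
    ((2 * Real.pi).toNNReal * ((√(8 * Real.pi * β)).toNNReal * K) ^ 2 + C), fun c hc => ?_⟩
  have hc1 : weightedNorm 1 (1 / 2) c ≠ ⊤ :=
    ne_top_of_le_ne_top (ENNReal.mul_ne_top ENNReal.coe_ne_top hc) (hK c)
  have hmem := memLp_centeredSeries hβ hc1
  have hL2 : eLpNorm (centeredSeries β c) 2 volume ≤
      ENNReal.ofReal √(8 * Real.pi * β) * (K * weightedNorm 2 τ c) :=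
    (eLpNorm_centeredSeries_le hβ (summable_norm_of_weightedNorm one_half_pos.le hc1)).trans
      (mul_le_mul_right (hK c) _)
  refine ⟨hmem, (lintegral_one_add_rpow_mul_fourierL2_sq_le hmem (by linarith)).trans ?_⟩
  calc _ ≤ ENNReal.ofReal (2 ^ (2 * τ - 1)) * (ENNReal.ofReal (2 * Real.pi) *
          (ENNReal.ofReal √(8 * Real.pi * β) * (K * weightedNorm 2 τ c)) ^ 2 +
          C * weightedNorm 2 τ c ^ 2) := by
        gcongr
        exact hC c hc
    _ = _ := by
        simp only [ENNReal.ofReal]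
        push_cast
        ring

theorem memSobolevLine_of_lintegral_le {t B : ℝ} {g : ℝ → ℂ} (hB : 0 ≤ B)
    (hg : MemLp g 2 volume)
    (h : ∫⁻ k : ℝ, ENNReal.ofReal ((1 + |k|) ^ (2 * t)) * ‖fourierL2 g k‖ₑ ^ 2 ≤
      ENNReal.ofReal B) :
    MemSobolevLine t g ∧ normSobolevLine t g ≤ √B := by
  have hnonneg : ∀ k : ℝ, 0 ≤ (1 + |k|) ^ (2 * t) * ‖fourierL2 g k‖ ^ 2 := fun k => by positivity
  have hmeas : AEStronglyMeasurable fun k : ℝ => (1 + |k|) ^ (2 * t) * ‖fourierL2 g k‖ ^ 2 :=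
    (Measurable.aestronglyMeasurable (by fun_prop)).mul
      ((aestronglyMeasurable_fourierL2 g).norm.pow 2)
  have hle : ∫⁻ k : ℝ, ENNReal.ofReal ((1 + |k|) ^ (2 * t) * ‖fourierL2 g k‖ ^ 2) ≤
      ENNReal.ofReal B := by
    refine (lintegral_congr fun k => ?_).trans_le h
    rw [ENNReal.ofReal_mul (by positivity), ENNReal.ofReal_pow (norm_nonneg _), ofReal_norm]
  refine ⟨⟨hg, hmeas, ?_⟩, Real.sqrt_le_sqrt ?_⟩
  · rw [hasFiniteIntegral_iff_ofReal (ae_of_all _ hnonneg)]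
    exact hle.trans_lt ENNReal.ofReal_lt_top
  · rw [integral_eq_lintegral_of_nonneg_ae (ae_of_all _ hnonneg) hmeas]
    exact ENNReal.toReal_le_of_le_ofReal hB hle

theorem exists_normSobolevLine_centeredSeries_le (hβ : 0 < β) (hτ : 1 < τ) :
    ∃ C : ℝ≥0, ∀ c : ℤ → ℂ, weightedNorm 2 τ c ≠ ⊤ → ∀ t ≤ τ,
      MemSobolevLine t (centeredSeries β c) ∧
        ENNReal.ofReal (normSobolevLine t (centeredSeries β c)) ≤ C * weightedNorm 2 τ c := by
  obtain ⟨C, hC⟩ := exists_lintegral_one_add_rpow_mul_fourierL2_centeredSeries_le hβ hτ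
  refine ⟨NNReal.sqrt C, fun c hc t ht => ?_⟩
  obtain ⟨hmem, hintegrable⟩ := hC c hc
  have hmono : ∫⁻ k : ℝ, ENNReal.ofReal ((1 + |k|) ^ (2 * t)) *
      ‖fourierL2 (centeredSeries β c) k‖ₑ ^ 2 ≤
        ENNReal.ofReal (C * (weightedNorm 2 τ c).toReal ^ 2) := by
    rw [ENNReal.ofReal_mul C.coe_nonneg, ENNReal.ofReal_coe_nnreal,
      ENNReal.ofReal_pow ENNReal.toReal_nonneg, ENNReal.ofReal_toReal hc]
    refine (lintegral_mono fun k => ?_).trans hintegrable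
    gcongr
    simp
  obtain ⟨hline, hnorm⟩ := memSobolevLine_of_lintegral_le (by positivity) hmem hmono
  refine ⟨hline, (ENNReal.ofReal_le_ofReal hnorm).trans_eq ?_⟩
  rw [Real.sqrt_mul C.coe_nonneg, Real.sqrt_sq ENNReal.toReal_nonneg,
    ENNReal.ofReal_mul (Real.sqrt_nonneg _), ENNReal.ofReal_toReal hc, ← Real.coe_sqrt,
    ENNReal.ofReal_coe_nnreal]

end SobolevLine

section Convergence

variable {β s : ℝ}

theorem coe_mul_natCast_rpow_mul_ofReal (C : ℝ≥0) {n : ℕ} (hn : 1 ≤ n) (p N : ℝ) :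
    C * (n : ℝ≥0∞) ^ p * ENNReal.ofReal N = ENNReal.ofReal (C * (n : ℝ) ^ p * N) := by
  rw [ENNReal.ofReal_mul (by positivity), ENNReal.ofReal_mul C.coe_nonneg,
    ENNReal.ofReal_coe_nnreal, ← ENNReal.ofReal_rpow_of_pos (by exact_mod_cast hn),
    ENNReal.ofReal_natCast]

theorem normSobolevTorus_nonneg (s : ℝ) (F : Torus → ℂ) : 0 ≤ normSobolevTorus s F :=
  Real.sqrt_nonneg _

theorem le_coe_mul_mul_of_ofReal_le {K C : ℝ≥0} {n : ℕ} {x p N : ℝ} {y : ℝ≥0∞} (hN : 0 ≤ N)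
    (hx : ENNReal.ofReal x ≤ K * y) (hy : y ≤ ENNReal.ofReal (C * (n : ℝ) ^ p * N)) :
    x ≤ (K * C : ℝ≥0) * (n : ℝ) ^ p * N := by
  rw [← ENNReal.ofReal_le_ofReal_iff (by positivity), NNReal.coe_mul, mul_assoc, mul_assoc,
    ENNReal.ofReal_mul K.coe_nonneg, ENNReal.ofReal_coe_nnreal, ← mul_assoc]
  exact hx.trans (mul_le_mul_right hy _)

theorem exists_normC0_ratInterp_sub_le (hβ : 0 < β) {r : ℕ} (hr : (r : ℝ) < s - 1 / 2) :
    ∃ C : ℝ, ∀ f : ℝ → ℂ, Continuous f → MemSobolevTorus s (toTorus β f) → ∀ n : ℕ, 1 ≤ n →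
      MemC0 r (fun x => ratInterp β n f x - f x) ∧
      normC0 r (fun x => ratInterp β n f x - f x) ≤
        C * (n : ℝ) ^ (1 / 2 + r - s) * normSobolevTorus s (toTorus β f) := by
  have hs : 1 / 2 < s := by linarith [(r.cast_nonneg : (0 : ℝ) ≤ r)]
  obtain ⟨C, hC⟩ := exists_weightedNorm_one_errCoeff_le r.cast_nonneg hr
  obtain ⟨K, hK⟩ := exists_normC0_mobiusSeries_le hβ r
  refine ⟨(K * C : ℝ≥0), fun f hf hF n hn => ?_⟩
  obtain ⟨a, ha, hnorm, heq⟩ := exists_ratInterp_sub_eq hβ hs hf hF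
  have herr := hC n hn a ha.of_norm
  rw [hnorm, coe_mul_natCast_rpow_mul_ofReal C hn] at herr
  rw [heq n hn]
  refine ⟨memC0_mobiusSeries hβ (ne_top_of_le_ne_top ENNReal.ofReal_ne_top herr)
    (tsum_errCoeff hn ha.of_norm), ?_⟩
  exact le_coe_mul_mul_of_ofReal_le (normSobolevTorus_nonneg s _) (hK _) herr

theorem exists_normSobolevLine_ratInterp_sub_le_of_le (hβ : 0 < β) {τ : ℝ} (hτ : 1 < τ)
    (hτs : τ ≤ s) :
    ∃ C : ℝ≥0, ∀ f : ℝ → ℂ, Continuous f → MemSobolevTorus s (toTorus β f) →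
      ∀ n : ℕ, 1 ≤ n → ∀ t ≤ τ, MemSobolevLine t (fun x => ratInterp β n f x - f x) ∧
        normSobolevLine t (fun x => ratInterp β n f x - f x) ≤
          C * (n : ℝ) ^ (τ - s) * normSobolevTorus s (toTorus β f) := by
  have hs : 1 / 2 < s := by linarith
  obtain ⟨C, hC⟩ := exists_weightedNorm_two_errCoeff_le hs (by linarith) hτs
  obtain ⟨K, hK⟩ := exists_normSobolevLine_centeredSeries_le hβ hτ
  refine ⟨K * C, fun f hf hF n hn t ht => ?_⟩
  obtain ⟨a, ha, hnorm, heq⟩ := exists_ratInterp_sub_eq hβ hs hf hF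
  have herr := hC n hn a ha.of_norm
  rw [hnorm, coe_mul_natCast_rpow_mul_ofReal C hn] at herr
  rw [heq n hn, ← centeredSeries_of_tsum_eq_zero (tsum_errCoeff hn ha.of_norm)]
  obtain ⟨hline, hle⟩ := hK _ (ne_top_of_le_ne_top ENNReal.ofReal_ne_top herr) t ht
  exact ⟨hline, le_coe_mul_mul_of_ofReal_le (normSobolevTorus_nonneg s _) hle herr⟩

theorem exists_normSobolevLine_ratInterp_sub_le (hβ : 0 < β) (s : ℝ) :
    ∃ C₁ C₂ : ℝ → ℝ, ∀ ε : ℝ, 0 < ε → 1 + ε ≤ s → ∀ t : ℝ, t ≤ s →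
      ∀ f : ℝ → ℂ, Continuous f → MemSobolevTorus s (toTorus β f) → ∀ n : ℕ, 1 ≤ n →
        MemSobolevLine t (fun x => ratInterp β n f x - f x) ∧
        normSobolevLine t (fun x => ratInterp β n f x - f x) ≤
          (C₁ ε * (n : ℝ) ^ (1 + ε - s) + C₂ t * (n : ℝ) ^ (t - s)) *
            normSobolevTorus s (toTorus β f) := by
  have hexists : ∀ τ : ℝ, ∃ C : ℝ≥0, 1 < τ → τ ≤ s → ∀ f : ℝ → ℂ, Continuous f →
      MemSobolevTorus s (toTorus β f) → ∀ n : ℕ, 1 ≤ n → ∀ t ≤ τ,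
        MemSobolevLine t (fun x => ratInterp β n f x - f x) ∧
        normSobolevLine t (fun x => ratInterp β n f x - f x) ≤
          C * (n : ℝ) ^ (τ - s) * normSobolevTorus s (toTorus β f) := fun τ => by
    by_cases hτ : 1 < τ ∧ τ ≤ s
    · obtain ⟨C, hC⟩ := exists_normSobolevLine_ratInterp_sub_le_of_le hβ hτ.1 hτ.2
      exact ⟨C, fun _ _ => hC⟩
    · exact ⟨0, fun h1 hs => absurd ⟨h1, hs⟩ hτ⟩
  choose C hC using hexists
  refine ⟨fun ε => C (1 + ε), fun t => C t, fun ε hε hεs t hts f hf hF n hn => ?_⟩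
  have hN := normSobolevTorus_nonneg s (toTorus β f)
  have hpow : ∀ p : ℝ, 0 ≤ (n : ℝ) ^ p := fun p => by positivity
  rcases le_or_gt t (1 + ε) with ht | ht
  · refine (hC (1 + ε) (by linarith) hεs f hf hF n hn t ht).imp_right fun h => h.trans ?_
    gcongr
    exact le_add_of_nonneg_right (mul_nonneg (C t).coe_nonneg (hpow _))
  · refine (hC t (by linarith) hts f hf hF n hn t le_rfl).imp_right fun h => h.trans ?_
    gcongr
    exact le_add_of_nonneg_left (mul_nonneg (C (1 + ε)).coe_nonneg (hpow _))

theorem exists_hasPVIntegral_ratInterp_sub (hβ : 0 < β) (hs : 3 / 2 < s) :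
    ∃ C : ℝ≥0, ∀ f : ℝ → ℂ, Continuous f → MemSobolevTorus s (toTorus β f) → ∀ n : ℕ, 1 ≤ n →
      ∃ I : ℂ, HasPVIntegral (fun x => ratInterp β n f x - f x) I ∧
        ‖I‖ ≤ C * (n : ℝ) ^ (3 / 2 - s) * normSobolevTorus s (toTorus β f) := by
  obtain ⟨C, hC⟩ := exists_weightedNorm_one_errCoeff_le (s := s) zero_le_one (by linarith)
  refine ⟨(4 * Real.pi * β).toNNReal * C, fun f hf hF n hn => ?_⟩
  obtain ⟨a, ha, hnorm, heq⟩ := exists_ratInterp_sub_eq hβ (by linarith) hf hF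
  have herr := hC n hn a ha.of_norm
  rw [hnorm, coe_mul_natCast_rpow_mul_ofReal C hn] at herr
  rw [heq n hn]
  obtain ⟨I, hI, hle⟩ := exists_hasPVIntegral_mobiusSeries hβ
    (ne_top_of_le_ne_top ENNReal.ofReal_ne_top herr) (tsum_errCoeff hn ha.of_norm)
  rw [← ofReal_norm] at hle
  refine ⟨I, hI, ?_⟩
  convert le_coe_mul_mul_of_ofReal_le (normSobolevTorus_nonneg s _) hle herr using 4
  norm_num

theorem exists_isWeakDeriv_ratInterp_sub (hβ : 0 < β) {j : ℕ} (hj : 0 < j) (hjs : (j : ℝ) ≤ s) :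
    ∃ C : ℝ, ∀ f : ℝ → ℂ, Continuous f → MemSobolevTorus s (toTorus β f) → ∀ n : ℕ, 1 ≤ n →
      ∃ w : ℝ → ℂ, IsWeakDeriv j (fun x => ratInterp β n f x - f x) w ∧ Integrable w ∧
        ∫ x, ‖w x‖ ≤ C * (n : ℝ) ^ ((j : ℝ) - s) * normSobolevTorus s (toTorus β f) := by
  have hs : 1 / 2 < s := by linarith [(Nat.one_le_cast (α := ℝ)).mpr hj]
  obtain ⟨i, rfl⟩ := Nat.exists_eq_succ_of_ne_zero hj.ne'
  obtain ⟨C, hC⟩ := exists_weightedNorm_two_errCoeff_le hs (Nat.cast_nonneg _) hjs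
  obtain ⟨K, hK⟩ := exists_isWeakDeriv_mobiusSeries hβ i
  refine ⟨(K * C : ℝ≥0), fun f hf hF n hn => ?_⟩
  obtain ⟨a, ha, hnorm, heq⟩ := exists_ratInterp_sub_eq hβ hs hf hF
  have herr := hC n hn a ha.of_norm
  rw [hnorm, coe_mul_natCast_rpow_mul_ofReal C hn] at herr
  obtain ⟨w, hw, hwint, hle⟩ := hK _ (ne_top_of_le_ne_top ENNReal.ofReal_ne_top herr)
  rw [eLpNorm_one_eq_lintegral_enorm, ← ofReal_integral_norm_eq_lintegral_enorm hwint] at hle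
  rw [heq n hn]
  exact ⟨w, hw, hwint, le_coe_mul_mul_of_ofReal_le (normSobolevTorus_nonneg s _) hle herr⟩

end Convergence

end

end RationalInterpolation

open RationalInterpolation in
theorem mainTheorem1_general (β : ℝ) (hβ : 0 < β) (s : ℝ) :
    (∀ r : ℕ, (r : ℝ) < s - 1 / 2 → ∃ C : ℝ,
      ∀ f : ℝ → ℂ, Continuous f → MemSobolevTorus s (toTorus β f) → ∀ n : ℕ, 1 ≤ n →
        MemC0 r (fun x => ratInterp β n f x - f x) ∧
        normC0 r (fun x => ratInterp β n f x - f x) ≤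
          C * (n : ℝ) ^ (1 / 2 + r - s) * normSobolevTorus s (toTorus β f)) ∧
    (∃ C₁ C₂ : ℝ → ℝ, ∀ ε : ℝ, 0 < ε → 1 + ε ≤ s → ∀ t : ℝ, t ≤ s →
      ∀ f : ℝ → ℂ, Continuous f → MemSobolevTorus s (toTorus β f) → ∀ n : ℕ, 1 ≤ n →
        MemSobolevLine t (fun x => ratInterp β n f x - f x) ∧
        normSobolevLine t (fun x => ratInterp β n f x - f x) ≤
          (C₁ ε * (n : ℝ) ^ (1 + ε - s) + C₂ t * (n : ℝ) ^ (t - s)) *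
            normSobolevTorus s (toTorus β f)) ∧
    (∀ ε : ℝ, 0 ≤ ε → 3 / 2 + ε < s → ∃ C : ℝ,
      ∀ f : ℝ → ℂ, Continuous f → MemSobolevTorus s (toTorus β f) → ∀ n : ℕ, 1 ≤ n →
        ∃ I : ℂ, HasPVIntegral (fun x => ratInterp β n f x - f x) I ∧
          ‖I‖ ≤ C * (n : ℝ) ^ (3 / 2 + ε - s) * normSobolevTorus s (toTorus β f)) ∧
    (∀ j : ℕ, 0 < j → (j : ℝ) ≤ s → ∃ C : ℝ,
      ∀ f : ℝ → ℂ, Continuous f → MemSobolevTorus s (toTorus β f) → ∀ n : ℕ, 1 ≤ n →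
        ∃ w : ℝ → ℂ, IsWeakDeriv j (fun x => ratInterp β n f x - f x) w ∧
          MeasureTheory.Integrable w ∧
          ∫ x, ‖w x‖ ≤ C * (n : ℝ) ^ ((j : ℝ) - s) * normSobolevTorus s (toTorus β f)) := by
  refine ⟨fun r hr => exists_normC0_ratInterp_sub_le hβ hr,
    exists_normSobolevLine_ratInterp_sub_le hβ s, fun ε hε hεs => ?_,
    fun j hj hjs => exists_isWeakDeriv_ratInterp_sub hβ hj hjs⟩
  obtain ⟨C, hC⟩ := exists_hasPVIntegral_ratInterp_sub hβ (s := s) (by linarith)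
  refine ⟨C, fun f hf hF n hn => ?_⟩
  obtain ⟨I, hI, hle⟩ := hC f hf hF n hn
  have hN := normSobolevTorus_nonneg s (toTorus β f)
  refine ⟨I, hI, hle.trans ?_⟩
  gcongr
  · exact_mod_cast hn
  · linarith

open RationalInterpolation in
theorem mainTheorem1 (β : ℝ) (hβ : 0 < β) (s : ℝ) (hs : 1 / 2 < s) :
    -- convergence in `C_0^r(ℝ)`
    (∀ r : ℕ, (r : ℝ) < s - 1 / 2 → ∃ C : ℝ,
      ∀ f : ℝ → ℂ, Continuous f → MemSobolevTorus s (toTorus β f) → ∀ n : ℕ, 1 ≤ n →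
        MemC0 r (fun x => ratInterp β n f x - f x) ∧
        normC0 r (fun x => ratInterp β n f x - f x) ≤
          C * (n : ℝ) ^ (1 / 2 + r - s) * normSobolevTorus s (toTorus β f)) ∧
    -- convergence in `H^t(ℝ)`; the first constant depends on `ε` only, the second on `t` only
    (∃ C₁ C₂ : ℝ → ℝ, ∀ ε : ℝ, 0 < ε → 1 + ε < s → ∀ t : ℝ, t < s →
      ∀ f : ℝ → ℂ, Continuous f → MemSobolevTorus s (toTorus β f) → ∀ n : ℕ, 1 ≤ n →
        MemSobolevLine t (fun x => ratInterp β n f x - f x) ∧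
        normSobolevLine t (fun x => ratInterp β n f x - f x) ≤
          (C₁ ε * (n : ℝ) ^ (1 + ε - s) + C₂ t * (n : ℝ) ^ (t - s)) *
            normSobolevTorus s (toTorus β f)) ∧
    -- convergence of the principal-value integral
    (∀ ε : ℝ, 0 < ε → 3 / 2 + ε < s → ∃ C : ℝ,
      ∀ f : ℝ → ℂ, Continuous f → MemSobolevTorus s (toTorus β f) → ∀ n : ℕ, 1 ≤ n →
        ∃ I : ℂ, HasPVIntegral (fun x => ratInterp β n f x - f x) I ∧
          ‖I‖ ≤ C * (n : ℝ) ^ (3 / 2 + ε - s) * normSobolevTorus s (toTorus β f)) ∧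
    -- convergence of the derivatives in `L¹(ℝ)`
    (∀ j : ℕ, 0 < j → (j : ℝ) ≤ s → ∃ C : ℝ,
      ∀ f : ℝ → ℂ, Continuous f → MemSobolevTorus s (toTorus β f) → ∀ n : ℕ, 1 ≤ n →
        ∃ w : ℝ → ℂ, IsWeakDeriv j (fun x => ratInterp β n f x - f x) w ∧
          MeasureTheory.Integrable w ∧
          ∫ x, ‖w x‖ ≤ C * (n : ℝ) ^ ((j : ℝ) - s) * normSobolevTorus s (toTorus β f)) := by
  obtain ⟨hC0, ⟨C₁, C₂, hLine⟩, hPV, hWeak⟩ := mainTheorem1_general β hβ s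
  exact ⟨hC0, ⟨C₁, C₂, fun ε hε hεs t hts => hLine ε hε hεs.le t hts.le⟩,
    fun ε hε => hPV ε hε.le, hWeak⟩
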